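/- \textbf{Setting.} Let $d\ge 1$, $L>0$, $\bold{j}_*\in\mathbb{Z}^d\setminus\{\bold 0\}$, $\phi>0$ (the Fourier component $\phi_{\bold j_*}=\phi_{-\bold j_*}$ of the pair potential) and let $N>0$ be even. Put $k_{\bold j}=\frac{2\pi}{L}\bold j$, $\Delta_0=\min_{\bold j\ne \bold 0}k_{\bold j}^2$, $\epsilon=k_{\bold j_*}^2/\phi$, $E^{Bog}=-[k_{\bold j_*}^2+\phi-\sqrt{(k_{\bold j_*}^2)^2+2\phi k_{\bold j_*}^2}]$ and $w=\sqrt{\epsilon}\,\phi\sqrt{\epsilon^2+2\epsilon}$. Let $\mathcal F^N$ be the $N$-particle subspace of the bosonic Fock space over $L^2$ of the periodic box of side $L$, with creation and annihilation operators $a^*_{\bold j},a_{\bold j}$ of the modes $k_{\bold j}$, and on $\mathcal F^N$ let $$W=\tfrac{\phi}{N}a_{\bold 0}^*a_{\bold 0}^*a_{\bold j_*}a_{-\bold j_*},\quad W^*=\tfrac{\phi}{N}a_{\bold 0}a_{\bold 0}a^*_{\bold j_*}a^*_{-\bold j_*},$$ $$H=\sum_{\bold j\ne\pm\bold j_*}k_{\bold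 j}^2a_{\bold j}^*a_{\bold j}+\big(k_{\bold j_*}^2+\tfrac{\phi}{N}a_{\bold 0}^*a_{\bold 0}\big)\big(a^*_{\bold j_*}a_{\bold j_*}+a^*_{-\bold j_*}a_{-\bold j_*}\big)+W+W^*$$ on the domain of the kinetic energy (this is $H^{Bog}_{\bold j_*}$). For even $i$ let $Q^{(i,i+1)}$ and $Q^{(>i+1)}$ be the projections onto the span of the product states with $N-i$ or $N-i-1$, respectively with fewer than $N-i-1$, particles in the modes $\pm\bold j_*$. For real $z$ put $\mathscr K^{(-2)}(z)=H-z$ and, for $i=0,2,\dots,N-2$, $$\mathscr K^{(i)}=Q^{(>i+1)}\mathscr K^{(i-2)}Q^{(>i+1)}-Q^{(>i+1)}\mathscr K^{(i-2)}Q^{(i,i+1)}\frac{1}{Q^{(i,i+1)}\mathscr K^{(i-2)}Q^{(i,i+1)}}Q^{(i,i+1)}\mathscr K^{(i-2)}Q^{(>i+1)}.$$ Write $R_r(z)$ for the inverse of $Q^{(N-2r,N-2r+1)}\mathscr K^{(N-2r-2)}(z)Q^{(N-2r,N-2r+1)}$ on $Q^{(N-2r,N-2r+1)}\mathcal F^N$,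 $W^*_{i,i'}=Q^{(i,i+1)}W^*Q^{(i',i'+1)}$, let $\eta$ be the normalized state with all $N$ particles in the zero mode, and $f(z)=-z-\langle\eta,W R_1(z)W^*\eta\rangle$. We say that \emph{$z_*$ is the ground state energy given by the flow} if (i) for all $z\le E^{Bog}+w$ the inverses $R_r(z)$, $1\le r\le N/2$, exist as bounded operators, and $z_*$ is the only zero of $f$ in $(-\infty,E^{Bog}+w]$; (ii) the spectrum of $H$ is contained in $[z_*,\infty)$; (iii) $z_*$ is an eigenvalue of $H$ whose eigenspace is one-dimensional and spanned by $$\psi=\eta-u_1-\sum_{l=2}^{N/2}u_l,\qquad u_1=R_1(z_*)Q^{(N-2,N-1)}W^*\eta,\quad u_l=\Big\{\prod_{r=l}^{2}\big[-R_r(z_*)W^*_{N-2r,N-2r+2}\big]\Big\}u_1$$ (the factor with $r=l$ stands leftmost). We say that \emph{the gap above $z_*$ is at least $g$} if the spectrum of $H$ without $z_*$ is contained in $[z_*+g,\infty)$. Put $g_0=\min\{\frac{\Delta_0}{2},\frac{3-2\sqrt2}{6}\,w\}$. Consider the conditions $$(\mathrm A)_{\gamma,k}:\ \epsilon^2+\tfrac{\epsilon}{N^\gamma}+\tfrac1N\le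 k\,\epsilon\sqrt\epsilon,\quad \tfrac{1}{N^{1-\gamma}}\le k\,\epsilon;\qquad (\mathrm B)_{\mu,\theta,C}:\ \tfrac{\phi}{\Delta_0}\tfrac{N^\mu}{N(N-N^\mu)}<\tfrac12,\quad \tfrac1{N^\mu}\le C(\sqrt\epsilon)^{1+\theta}.$$ \textbf{Theorem.} (1) For every $\gamma\in(0,1)$ there is $k>0$ such that for all $\mu\in(0,1)$, $\theta,C>0$ there is $\epsilon_0>0$ such that for every $\epsilon\in(0,\epsilon_0]$ there is a summable sequence $(c_l)_{l\ge1}$ with the following property. For all $d,L,\phi,\bold j_*,N$ as above with $k_{\bold j_*}^2/\phi=\epsilon$ that satisfy $(\mathrm A)_{\gamma,k}$ and $(\mathrm B)_{\mu,\theta,C}$ there is a ground state energy $z_*$ given by the flow, the gap above $z_*$ is at least $g_0$, and $\|u_l\|\le c_l$ for $1\le l\le N/2$. (2) The conditions hold in the mean field regime: for all $\gamma,\mu\in(0,1)$, $k,\theta,C>0$ there is $\epsilon_0>0$ such that for all $d,L,\phi,\bold j_*$ with $\epsilon\le\epsilon_0$, $(\mathrm A)_{\gamma,k}$ and $(\mathrm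 B)_{\mu,\theta,C}$ hold for all sufficiently large $N$. They hold at fixed large density: for all $k,C>0$ there is $\epsilon_0>0$ such that for every $\phi>0$ there is $\rho_0>0$ such that $(\mathrm A)_{1/3,k}$ and $(\mathrm B)_{2/3,1,C}$ hold whenever $d\ge3$, $\rho\ge\rho_0$, $L>1$, $N=\rho L^d$ and $\epsilon\le\epsilon_0$. (3) (Mean field regime.) There is $\epsilon_0>0$ such that for all $d\ge1$, $L,\phi,\bold j_*$ with $\epsilon\le\epsilon_0$: for all sufficiently large even $N$ there is a ground state energy $z_*$ given by the flow, the gap above it is at least $\frac{\Delta_0}{2}$, and $z_*\to E^{Bog}$ as $N\to\infty$. (4) (Fixed density.) There is $\epsilon_0>0$ such that for every $\phi>0$ there is $\rho_0>0$ such that, whenever $d\ge3$, $\rho\ge\rho_0$, $L>1$, $N=\rho L^d$ is an even integer and $\epsilon\le\epsilon_0$, there is a ground state energy $z_*$ given by the flow and the gap above it is at least $g_0$. Moreover, at fixed $\bold j_*$, $\phi$ and $\rho$, as $L\to\infty$ with $N=\rho L^d$ an even integer, the ground state energy $z_*$ given by the flow exists for $L$ large and $z_*-E^{Bog}\to0$: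 for every $\rho>0$ if $d\ge4$, and for every $\rho\ge\rho_0(\phi)$ if $d=3$. -/

import Mathlib

open scoped ENNReal
open Filter Topology

noncomputable section

namespace ThreeMode

/-! ### Fock space of a gas in the periodic box of side `L` in occupation-number representation

The one-particle space `L²(Λ)` has the orthonormal basis of plane waves `e^{i k_p · x} / |Λ|^{1/2}`,
`k_p = (2π/L) p`, `p ∈ ℤ^d`; a product state of the bosonic Fock space is given by finitely many
occupation numbers, and these states form an orthonormal basis. -/

/-- Field modes, labelled by `ℤ^d`. -/
abbrev Mode (d : ℕ) := Fin d → ℤ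

/-- Occupation numbers of a product state. -/
abbrev Occ (d : ℕ) := Mode d →₀ ℕ

/-- The space of vectors of the Fock space with a bounded number of particles: square-summable
coefficients `ψ n` in the product-state basis, vanishing for large particle number. -/
def FinFock (d : ℕ) : Submodule ℂ (Occ d → ℂ) where
  carrier := {ψ | Memℓp ψ 2 ∧ ∃ M : ℕ, ∀ n, M < n.degree → ψ n = 0}
  add_mem' := by
    rintro ψ χ ⟨h1, M1, h2⟩ ⟨h3, M2, h4⟩
    refine ⟨h1.add h3, max M1 M2, fun n hn => ?_⟩
    simp [h2 n (lt_of_le_of_lt (le_max_left _ _) hn), h4 n (lt_of_le_of_lt (le_max_right _ _) hn)]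
  zero_mem' := ⟨zero_memℓp, 0, fun _ _ => rfl⟩
  smul_mem' := by
    rintro c ψ ⟨h1, M, h2⟩
    exact ⟨h1.const_smul c, M, fun n hn => by simp [h2 n hn]⟩

theorem memℓp_two_iff {ι : Type*} (ψ : ι → ℂ) : Memℓp ψ 2 ↔ Summable fun n => ‖ψ n‖ ^ 2 := by
  rw [memℓp_gen_iff (by norm_num)]
  norm_num

theorem occ_le_degree {d : ℕ} (n : Occ d) (p : Mode d) : n p ≤ n.degree := by
  by_cases h : p ∈ n.support
  · exact Finset.single_le_sum (f := fun q => n q) (fun _ _ => Nat.zero_le _) h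
  · simp [Finsupp.notMem_support_iff.mp h]

/-- The annihilation operator `a_p`: `(a_p ψ)(n) = √(n_p + 1) ψ(n + δ_p)`. -/
def annih {d : ℕ} (p : Mode d) : FinFock d →ₗ[ℂ] FinFock d where
  toFun ψ := ⟨fun n => (Real.sqrt (n p + 1) : ℂ) * ψ.1 (n + Finsupp.single p 1), by
    obtain ⟨ψ, h1, M, h2⟩ := ψ
    have hz : ∀ n : Occ d, M ≤ n.degree → ψ (n + Finsupp.single p 1) = 0 := fun n hn =>
      h2 _ (by simp [map_add]; omega)
    refine ⟨?_, M, fun n hn => by simp [hz n hn.le]⟩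
    rw [memℓp_two_iff] at h1 ⊢
    have hs : Summable fun n : Occ d => (M + 1 : ℝ) * ‖ψ (n + Finsupp.single p 1)‖ ^ 2 :=
      (h1.comp_injective (add_left_injective (Finsupp.single p 1 : Occ d))).mul_left _
    refine Summable.of_nonneg_of_le (fun n => by positivity) (fun n => ?_) hs
    by_cases hn : M ≤ n.degree
    · simp [hz n hn]
    · have h3 : (n p : ℝ) + 1 ≤ M + 1 := by
        have := occ_le_degree n p
        exact_mod_cast (by omega : n p + 1 ≤ M + 1)
      rw [norm_mul, mul_pow, Complex.norm_real, Real.norm_eq_abs, sq_abs,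
        Real.sq_sqrt (by positivity)]
      gcongr⟩
  map_add' ψ χ := by ext n; simp [mul_add]
  map_smul' c ψ := by ext n; simp [mul_left_comm]

/-- The creation operator `a*_p`: `(a*_p ψ)(n) = √(n_p) ψ(n - δ_p)`, which is `0` if `n_p = 0`. -/
def create {d : ℕ} (p : Mode d) : FinFock d →ₗ[ℂ] FinFock d where
  toFun ψ := ⟨fun n => (Real.sqrt (n p) : ℂ) * ψ.1 (n - Finsupp.single p 1), by
    obtain ⟨ψ, h1, M, h2⟩ := ψ
    have hex : ∀ n : Occ d, n p ≠ 0 → ∃ m, m + Finsupp.single p 1 = n := fun n hn =>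
      ⟨n - Finsupp.single p 1, tsub_add_cancel_of_le (by
        rw [Finsupp.single_le_iff]; omega)⟩
    refine ⟨?_, M + 1, fun n hn => ?_⟩
    · rw [memℓp_two_iff] at h1 ⊢
      rw [← (add_left_injective (Finsupp.single p 1 : Occ d)).summable_iff]
      · refine Summable.of_nonneg_of_le (fun n => sq_nonneg _) (fun n => ?_)
          (h1.mul_left (M + 1 : ℝ))
        by_cases hn : M < n.degree
        · simp [h2 n hn]
        · have h3 : (n p : ℝ) + 1 ≤ M + 1 := by
            have := occ_le_degree n p
            exact_mod_cast (by omega : n p + 1 ≤ M + 1)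
          simp only [Function.comp, Finsupp.add_apply, Finsupp.single_eq_same, Nat.cast_add,
            Nat.cast_one, add_tsub_cancel_right]
          rw [norm_mul, mul_pow, Complex.norm_real, Real.norm_eq_abs, sq_abs,
            Real.sq_sqrt (by positivity)]
          gcongr
      · intro n hn
        have : n p = 0 := by
          by_contra h
          exact hn (hex n h)
        simp [this]
    · by_cases h : n p = 0
      · simp [h]
      · obtain ⟨m, rfl⟩ := hex n h
        have : M < m.degree := by simp [map_add] at hn; omega
        simp [h2 m this]⟩
  map_add' ψ χ := by ext n; simp [mul_add]
  map_smul' c ψ := by ext n; simp [mul_left_comm]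

/-- Product states with exactly `N` particles. -/
abbrev Conf (d N : ℕ) := {n : Occ d // n.degree = N}

/-- The `N`-particle Hilbert space `F^N`. -/
abbrev Fock (d N : ℕ) := lp (fun _ : Conf d N => ℂ) 2

/-- The inclusion of `F^N` into the Fock space. -/
def incl (d N : ℕ) : Fock d N →ₗ[ℂ] FinFock d where
  toFun ψ := ⟨fun n => if h : n.degree = N then ψ ⟨n, h⟩ else 0, by
    refine ⟨?_, N, fun n hn => dif_neg hn.ne'⟩
    have h1 := (memℓp_two_iff _).1 (lp.memℓp ψ)
    rw [memℓp_two_iff, ← (Subtype.val_injective (p := fun n : Occ d => n.degree = N)).summable_iff]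
    · refine h1.congr fun n => ?_
      simp [n.2]
    · intro n hn
      have : ¬ n.degree = N := fun h => hn ⟨⟨n, h⟩, rfl⟩
      simp [this]⟩
  map_add' ψ χ := by
    ext n
    by_cases h : n.degree = N <;> simp [h]
  map_smul' c ψ := by
    ext n
    by_cases h : n.degree = N <;> simp [h]

/-- The orthogonal projection of the Fock space onto `F^N`. -/
def proj (d N : ℕ) : FinFock d →ₗ[ℂ] Fock d N where
  toFun ψ := ⟨fun n => ψ.1 n.1, by
    change Memℓp _ 2
    have h1 := (memℓp_two_iff _).1 ψ.2.1
    rw [memℓp_two_iff]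
    exact h1.comp_injective Subtype.val_injective⟩
  map_add' _ _ := rfl
  map_smul' _ _ := rfl

/-- The restriction to `F^N` of an operator which conserves the number of particles. -/
def onFock {d : ℕ} (N : ℕ) (A : FinFock d →ₗ[ℂ] FinFock d) : Fock d N →ₗ[ℂ] Fock d N :=
  proj d N ∘ₗ A ∘ₗ incl d N

/-- The projection onto the span of the product states in `S`. -/
def maskOp {d N : ℕ} (S : Set (Conf d N)) : Fock d N →ₗ[ℂ] Fock d N where
  toFun ψ := ⟨S.indicator ψ, by
    change Memℓp _ 2
    have h1 := (memℓp_two_iff _).1 (lp.memℓp ψ)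
    rw [memℓp_two_iff]
    refine Summable.of_nonneg_of_le (fun n => by positivity) (fun n => ?_) h1
    gcongr
    exact norm_indicator_le_norm_self _ _⟩
  map_add' ψ χ := by
    ext n
    exact congrFun (Set.indicator_add S (ψ : Conf d N → ℂ) χ) n
  map_smul' c ψ := by
    ext n
    exact congrFun (Set.indicator_const_smul S c (ψ : Conf d N → ℂ)) n

/-! ### The Hamiltonian -/

/-- The kinetic energy `k_p²` of the mode `p`, where `k_p = (2π/L) p`. -/
def kSq {d : ℕ} (L : ℝ) (p : Mode d) : ℝ := ∑ i, (2 * Real.pi / L * (p i : ℝ)) ^ 2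

/-- `Δ₀`, the minimum of `k_p²` over `p ≠ 0`. -/
def gap0 (d : ℕ) (L : ℝ) : ℝ := ⨅ p : {p : Mode d // p ≠ 0}, kSq L p.1

/-- The kinetic energy `∑_p k_p² n_p` of a product state. -/
def kinEnergy {d : ℕ} (L : ℝ) (n : Occ d) : ℝ := n.sum fun p m => (m : ℝ) * kSq L p

/-- The domain in `F^N` of the kinetic energy `∑_p k_p² a*_p a_p`, which is also the domain of the
Bogoliubov Hamiltonian (the interaction is bounded on `F^N`). -/
def dom (d N : ℕ) (L : ℝ) : Submodule ℂ (Fock d N) where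
  carrier := {ψ | Memℓp (fun n : Conf d N => (kinEnergy L n.1 : ℂ) * ψ n) 2}
  add_mem' := by
    intro ψ χ h1 h2
    have := h1.add h2
    change Memℓp _ 2
    convert this using 2 with n
    simp [mul_add]
  zero_mem' := by
    change Memℓp _ 2
    convert zero_memℓp (E := fun _ : Conf d N => ℂ) (p := 2) using 2
    simp
  smul_mem' := by
    intro c ψ h1
    have := h1.const_smul c
    change Memℓp _ 2
    convert this using 2 with n
    simp [mul_left_comm]

/-- The projection onto the span of the product states in `S`, on the domain. -/
def maskDom {d N : ℕ} (L : ℝ) (S : Set (Conf d N)) : dom d N L →ₗ[ℂ] dom d N L :=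
  (maskOp S).restrict (p := dom d N L) (q := dom d N L) (by
    intro ψ hψ
    change Memℓp _ 2 at hψ
    change Memℓp _ 2
    rw [memℓp_two_iff] at hψ ⊢
    refine Summable.of_nonneg_of_le (fun n => by positivity) (fun n => ?_) hψ
    rw [norm_mul, norm_mul]
    gcongr
    exact norm_indicator_le_norm_self _ _)

/-- The kinetic energy operator `∑_p k_p² a*_p a_p`. -/
def kinetic (d N : ℕ) (L : ℝ) : dom d N L →ₗ[ℂ] Fock d N where
  toFun ψ := ⟨fun n => (kinEnergy L n.1 : ℂ) * ψ.1 n, ψ.2⟩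
  map_add' ψ χ := by
    ext n
    exact mul_add _ _ _
  map_smul' c ψ := by
    ext n
    exact mul_left_comm _ _ _

/-- `W_j = φ_j a*_0 a*_0 a_j a_{-j} / N`. -/
def W {d : ℕ} (N : ℕ) (φ : ℝ) (j : Mode d) : Fock d N →ₗ[ℂ] Fock d N :=
  ((φ / N : ℝ) : ℂ) • onFock N (create 0 ∘ₗ create 0 ∘ₗ annih j ∘ₗ annih (-j))

/-- `W*_j = φ_j a_0 a_0 a*_j a*_{-j} / N`. -/
def Wstar {d : ℕ} (N : ℕ) (φ : ℝ) (j : Mode d) : Fock d N →ₗ[ℂ] Fock d N :=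
  ((φ / N : ℝ) : ℂ) • onFock N (annih 0 ∘ₗ annih 0 ∘ₗ create j ∘ₗ create (-j))

/-- `φ_j (a*_0 a_0 / N) (a*_j a_j + a*_{-j} a_{-j})`. -/
def diagInt {d : ℕ} (N : ℕ) (φ : ℝ) (j : Mode d) : Fock d N →ₗ[ℂ] Fock d N :=
  ((φ / N : ℝ) : ℂ) • onFock N
    (create 0 ∘ₗ annih 0 ∘ₗ (create j ∘ₗ annih j + create (-j) ∘ₗ annih (-j)))

/-- The three-modes Bogoliubov Hamiltonian on `F^N`,
`H = ∑_{p ≠ ±j} k_p² a*_p a_p + (k_j² + φ_j a*_0 a_0 / N)(a*_j a_j + a*_{-j} a_{-j}) + W_j + W*_j`. -/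
def hBog {d : ℕ} (N : ℕ) (L φ : ℝ) (j : Mode d) : dom d N L →ₗ[ℂ] Fock d N :=
  kinetic d N L + (diagInt N φ j + W N φ j + Wstar N φ j) ∘ₗ (dom d N L).subtype

/-! ### Inverses, resolvent set and spectrum -/

/-- `R` is a bounded inverse of `Q A Q` on `Q F^N` (extended by `0` to the complement), where `Q` is
the projection onto the span of the product states in `S`. -/
structure IsInverseOn {d N : ℕ} {L : ℝ} (S : Set (Conf d N)) (A : dom d N L →ₗ[ℂ] Fock d N)
    (R : Fock d N →ₗ[ℂ] dom d N L) : Prop where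
  bounded : ∃ C : ℝ, ∀ y, ‖(R y : Fock d N)‖ ≤ C * ‖y‖
  range : ∀ y, maskDom L S (R y) = R y
  right : ∀ y, maskOp S (A (R y)) = maskOp S y
  left : ∀ x, maskDom L S x = x → R (maskOp S (A x)) = x

/-- `Q A Q` is bounded invertible on `Q F^N`. -/
def InvertibleOn {d N : ℕ} {L : ℝ} (S : Set (Conf d N)) (A : dom d N L →ₗ[ℂ] Fock d N) : Prop :=
  ∃ R, IsInverseOn S A R

open Classical in
/-- The operator `1 / (Q A Q)` on `Q F^N`; it is unique if it exists, and `0` is the value where it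
does not exist. -/
def invOn {d N : ℕ} {L : ℝ} (S : Set (Conf d N)) (A : dom d N L →ₗ[ℂ] Fock d N) :
    Fock d N →ₗ[ℂ] dom d N L :=
  if h : InvertibleOn S A then h.choose else 0

/-- The operator `A - w`. -/
def shiftBy {d N : ℕ} {L : ℝ} (A : dom d N L →ₗ[ℂ] Fock d N) (w : ℂ) :
    dom d N L →ₗ[ℂ] Fock d N :=
  A - w • (dom d N L).subtype

/-- The spectrum of an unbounded operator: all `w` for which `A - w` has no bounded inverse
(for `S = univ` the projection is the identity). -/
def spec {d N : ℕ} {L : ℝ} (A : dom d N L →ₗ[ℂ] Fock d N) : Set ℂ :=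
  {w | ¬ InvertibleOn Set.univ (shiftBy A w)}

/-! ### The Feshbach-Schur flow -/

/-- The number of particles in the modes `±j`. -/
def pairNum {d N : ℕ} (j : Mode d) (n : Conf d N) : ℕ := n.1 j + n.1 (-j)

/-- Product states with `N - i` or `N - i - 1` particles in the modes `±j`; they span the range of
`Q^{(i,i+1)}`. -/
def shell {d N : ℕ} (j : Mode d) (i : ℕ) : Set (Conf d N) :=
  {n | pairNum j n + i = N ∨ pairNum j n + i + 1 = N}

/-- Product states with fewer than `N - i - 1` particles in the modes `±j`; they span the range of
`Q^{(>i+1)}`. -/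
def below {d N : ℕ} (j : Mode d) (i : ℕ) : Set (Conf d N) :=
  {n | pairNum j n + i + 1 < N}

/-- The Feshbach-Schur map `P K P - P K P̄ (P̄ K P̄)⁻¹ P̄ K P` for the projections `P`, `P̄` onto the
spans of the product states in `S`, `T`. -/
def feshbach {d N : ℕ} {L : ℝ} (S T : Set (Conf d N)) (K : dom d N L →ₗ[ℂ] Fock d N) :
    dom d N L →ₗ[ℂ] Fock d N :=
  maskOp S ∘ₗ K ∘ₗ maskDom L S
    - maskOp S ∘ₗ K ∘ₗ maskDom L T ∘ₗ invOn T K ∘ₗ maskOp T ∘ₗ K ∘ₗ maskDom L S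

/-- The Feshbach-Schur Hamiltonians: `kBog z t` is `K^{(2t-2)}(z)`, so that `kBog z 0` is
`K^{(-2)}(z) = H - z` and `K^{(2t)}(z)` arises from `K^{(2t-2)}(z)` by the map for
`P = Q^{(>2t+1)}` and `P̄ = Q^{(2t,2t+1)}`. -/
def kBog {d : ℕ} (N : ℕ) (L φ : ℝ) (j : Mode d) (z : ℝ) : ℕ → (dom d N L →ₗ[ℂ] Fock d N)
  | 0 => shiftBy (hBog N L φ j) z
  | t + 1 => feshbach (below j (2 * t)) (shell j (2 * t)) (kBog N L φ j z t)

/-- `Q^{(2t,2t+1)} K^{(2t-2)}(z) Q^{(2t,2t+1)}` is bounded invertible on `Q^{(2t,2t+1)} F^N`, that is,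
the Feshbach-Schur map can be applied at the step `2t`. -/
def StepInvertible {d : ℕ} (N : ℕ) (L φ : ℝ) (j : Mode d) (z : ℝ) (t : ℕ) : Prop :=
  InvertibleOn (shell j (2 * t)) (kBog N L φ j z t)

/-- `1 / (Q^{(2t,2t+1)} K^{(2t-2)}(z) Q^{(2t,2t+1)})`. -/
def stepInv {d : ℕ} (N : ℕ) (L φ : ℝ) (j : Mode d) (z : ℝ) (t : ℕ) : Fock d N →ₗ[ℂ] dom d N L :=
  invOn (shell j (2 * t)) (kBog N L φ j z t)

theorem kinEnergy_single_zero {d : ℕ} (L : ℝ) (N : ℕ) :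
    kinEnergy L (Finsupp.single (0 : Mode d) N) = 0 := by
  simp [kinEnergy, kSq]

/-- The product state `η` with all `N` particles in the zero mode. -/
def eta (d N : ℕ) (L : ℝ) : dom d N L :=
  ⟨lp.single 2 (⟨Finsupp.single 0 N, by simp⟩ : Conf d N) (1 : ℂ), by
    change Memℓp _ 2
    convert zero_memℓp (E := fun _ : Conf d N => ℂ) (p := 2) using 2 with n
    by_cases h : n = ⟨Finsupp.single 0 N, by simp⟩
    · subst h
      simp [kinEnergy_single_zero]
    · simp [lp.single_apply, h]⟩

/-- The function
`f(z) = -z - ⟨η, W_j (Q^{(N-2,N-1)} K^{(N-4)}(z) Q^{(N-2,N-1)})⁻¹ W*_j η⟩`. -/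
def fixFun {d : ℕ} (N : ℕ) (L φ : ℝ) (j : Mode d) (z : ℝ) : ℂ :=
  -(z : ℂ) - inner ℂ (eta d N L : Fock d N)
    (W N φ j (stepInv N L φ j z (N / 2 - 1) (Wstar N φ j (eta d N L : Fock d N))))

/-- The terms of the expansion of the ground state vector. With
`R_r = 1 / (Q^{(N-2r,N-2r+1)} K^{(N-2r-2)}(z) Q^{(N-2r,N-2r+1)})` and
`W*_{i,i'} = Q^{(i,i+1)} W*_j Q^{(i',i'+1)}`, the term with index `0` is
`R_1 Q^{(N-2,N-1)} W*_j η` and the term with index `m` is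
`[-R_{m+1} W*_{N-2m-2,N-2m}] ⋯ [-R_2 W*_{N-4,N-2}] R_1 Q^{(N-2,N-1)} W*_j η`. -/
def gsTerm {d : ℕ} (N : ℕ) (L φ : ℝ) (j : Mode d) (z : ℝ) : ℕ → dom d N L
  | 0 => stepInv N L φ j z (N / 2 - 1)
      (maskOp (shell j (N - 2)) (Wstar N φ j (eta d N L : Fock d N)))
  | m + 1 => -stepInv N L φ j z (N / 2 - (m + 2))
      (maskOp (shell j (N - 2 * (m + 2))) (Wstar N φ j
        (maskOp (shell j (N - 2 * (m + 2) + 2)) (gsTerm N L φ j z m : Fock d N))))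

/-- The vector `ψ = η - R_1 Q^{(N-2,N-1)} W*_j η
- ∑_{l=2}^{N/2} {∏_{r=l}^{2} [-R_r W*_{N-2r,N-2r+2}]} R_1 Q^{(N-2,N-1)} W*_j η`. -/
def gsVector {d : ℕ} (N : ℕ) (L φ : ℝ) (j : Mode d) (z : ℝ) : dom d N L :=
  eta d N L - gsTerm N L φ j z 0 - ∑ l ∈ Finset.Icc 2 (N / 2), gsTerm N L φ j z (l - 1)

/-! ### Parameters and conditions -/

/-- `ε_j = k_j² / φ_j`. -/
def eps {d : ℕ} (L φ : ℝ) (j : Mode d) : ℝ := kSq L j / φ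

/-- `E^Bog_j = -[k_j² + φ_j - √((k_j²)² + 2 φ_j k_j²)]`. -/
def eBog {d : ℕ} (L φ : ℝ) (j : Mode d) : ℝ :=
  -(kSq L j + φ - √(kSq L j ^ 2 + 2 * φ * kSq L j))

/-- The width `√ε_j φ_j √(ε_j² + 2 ε_j)`. -/
def width {d : ℕ} (L φ : ℝ) (j : Mode d) : ℝ :=
  √(eps L φ j) * φ * √(eps L φ j ^ 2 + 2 * eps L φ j)

/-- The condition `ε² + ε / N^γ + 1 / N ≤ k ε √ε` and `1 / N^{1-γ} ≤ k ε`. -/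
def GammaCond (k γ : ℝ) (N : ℕ) (ε : ℝ) : Prop :=
  ε ^ 2 + ε / (N : ℝ) ^ γ + 1 / (N : ℝ) ≤ k * ε * √ε ∧ 1 / (N : ℝ) ^ (1 - γ) ≤ k * ε

/-- The condition `(φ/Δ₀) N^μ / (N (N - N^μ)) < 1/2` and `1 / N^μ ≤ C (√ε)^{1+θ}`. -/
def MuCond {d : ℕ} (μ θ C : ℝ) (N : ℕ) (L φ : ℝ) (j : Mode d) : Prop :=
  φ / gap0 d L * ((N : ℝ) ^ μ / ((N : ℝ) * ((N : ℝ) - (N : ℝ) ^ μ))) < 1 / 2 ∧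
    1 / (N : ℝ) ^ μ ≤ C * √(eps L φ j) ^ (1 + θ)

/-! ### The properties of the ground state -/

/-- `z` is the unique zero of `f` in `(-∞, E^Bog_j + √ε_j φ_j √(ε_j² + 2 ε_j)]`, the Feshbach-Schur
flow being well defined there up to the step `N - 2`. -/
structure IsFixedPoint {d : ℕ} (N : ℕ) (L φ : ℝ) (j : Mode d) (z : ℝ) : Prop where
  flow : ∀ w ≤ eBog L φ j + width L φ j, ∀ t < N / 2, StepInvertible N L φ j w t
  le : z ≤ eBog L φ j + width L φ j
  zero : fixFun N L φ j z = 0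
  unique : ∀ w ≤ eBog L φ j + width L φ j, fixFun N L φ j w = 0 → w = z

/-- `z` is the nondegenerate ground state energy of `H`, with eigenvector `gsVector`. -/
structure IsGroundState {d : ℕ} (N : ℕ) (L φ : ℝ) (j : Mode d) (z : ℝ) : Prop where
  bottom : ∀ w ∈ spec (hBog N L φ j), w.im = 0 ∧ z ≤ w.re
  ne_zero : gsVector N L φ j z ≠ 0
  eigen : hBog N L φ j (gsVector N L φ j z) = (z : ℂ) • (gsVector N L φ j z : Fock d N)
  nondegenerate : ∀ x : dom d N L, hBog N L φ j x = (z : ℂ) • (x : Fock d N) →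
    ∃ c : ℂ, x = c • gsVector N L φ j z

/-- The spectral gap above `z` is at least `g`: the spectrum except `z` lies in `[z + g, ∞)`. -/
def GapAbove {d : ℕ} (N : ℕ) (L φ : ℝ) (j : Mode d) (z g : ℝ) : Prop :=
  ∀ w ∈ spec (hBog N L φ j), w ≠ (z : ℂ) → w.im = 0 ∧ z + g ≤ w.re

/-- `min {Δ₀ / 2, ((3 - 2√2) / 6) √ε_j φ_j √(ε_j² + 2 ε_j)}`. -/
def gapBound {d : ℕ} (L φ : ℝ) (j : Mode d) : ℝ :=
  min (gap0 d L / 2) ((-2 * √2 + 3) / 6 * width L φ j)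

end ThreeMode

end

open ThreeMode

/-!
Creating a pair in the modes `±j` turns a product state into a multiple of another one. So on every
chain of product states `H` is a Jacobi matrix, the Feshbach–Schur flow computes a continued
fraction along the chain, and `f(z)` is the value of this fraction at `η`.

A continued fraction stays positive below any positive supersolution of the recursion. With
`e = √(ε² + 2ε)`, the ratios `(1 + ε - e)(1 + 2e/p)` of the coefficients of states with `p` and
`p - 2` particles in the modes `±j` form one up to the energy `E^Bog + w`: the flow is well defined
there, it is strictly decreasing in `z`, and the coefficients of `ψ` are bounded by products of
these ratios, whatever `N` is. The constant ratio `1 + ε - e` defines a trial state which puts the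
zero of `f` below `E^Bog + 5φ/(eN)`.

A positive weight which is a supersolution on the chains orthogonal to `η` bounds the quadratic form
of `H` there by `z + Δ₀/2`. As `z` is an eigenvalue, everything else in the spectrum lies above.
-/

noncomputable section

namespace ThreeMode

/-! ### The continued fraction of a chain -/

/-- The diagonal entry, relative to the energy `z`, which the Feshbach-Schur flow produces at a
product state with `n₀` particles in the zero mode, `a` and `b` particles in the modes `±j` and
kinetic energy `T` in all other modes. -/
def chainFrac (N φ κ T z : ℝ) : ℕ → ℕ → ℕ → ℝ
  | 0, a, b => T + ((a : ℝ) + b) * κ - z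
  | 1, a, b => T + ((a : ℝ) + b) * (κ + φ / N) - z
  | n + 2, a, b => T + ((a : ℝ) + b) * (κ + φ / N * ((n : ℝ) + 2)) - z -
      (φ / N) ^ 2 * (((n : ℝ) + 2) * ((n : ℝ) + 1)) * (((a : ℝ) + 1) * ((b : ℝ) + 1)) /
        chainFrac N φ κ T z n (a + 1) (b + 1)

/-- The regime of small `ε`, with `e = √(ε² + 2ε)` and `s = √ε` given by their defining polynomial
relations. In units of `φ`, the energy `E^Bog` is `-(1 + ε - e)` and the width of the energy window
is `e * s`. -/
structure SmallCoupling (ε e s : ℝ) : Prop where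
  e_pos : 0 < e
  s_pos : 0 < s
  e_sq : e ^ 2 = ε ^ 2 + 2 * ε
  s_sq : s ^ 2 = ε
  e_le : e ≤ 1 / 20

namespace SmallCoupling

variable {ε e s : ℝ}

theorem eps_pos (h : SmallCoupling ε e s) : 0 < ε := by
  rw [← h.s_sq]
  exact pow_pos h.s_pos 2

theorem eps_le (h : SmallCoupling ε e s) : ε ≤ 1 / 800 := by
  nlinarith [h.e_sq, h.e_le, h.e_pos, h.eps_pos]

theorem eps_le_e (h : SmallCoupling ε e s) : ε ≤ e := by
  nlinarith [h.e_sq, h.e_pos, h.eps_pos]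

theorem s_le (h : SmallCoupling ε e s) : s ≤ 3 / 4 * e := by
  have := h.e_pos
  refine abs_le_of_sq_le_sq' ?_ (by positivity) |>.2
  nlinarith [h.e_sq, h.s_sq, h.eps_pos]

theorem e_mul_s_le (h : SmallCoupling ε e s) : e * s ≤ 3 / 1600 := by
  nlinarith [h.s_le, h.e_le, h.e_pos, h.s_pos]

theorem le_ratio (h : SmallCoupling ε e s) : 19 / 20 ≤ 1 + ε - e := by
  linarith [h.e_le, h.eps_pos]

theorem ratio_pos (h : SmallCoupling ε e s) : 0 < 1 + ε - e := by
  linarith [h.le_ratio]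

theorem ratio_le_one (h : SmallCoupling ε e s) : 1 + ε - e ≤ 1 := by
  linarith [h.eps_le_e]

theorem ratio_mul_inv_ratio (h : SmallCoupling ε e s) : (1 + ε - e) * (1 + ε + e) = 1 := by
  linear_combination -h.e_sq

theorem div_ratio_eq_mul (h : SmallCoupling ε e s) (x : ℝ) :
    x / (1 + ε - e) = x * (1 + ε + e) := by
  rw [div_eq_iff h.ratio_pos.ne', mul_assoc, mul_comm (1 + ε + e), h.ratio_mul_inv_ratio, mul_one]

theorem le_ratio_sub_width (h : SmallCoupling ε e s) : 9 / 10 ≤ 1 + ε - e - e * s := by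
  linarith [h.le_ratio, h.e_mul_s_le]

end SmallCoupling

/-- The bound `(1 + ε - e)(1 + 2 e / p)` on the ratio of the coefficients of the ground state at
`p` and at `p - 2` particles in the modes `±j`. -/
def ratioBound (ε e p : ℝ) : ℝ := (1 + ε - e) * (1 + 2 * e / p)

section Supersolution

variable {ε e s n N p : ℝ}

theorem ratioBound_pos (h : SmallCoupling ε e s) (hp : 0 < p) : 0 < ratioBound ε e p := by
  have := h.ratio_pos
  have := h.e_pos
  unfold ratioBound
  positivity

theorem ratioBound_le_two (h : SmallCoupling ε e s) (hp : 2 ≤ p) : ratioBound ε e p ≤ 2 := by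
  have he := h.e_pos
  have hdiv : 2 * e / p ≤ 1 := by
    rw [div_le_iff₀ (by linarith)]
    linarith [h.e_le]
  calc (1 + ε - e) * (1 + 2 * e / p) ≤ 1 * (1 + 1) := by
        gcongr
        exact h.ratio_le_one
    _ = 2 := by norm_num

theorem mul_ratioBound_add_two (ε e x : ℝ) (hp : 0 ≤ p) :
    x * ((p + 2) / 2) * ratioBound ε e (p + 2) = x * ((1 + ε - e) * (p / 2 + 1 + e)) := by
  unfold ratioBound
  have : p + 2 ≠ 0 := by positivity
  field_simp

theorem half_le_sub_mul_one_add {e p : ℝ} (he : 0 < e) (hp : 2 ≤ p) :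
    p / 2 ≤ (p / 2 - e / (1 + e)) * (1 + 2 * e / p) := by
  have hdiff : (p / 2 - e / (1 + e)) * (1 + 2 * e / p) - p / 2 =
      e ^ 2 * (p - 2) / (p * (1 + e)) := by
    have : p ≠ 0 := by positivity
    field_simp
    ring
  have : 0 ≤ e ^ 2 * (p - 2) / (p * (1 + e)) :=
    div_nonneg (mul_nonneg (sq_nonneg e) (by linarith)) (by positivity)
  linarith

theorem div_ratioBound_le (h : SmallCoupling ε e s) {x : ℝ} (hx : 0 ≤ x) (hp : 2 ≤ p) :
    x * (p / 2) / ratioBound ε e p ≤ x * ((1 + ε + e) * (p / 2 - e / (1 + e))) := by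
  rw [div_le_iff₀ (ratioBound_pos h (by linarith)), mul_assoc]
  refine mul_le_mul_of_nonneg_left ?_ hx
  calc p / 2 ≤ (p / 2 - e / (1 + e)) * (1 + 2 * e / p) := half_le_sub_mul_one_add h.e_pos hp
    _ = ((1 + ε - e) * (1 + ε + e)) * ((p / 2 - e / (1 + e)) * (1 + 2 * e / p)) := by
      rw [h.ratio_mul_inv_ratio, one_mul]
    _ = _ := by unfold ratioBound; ring

theorem supersolution_down (h : SmallCoupling ε e s) (hn : 0 ≤ n) (hp : 2 ≤ p)
    (hN : n + p ≤ N) :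
    (n + 3 / 2) * (p / 2) / ratioBound ε e p ≤ p * (N * ε + n) + N * (1 + ε - e - e * s) := by
  have he := h.e_pos
  have hε := h.eps_pos
  have hN0 : 0 ≤ N := by linarith
  have hq : 0 < e / (1 + e) := by positivity
  have hdown : (n + 3 / 2) * ((1 + ε + e) * (p / 2 - e / (1 + e))) ≤
      (n + 3 / 2) * (11 / 10 * (p / 2)) := by
    gcongr
    · have : e / (1 + e) ≤ e := div_le_self he.le (by linarith)
      linarith [h.e_le]
    · linarith [h.e_le, h.eps_le]
    · linarith
  have hwindow : N * (9 / 10) ≤ N * (1 + ε - e - e * s) := by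
    gcongr
    exact h.le_ratio_sub_width
  have hkin : 0 ≤ p * (N * ε) := by positivity
  have hpn : 0 ≤ p * n := by positivity
  linarith [div_ratioBound_le h (x := n + 3 / 2) (by linarith) hp]

theorem supersolution_of_half_le (h : SmallCoupling ε e s) (hn : 1 / 2 ≤ n) (hp : 2 ≤ p)
    (hN : n + p ≤ N) :
    (n - 1 / 2) * ((p + 2) / 2) * ratioBound ε e (p + 2) + (n + 3 / 2) * (p / 2) / ratioBound ε e p
      ≤ p * (N * ε + n) + N * (1 + ε - e - e * s) := by
  rw [mul_ratioBound_add_two _ _ _ (by linarith)]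
  have hdown := div_ratioBound_le h (x := n + 3 / 2) (by linarith) hp
  have he := h.e_pos
  have hel := h.e_le
  have hε := h.eps_pos
  have hεl := h.eps_le
  have hq : 0 < e / (1 + e) := by positivity
  have hqe : e / (1 + e) * (1 + e) = e := by field_simp
  set q := e / (1 + e)
  clear_value q
  have hgain : e * s ≤ (1 + ε + e) * q - e * (1 + ε - e) := by
    have hexpand : (1 + ε + e) * q = e + ε * q := by linear_combination hqe
    have hes : e * s ≤ e * (3 / 4 * e) := mul_le_mul_of_nonneg_left h.s_le he.le
    have heε : e * ε ≤ e * (e / 40) := by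
      refine mul_le_mul_of_nonneg_left ?_ he.le
      nlinarith [h.e_sq]
    rw [hexpand]
    nlinarith [mul_pos hε hq]
  have hhalf : (1 + ε - e) * (p / 2 + 1 + e) * (-(1 / 2)) + 3 / 2 * ((1 + ε + e) * (p / 2 - q)) ≤
      p * (9 / 10) := by
    nlinarith [mul_pos hε hq, mul_pos he hq]
  have hwindow : p * (9 / 10) ≤ (N - n) * (1 + ε - e - e * s) := by
    have hpN : p ≤ N - n := by linarith
    nlinarith [hpN, h.le_ratio_sub_width]
  have hgain_n : n * (e * s) ≤ n * ((1 + ε + e) * q - e * (1 + ε - e)) := by gcongr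
  have hkin : 0 ≤ p * ε * (N - n) := by
    have : 0 ≤ N - n := by linarith
    positivity
  nlinarith

theorem supersolution (h : SmallCoupling ε e s) (hn : 0 ≤ n) (hp : 2 ≤ p) (hN : n + p ≤ N) :
    max 0 (n - 1 / 2) * ((p + 2) / 2) * ratioBound ε e (p + 2) +
      (n + 3 / 2) * (p / 2) / ratioBound ε e p ≤
    p * (N * ε + n) + N * (1 + ε - e - e * s) := by
  rcases le_total n (1 / 2) with hn' | hn'
  · rw [max_eq_left (by linarith), zero_mul, zero_mul, zero_add]
    exact supersolution_down h hn hp hN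
  · rw [max_eq_right (by linarith)]
    exact supersolution_of_half_le h hn' hp hN

theorem supersolution_one (h : SmallCoupling ε e s) (hn : 0 ≤ n) (hN : n + 1 ≤ N) :
    max 0 (n - 1 / 2) * ((1 + 2) / 2) * ratioBound ε e (1 + 2) + N / 4 ≤
      1 * (N * ε + n) + N * (1 + ε - e - e * s) := by
  rw [mul_ratioBound_add_two _ _ _ (by norm_num)]
  have hc := h.ratio_pos
  have he := h.e_pos
  have hup : max 0 (n - 1 / 2) * ((1 + ε - e) * (1 / 2 + 1 + e)) ≤ n * (1 * (155 / 100)) := by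
    gcongr
    · exact max_le hn (by linarith)
    · exact h.ratio_le_one
    · linarith [h.e_le]
  have hwindow : N * (9 / 10) ≤ N * (1 + ε - e - e * s) := by
    gcongr
    · linarith
    · exact h.le_ratio_sub_width
  have hkin : 0 ≤ N * ε := mul_nonneg (by linarith) h.eps_pos.le
  linarith

theorem supersolution_const (h : SmallCoupling ε e s) (hn : 0 ≤ n) (hp : 0 ≤ p) (hN : n + p ≤ N) :
    max 0 (n - 1 / 2) * ((p + 2) / 2) * (1 + ε - e) + (n + 3 / 2) * (p / 2) / (1 + ε - e) ≤
      p * (N * ε + n) + N * (1 + ε - e) := by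
  rw [h.div_ratio_eq_mul]
  have hc := h.ratio_pos
  have hε := h.eps_pos
  have hinv : 1 + ε + e ≤ 11 / 10 := by linarith [h.e_le, h.eps_le]
  have hkin : 0 ≤ p * ε * (N - n) := by
    have : 0 ≤ N - n := by linarith
    positivity
  have hpairs : p * (1 + ε - e) ≤ (N - n) * (1 + ε - e) := by
    gcongr
    linarith
  have hpc : p * (19 / 20) ≤ p * (1 + ε - e) := by
    gcongr
    exact h.le_ratio
  rcases le_total n (1 / 2) with hn' | hn'
  · rw [max_eq_left (by linarith)]
    have hdown : (n + 3 / 2) * (p / 2) * (1 + ε + e) ≤ (n + 3 / 2) * (p / 2) * (11 / 10) := by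
      gcongr
    have hpn : 0 ≤ p * n := by positivity
    have hnc : 0 ≤ n * (1 + ε - e) := by positivity
    nlinarith [mul_nonneg (mul_nonneg hp hε.le) hn]
  · rw [max_eq_right (by linarith)]
    have hdown : p * (1 + ε + e) ≤ p * (11 / 10) := by gcongr
    nlinarith

/-- Lowering the number `n` of particles available to the pairs to `n'` raises the energy: the
ground state of a chain of length `n` is a supersolution for the chain of length `n'`. -/
theorem supersolution_of_lt {u κ z G R a n n' : ℝ} (hn' : 0 ≤ n') (hnn : n' < n) (ha : 0 ≤ a)
    (hκ : 2 * u ≤ κ) (hz : z ≤ 0) (hR : 0 ≤ R) (hsum : R + G = 2 * a * (κ + u * n) - z) :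
    G * ((n' + 2) / (n + 2)) + R * (n' / n) ≤ 2 * a * (κ + u * n') - z := by
  have hn : 0 < n := by linarith
  have hG : 2 * G / (n + 2) ≤ 2 * a * κ - z := by
    rw [div_le_iff₀ (by linarith)]
    have hau : a * (2 * u) ≤ a * κ := by gcongr
    have : 0 ≤ n * (2 * a * κ - z - 4 * a * u) := mul_nonneg hn.le (by linarith)
    nlinarith
  calc G * ((n' + 2) / (n + 2)) + R * (n' / n) =
        (n' / n) * (R + G) + (2 * G / (n + 2)) * ((n - n') / n) := by
        field_simp
        ring
    _ ≤ (n' / n) * (2 * a * (κ + u * n) - z) + (2 * a * κ - z) * ((n - n') / n) := by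
        rw [hsum]
        gcongr
    _ = 2 * a * (κ + u * n') - z := by
        field_simp
        ring

end Supersolution

section Bounds

variable {ε e s N φ κ T z : ℝ}

theorem le_div_of_mul_self_le {b₂ B c G : ℝ} (hG : 0 < G) (hb : B ^ 2 ≤ b₂) :
    2 * B * c - c ^ 2 * G ≤ b₂ / G := by
  rw [le_div_iff₀ hG]
  linarith [sq_nonneg (B - c * G)]

theorem div_le_of_sq_le {b₂ B x G : ℝ} (hB : 0 < B) (hx : 0 < x) (hb : b₂ ≤ B ^ 2)
    (hG : B / x ≤ G) : b₂ / G ≤ B * x := by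
  calc b₂ / G ≤ B ^ 2 / (B / x) := by gcongr
    _ = B * x := by field_simp

/-- The arithmetic-geometric mean inequality in both pairs of factors of the square of the matrix
element of the pair creation. -/
theorem pair_weight_le (u : ℝ) (n a b : ℕ) :
    u ^ 2 * (((n : ℝ) + 2) * ((n : ℝ) + 1)) * (((a : ℝ) + 1) * ((b : ℝ) + 1)) ≤
      (u * (((n : ℝ) + 3 / 2) * (((a : ℝ) + b + 2) / 2))) ^ 2 := by
  rw [mul_pow, mul_pow, mul_assoc]
  gcongr
  · linarith
  · linarith [sq_nonneg ((a : ℝ) - b)]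

theorem le_chainFrac_of_next (hN : 0 < N) (hφ : 0 < φ) {n a b : ℕ} {x g : ℝ} (hx : 0 < x)
    (hnext : ∀ m, n = m + 2 → φ / N * (((m : ℝ) + 3 / 2) * (((a : ℝ) + b + 2) / 2)) / x ≤
      chainFrac N φ κ T z m (a + 1) (b + 1))
    (hstep : φ / N * (max 0 ((n : ℝ) - 1 / 2) * (((a : ℝ) + b + 2) / 2) * x) + g ≤
      ((a : ℝ) + b) * (κ + φ / N * n) - z) :
    T + g ≤ chainFrac N φ κ T z n a b := by
  have hup : 0 ≤ φ / N * (max 0 ((n : ℝ) - 1 / 2) * (((a : ℝ) + b + 2) / 2) * x) := by positivity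
  match n with
  | 0 =>
    simp only [chainFrac, Nat.cast_zero, mul_zero, add_zero] at hup hstep ⊢
    linarith
  | 1 =>
    simp only [chainFrac, Nat.cast_one, mul_one] at hup hstep ⊢
    linarith
  | m + 2 =>
    have hfrac := div_le_of_sq_le (by positivity) hx (pair_weight_le (φ / N) m a b) (hnext m rfl)
    have hmax : max 0 (((m + 2 : ℕ) : ℝ) - 1 / 2) = (m : ℝ) + 3 / 2 := by
      push_cast
      rw [max_eq_right] <;> linarith [m.cast_nonneg (α := ℝ)]
    rw [hmax] at hstep
    simp only [chainFrac]
    push_cast at hstep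
    linarith

theorem le_chainFrac_of_supersolution (hN : 0 < N) (hφ : 0 < φ) (hT : 0 ≤ T) {ρ : ℝ → ℝ} {p₀ : ℝ}
    (hρ : ∀ p, 0 < p → 0 < ρ p)
    (hsuper : ∀ n p : ℝ, 0 ≤ n → p₀ ≤ p → n + p ≤ N →
      φ / N * (max 0 (n - 1 / 2) * ((p + 2) / 2) * ρ (p + 2) + (n + 3 / 2) * (p / 2) / ρ p) ≤
        p * (κ + φ / N * n) - z) (n a b : ℕ) (hab : p₀ ≤ (a : ℝ) + b)
    (hn : (n : ℝ) + a + b ≤ N) :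
    T + φ / N * (((n : ℝ) + 3 / 2) * (((a : ℝ) + b) / 2) / ρ (a + b)) ≤
      chainFrac N φ κ T z n a b := by
  induction n using Nat.strong_induction_on generalizing a b with
  | _ n ih =>
    refine le_chainFrac_of_next hN hφ (x := ρ (a + b + 2)) (hρ _ (by positivity)) ?_ ?_
    · rintro m rfl
      have hcast : ((a + 1 : ℕ) : ℝ) + (b + 1 : ℕ) = (a : ℝ) + b + 2 := by push_cast; ring
      have := ih m (by omega) (a + 1) (b + 1) (by linarith) (by push_cast at hn ⊢; linarith)
      rw [hcast] at this
      rw [mul_div_assoc]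
      linarith
    · rw [← mul_add]
      exact hsuper n (a + b) n.cast_nonneg hab (by linarith)

theorem scaled_supersolution (hN : 0 < N) (hκ : κ = φ * ε) (n p c : ℝ) :
    φ / N * (p * (N * ε + n) + N * c) = p * (κ + φ / N * n) + φ * c := by
  rw [hκ]
  field_simp

theorem le_chainFrac (h : SmallCoupling ε e s) (hN : 0 < N) (hφ : 0 < φ) (hκ : κ = φ * ε)
    (hT : 0 ≤ T) (hz : z ≤ -(φ * (1 + ε - e)) + φ * (e * s)) (n a b : ℕ)
    (hab : (2 : ℝ) ≤ (a : ℝ) + b) (hn : (n : ℝ) + a + b ≤ N) :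
    T + φ / N * (((n : ℝ) + 3 / 2) * (((a : ℝ) + b) / 2) / ratioBound ε e (a + b)) ≤
      chainFrac N φ κ T z n a b := by
  refine le_chainFrac_of_supersolution hN hφ hT (fun _ => ratioBound_pos h)
    (fun n p hn hp hnp => ?_) n a b hab hn
  calc _ ≤ φ / N * (p * (N * ε + n) + N * (1 + ε - e - e * s)) := by
        exact mul_le_mul_of_nonneg_left (supersolution h hn hp hnp) (by positivity)
    _ ≤ p * (κ + φ / N * n) - z := by
        rw [scaled_supersolution hN hκ]
        linarith

theorem le_chainFrac_of_add_eq_one (h : SmallCoupling ε e s) (hN : 0 < N) (hφ : 0 < φ)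
    (hκ : κ = φ * ε) (hT : 0 ≤ T) (hz : z ≤ -(φ * (1 + ε - e)) + φ * (e * s)) (n a b : ℕ)
    (hab : (a : ℝ) + b = 1) (hn : (n : ℝ) + a + b ≤ N) :
    T + φ / 4 ≤ chainFrac N φ κ T z n a b := by
  refine le_chainFrac_of_next hN hφ (x := ratioBound ε e (a + b + 2))
    (ratioBound_pos h (by positivity)) ?_ ?_
  · rintro m rfl
    have hcast : ((a + 1 : ℕ) : ℝ) + (b + 1 : ℕ) = (a : ℝ) + b + 2 := by push_cast; ring
    have := le_chainFrac h hN hφ hκ hT hz m (a + 1) (b + 1) (by linarith)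
      (by push_cast at hn ⊢; linarith)
    rw [hcast] at this
    rw [mul_div_assoc]
    linarith
  · rw [hab]
    calc _ = φ / N * (max 0 ((n : ℝ) - 1 / 2) * ((1 + 2) / 2) * ratioBound ε e (1 + 2) +
          N / 4) := by field_simp
      _ ≤ φ / N * (1 * (N * ε + n) + N * (1 + ε - e - e * s)) := by
          have hsuper := supersolution_one h n.cast_nonneg (N := N) (n := n) (by linarith)
          exact mul_le_mul_of_nonneg_left hsuper (by positivity)
      _ ≤ 1 * (κ + φ / N * n) - z := by
          rw [scaled_supersolution hN hκ]
          linarith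

theorem le_chainFrac_eBog (h : SmallCoupling ε e s) (hN : 0 < N) (hφ : 0 < φ) (hκ : κ = φ * ε)
    (n a b : ℕ) (hn : (n : ℝ) + a + b ≤ N) :
    φ / N * (((n : ℝ) + 3 / 2) * (((a : ℝ) + b) / 2) / (1 + ε - e)) ≤
      chainFrac N φ κ 0 (-(φ * (1 + ε - e))) n a b := by
  rw [← zero_add (φ / N * _)]
  refine le_chainFrac_of_supersolution hN hφ le_rfl (ρ := fun _ => 1 + ε - e) (p₀ := 0)
    (fun _ _ => h.ratio_pos) (fun n p hn hp hnp => ?_) n a b (by positivity) hn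
  rw [sub_neg_eq_add, ← scaled_supersolution hN hκ]
  exact mul_le_mul_of_nonneg_left (supersolution_const h hn hp hnp) (by positivity)

theorem le_chainFrac_const (h : SmallCoupling ε e s) (hN : 0 < N) (hφ : 0 < φ) (hκ : κ = φ * ε)
    (hT : 0 ≤ T) (hz : z ≤ -(φ * (1 + ε - e)) + φ * (e * s)) (n a b : ℕ) (hab : 1 ≤ a + b)
    (hn : (n : ℝ) + a + b ≤ N) : T + φ / (4 * N) ≤ chainFrac N φ κ T z n a b := by
  rcases (by omega : a + b = 1 ∨ 2 ≤ a + b) with h1 | h2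
  · have hab' : (a : ℝ) + b = 1 := by exact_mod_cast h1
    calc T + φ / (4 * N) ≤ T + φ / 4 := by
          gcongr
          linarith
      _ ≤ _ := le_chainFrac_of_add_eq_one h hN hφ hκ hT hz n a b hab' hn
  · have hab' : (2 : ℝ) ≤ (a : ℝ) + b := by exact_mod_cast h2
    calc T + φ / (4 * N) = T + φ / N * ((1 / 2) / 2) := by
          field_simp
          ring
      _ ≤ T + φ / N * (((n : ℝ) + 3 / 2) * (((a : ℝ) + b) / 2) / ratioBound ε e (a + b)) := by
          gcongr
          · exact ratioBound_pos h (by linarith)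
          · nlinarith
          · exact ratioBound_le_two h hab'
      _ ≤ _ := le_chainFrac h hN hφ hκ hT hz n a b hab' hn

theorem chainFrac_pos (h : SmallCoupling ε e s) (hN : 0 < N) (hφ : 0 < φ) (hκ : κ = φ * ε)
    (hT : 0 ≤ T) (hz : z ≤ -(φ * (1 + ε - e)) + φ * (e * s)) (n a b : ℕ) (hab : 1 ≤ a + b)
    (hn : (n : ℝ) + a + b ≤ N) : 0 < chainFrac N φ κ T z n a b := by
  have : 0 < φ / (4 * N) := by positivity
  linarith [le_chainFrac_const h hN hφ hκ hT hz n a b hab hn]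

theorem chainFrac_strictAnti (h : SmallCoupling ε e s) (hN : 0 < N) (hφ : 0 < φ) (hκ : κ = φ * ε)
    (hT : 0 ≤ T) {z₁ z₂ : ℝ} (hlt : z₁ < z₂) (hz : z₂ ≤ -(φ * (1 + ε - e)) + φ * (e * s)) :
    ∀ n a b : ℕ, (n : ℝ) + a + b ≤ N →
      chainFrac N φ κ T z₂ n a b < chainFrac N φ κ T z₁ n a b := by
  intro n
  induction n using Nat.twoStepInduction with
  | zero => intro a b _; simp only [chainFrac]; linarith
  | one => intro a b _; simp only [chainFrac]; linarith
  | more n ih _ =>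
    intro a b hn
    have hn' : (n : ℝ) + ((a + 1 : ℕ) : ℝ) + ((b + 1 : ℕ) : ℝ) ≤ N := by
      push_cast at hn ⊢; linarith
    have hpos := chainFrac_pos h hN hφ hκ hT hz n (a + 1) (b + 1) (by omega) hn'
    simp only [chainFrac]
    gcongr
    exact ih (a + 1) (b + 1) hn'

theorem chainFrac_continuousOn (h : SmallCoupling ε e s) (hN : 0 < N) (hφ : 0 < φ)
    (hκ : κ = φ * ε) (hT : 0 ≤ T) : ∀ n a b : ℕ, (n : ℝ) + a + b ≤ N →
      ContinuousOn (fun z => chainFrac N φ κ T z n a b)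
        (Set.Iic (-(φ * (1 + ε - e)) + φ * (e * s))) := by
  intro n
  induction n using Nat.twoStepInduction with
  | zero => intro a b _; simp only [chainFrac]; fun_prop
  | one => intro a b _; simp only [chainFrac]; fun_prop
  | more n ih _ =>
    intro a b hn
    have hn' : (n : ℝ) + ((a + 1 : ℕ) : ℝ) + ((b + 1 : ℕ) : ℝ) ≤ N := by
      push_cast at hn ⊢; linarith
    simp only [chainFrac]
    refine ContinuousOn.sub (by fun_prop) (ContinuousOn.div continuousOn_const
      (ih (a + 1) (b + 1) hn') fun z hz => ?_)
    exact (chainFrac_pos h hN hφ hκ hT hz n (a + 1) (b + 1) (by omega) hn').ne'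

theorem trial_step (h : SmallCoupling ε e s) {a : ℝ} (ha : 0 ≤ a) :
    2 * a * (N * ε + (N - 2 * a)) + N * (1 + ε - e) - 5 / e
        - (2 * ((a + 1) * (N - 2 * a - 1)) * (1 + ε - e)
          - (1 + ε - e) ^ 2 * ((a + 1) * ((1 + ε + e) * (N + 3 / e)))) ≤
      a * ((1 + ε + e) * (N + 3 / e)) := by
  have hc : (1 + ε - e) ^ 2 * ((a + 1) * ((1 + ε + e) * (N + 3 / e))) =
      (a + 1) * ((1 + ε - e) * (N + 3 / e)) := by
    linear_combination ((a + 1) * (1 + ε - e) * (N + 3 / e)) * h.ratio_mul_inv_ratio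
  have he : e * (1 / e) = 1 := mul_one_div_cancel h.e_pos.ne'
  have hsmall : 0 ≤ (e - ε) * (4 * a ^ 2 + 6 * a) := by
    have := h.eps_le_e
    have : 0 ≤ e - ε := by linarith
    positivity
  have hinv : (1 + ε - e) * (1 / e) ≤ 1 * (1 / e) := by
    have := h.e_pos
    gcongr
    exact h.ratio_le_one
  have hinv20 : 20 ≤ 1 / e := by
    rw [le_div_iff₀ h.e_pos]
    linarith [h.e_le]
  have hratio := h.ratio_le_one
  rw [hc, div_eq_mul_one_div 5, div_eq_mul_one_div 3]
  generalize 1 / e = i at *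
  nlinarith

theorem trial_energy_le (he : 0 < e) (hN : 0 < N) (hκ : κ = φ * ε)
    (hz' : -(φ * (1 + ε - e)) + φ * (5 / (e * N)) ≤ z) (a x : ℝ) :
    (a + a) * (κ + φ / N * x) - z ≤
      φ / N * (2 * a * (N * ε + x) + N * (1 + ε - e) - 5 / e) := by
  calc (a + a) * (κ + φ / N * x) - z ≤
        (a + a) * (κ + φ / N * x) - (-(φ * (1 + ε - e)) + φ * (5 / (e * N))) := by gcongr
    _ = φ / N * (2 * a * (N * ε + x) + N * (1 + ε - e) - 5 / e) := by
        rw [hκ]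
        field_simp
        ring

theorem chainFrac_zero_le (h : SmallCoupling ε e s) (hN : 0 < N) (hφ : 0 < φ) (hκ : κ = φ * ε)
    (hz' : -(φ * (1 + ε - e)) + φ * (5 / (e * N)) ≤ z) {a : ℕ} (ha : 1 ≤ a) :
    chainFrac N φ κ 0 z 0 a a ≤ φ / N * (a * ((1 + ε + e) * (N + 3 / e))) := by
  have he := h.e_pos
  have hε := h.eps_pos
  have ha' : (1 : ℝ) ≤ a := by exact_mod_cast ha
  have hbound : 2 * a * (N * ε + 0) + N * (1 + ε - e) - 5 / e ≤
      a * ((1 + ε + e) * (N + 3 / e)) := by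
    have hratio : N * (1 + ε - e) ≤ a * N * (1 + ε - e) := by
      have := h.ratio_pos
      gcongr
      exact le_mul_of_one_le_left hN.le ha'
    have heps : a * N * (2 * ε) ≤ a * N * (2 * e) := by
      gcongr
      exact h.eps_le_e
    have : 0 ≤ a * ((1 + ε + e) * (3 / e)) := by positivity
    have : 0 ≤ 5 / e := by positivity
    linarith
  calc chainFrac N φ κ 0 z 0 a a = (a + a) * (κ + φ / N * 0) - z := by simp [chainFrac]
    _ ≤ φ / N * (2 * a * (N * ε + 0) + N * (1 + ε - e) - 5 / e) :=
        trial_energy_le he hN hκ hz' a 0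
    _ ≤ _ := mul_le_mul_of_nonneg_left hbound (by positivity)

/-- Upper bounds come from the trial state with the constant ratio `1 + ε - e`: the quotient
`b₂ / G` is the supremum of `2 B c - c² G` over `c`. -/
theorem chainFrac_le (h : SmallCoupling ε e s) (hN : 0 < N) (hφ : 0 < φ) (hκ : κ = φ * ε)
    (hz : z ≤ -(φ * (1 + ε - e)) + φ * (e * s)) (hz' : -(φ * (1 + ε - e)) + φ * (5 / (e * N)) ≤ z)
    (k a : ℕ) (hak : 1 ≤ a + k) (hn : 2 * (k : ℝ) + a + a = N) :
    chainFrac N φ κ 0 z (2 * k) a a ≤ φ / N * (a * ((1 + ε + e) * (N + 3 / e))) := by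
  induction k generalizing a with
  | zero => exact chainFrac_zero_le h hN hφ hκ hz' hak
  | succ k ih =>
    have hn' : 2 * (k : ℝ) + ((a + 1 : ℕ) : ℝ) + ((a + 1 : ℕ) : ℝ) = N := by
      push_cast at hn ⊢
      linarith
    have hk : 2 * (k : ℝ) + 2 = N - 2 * a := by
      push_cast at hn
      linarith
    have hk' : 2 * (k : ℝ) + 1 = N - 2 * a - 1 := by linarith
    have hG := chainFrac_pos h hN hφ hκ le_rfl hz (2 * k) (a + 1) (a + 1) (by omega)
      (by push_cast at hn' ⊢; linarith)
    have hGle := ih (a + 1) (by omega) hn'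
    have hstep := mul_le_mul_of_nonneg_left (trial_step (N := N) h a.cast_nonneg)
      (show 0 ≤ φ / N by positivity)
    have henergy := trial_energy_le h.e_pos hN hκ hz' a (N - 2 * a)
    rw [show 2 * (k + 1) = 2 * k + 2 by ring]
    simp only [chainFrac]
    set G := chainFrac N φ κ 0 z (2 * k) (a + 1) (a + 1)
    set X := (1 + ε + e) * (N + 3 / e)
    have hweight : (φ / N * ((a + 1) * (2 * k + 1))) ^ 2 ≤
        (φ / N) ^ 2 * ((2 * (k : ℝ) + 2) * (2 * (k : ℝ) + 1)) *
          (((a : ℝ) + 1) * ((a : ℝ) + 1)) := by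
      calc _ = (φ / N) ^ 2 * ((2 * (k : ℝ) + 1) * (2 * (k : ℝ) + 1)) *
            (((a : ℝ) + 1) * ((a : ℝ) + 1)) := by ring
        _ ≤ _ := by
          gcongr
          norm_num
    have hfrac := le_div_of_mul_self_le (c := 1 + ε - e) hG hweight
    have hGc : (1 + ε - e) ^ 2 * G ≤ (1 + ε - e) ^ 2 * (φ / N * ((a + 1) * X)) := by
      push_cast at hGle
      gcongr
    push_cast
    rw [hk, hk'] at hfrac ⊢
    linarith

end Bounds

theorem exists_chainFrac_eq_zero {ε e s φ κ : ℝ} (h : SmallCoupling ε e s) {N : ℕ} (hN : 0 < N)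
    (hE : Even N) (hφ : 0 < φ) (hκ : κ = φ * ε) (hδ : 5 / (e * N) ≤ e * s) :
    ∃ z, -(φ * (1 + ε - e)) ≤ z ∧ z ≤ -(φ * (1 + ε - e)) + φ * (5 / (e * N)) ∧
      chainFrac N φ κ 0 z N 0 0 = 0 := by
  have hN' : (0 : ℝ) < N := by exact_mod_cast hN
  have he := h.e_pos
  set z₀ := -(φ * (1 + ε - e))
  set z₁ := z₀ + φ * (5 / (e * N)) with hz₁
  have hz₁' : z₁ ≤ z₀ + φ * (e * s) := by
    rw [hz₁]
    gcongr
  have hle : z₀ ≤ z₁ := le_add_of_nonneg_right (by positivity)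
  have hnonneg : 0 ≤ chainFrac N φ κ 0 z₀ N 0 0 := by
    simpa using le_chainFrac_eBog h hN' hφ hκ N 0 0 (by simp)
  have hnonpos : chainFrac N φ κ 0 z₁ N 0 0 ≤ 0 := by
    obtain ⟨k, rfl⟩ := hE.two_dvd
    simpa using chainFrac_le h hN' hφ hκ hz₁' le_rfl k 0 (by omega) (by simp)
  have hcont := (chainFrac_continuousOn (κ := κ) h hN' hφ hκ le_rfl N 0 0 (by simp)).mono
    (t := Set.Icc z₀ z₁) (Set.Icc_subset_Iic_self.trans (Set.Iic_subset_Iic.2 hz₁'))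
  obtain ⟨z, hz, hzero⟩ := intermediate_value_Icc' hle hcont ⟨hnonpos, hnonneg⟩
  exact ⟨z, hz.1, hz.2, hzero⟩

/-! ### The operators in coordinates -/

/-- Two particles of the zero mode are replaced by a pair in the modes `±j`. -/
def pairUp {d : ℕ} (j : Mode d) (n : Occ d) : Occ d :=
  n - Finsupp.single 0 1 - Finsupp.single 0 1 + Finsupp.single j 1 + Finsupp.single (-j) 1

/-- A pair in the modes `±j` is replaced by two particles of the zero mode. -/
def pairDown {d : ℕ} (j : Mode d) (n : Occ d) : Occ d :=
  n + Finsupp.single 0 1 + Finsupp.single 0 1 - Finsupp.single j 1 - Finsupp.single (-j) 1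

section Modes

variable {d : ℕ} {j : Mode d}

theorem neg_mode_ne (hj : j ≠ 0) : -j ≠ j := by
  simpa only [ne_eq, neg_eq_self] using hj

theorem pairUp_zero (hj : j ≠ 0) (n : Occ d) : pairUp j n 0 = n 0 - 2 := by
  simp [pairUp, hj, Nat.sub_sub]

theorem pairUp_self (hj : j ≠ 0) (n : Occ d) : pairUp j n j = n j + 1 := by
  simp [pairUp, hj.symm, neg_mode_ne hj]

theorem pairUp_neg (hj : j ≠ 0) (n : Occ d) : pairUp j n (-j) = n (-j) + 1 := by
  simp [pairUp, hj, (neg_mode_ne hj).symm]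

theorem pairDown_zero (hj : j ≠ 0) (n : Occ d) : pairDown j n 0 = n 0 + 2 := by
  simp [pairDown, hj]

theorem pairDown_self (hj : j ≠ 0) (n : Occ d) : pairDown j n j = n j - 1 := by
  simp [pairDown, hj.symm, neg_mode_ne hj]

theorem pairDown_neg (hj : j ≠ 0) (n : Occ d) : pairDown j n (-j) = n (-j) - 1 := by
  simp [pairDown, hj, (neg_mode_ne hj).symm]

theorem pairUp_add (m : Occ d) :
    pairUp j (m + Finsupp.single 0 1 + Finsupp.single 0 1) =
      m + Finsupp.single j 1 + Finsupp.single (-j) 1 := by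
  simp [pairUp]

theorem pairDown_add (m : Occ d) :
    pairDown j (m + Finsupp.single j 1 + Finsupp.single (-j) 1) =
      m + Finsupp.single 0 1 + Finsupp.single 0 1 := by
  ext p
  simp only [pairDown, Finsupp.coe_add, Finsupp.coe_tsub, Pi.add_apply, Pi.sub_apply]
  omega

theorem exists_eq_add_zero_pair {n : Occ d} (h : 2 ≤ n 0) :
    ∃ m : Occ d, n = m + Finsupp.single 0 1 + Finsupp.single 0 1 := by
  refine ⟨n - Finsupp.single 0 1 - Finsupp.single 0 1, ?_⟩
  ext p
  by_cases hp : p = 0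
  · subst hp
    simp only [Finsupp.coe_add, Finsupp.coe_tsub, Pi.add_apply, Pi.sub_apply,
      Finsupp.single_eq_same]
    omega
  · simp [Ne.symm hp]

theorem exists_eq_add_pair (hj : j ≠ 0) {n : Occ d} (h1 : 1 ≤ n j) (h2 : 1 ≤ n (-j)) :
    ∃ m : Occ d, n = m + Finsupp.single j 1 + Finsupp.single (-j) 1 := by
  refine ⟨n - Finsupp.single j 1 - Finsupp.single (-j) 1, ?_⟩
  ext p
  have := neg_mode_ne hj
  by_cases hp : p = j
  · subst hp
    simp [this]
    omega
  · by_cases hp' : p = -j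
    · subst hp'
      simp [this.symm]
      omega
    · simp [Ne.symm hp, Ne.symm hp']

theorem degree_pairUp {n : Occ d} (h : 2 ≤ n 0) : (pairUp j n).degree = n.degree := by
  obtain ⟨m, rfl⟩ := exists_eq_add_zero_pair h
  rw [pairUp_add]
  simp [map_add]

theorem degree_pairDown (hj : j ≠ 0) {n : Occ d} (h1 : 1 ≤ n j) (h2 : 1 ≤ n (-j)) :
    (pairDown j n).degree = n.degree := by
  obtain ⟨m, rfl⟩ := exists_eq_add_pair hj h1 h2
  rw [pairDown_add]
  simp [map_add]

theorem pairDown_pairUp {n : Occ d} (h : 2 ≤ n 0) : pairDown j (pairUp j n) = n := by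
  obtain ⟨m, rfl⟩ := exists_eq_add_zero_pair h
  rw [pairUp_add, pairDown_add]

theorem pairUp_pairDown (hj : j ≠ 0) {n : Occ d} (h1 : 1 ≤ n j) (h2 : 1 ≤ n (-j)) :
    pairUp j (pairDown j n) = n := by
  obtain ⟨m, rfl⟩ := exists_eq_add_pair hj h1 h2
  rw [pairDown_add, pairUp_add]

theorem sum_three_modes (hj : j ≠ 0) (n : Occ d) :
    ∑ p ∈ ({0, j, -j} : Finset (Mode d)), n p = n 0 + n j + n (-j) := by
  rw [Finset.sum_insert, Finset.sum_insert, Finset.sum_singleton, add_assoc]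
  · simpa using (neg_mode_ne hj).symm
  · simp [hj.symm, (neg_ne_zero.2 hj).symm]

theorem three_modes_le (hj : j ≠ 0) (n : Occ d) : n 0 + n j + n (-j) ≤ n.degree := by
  have hdegree : n.degree = ∑ p ∈ n.support ∪ {0, j, -j}, n p :=
    Finset.sum_subset Finset.subset_union_left fun p _ hp => Finsupp.notMem_support_iff.1 hp
  rw [← sum_three_modes hj, hdegree]
  exact Finset.sum_le_sum_of_subset Finset.subset_union_right

theorem exists_other_mode (hj : j ≠ 0) {n : Occ d} (h : n 0 + n j + n (-j) ≠ n.degree) :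
    ∃ p, p ≠ 0 ∧ p ≠ j ∧ p ≠ -j ∧ n p ≠ 0 := by
  by_contra! hzero
  refine h ((sum_three_modes hj n).symm.trans (Finset.sum_subset (fun p hp => ?_)
    fun p _ hp => Finsupp.notMem_support_iff.1 hp).symm)
  by_contra hother
  simp only [Finset.mem_insert, Finset.mem_singleton, not_or] at hother
  exact Finsupp.mem_support_iff.1 hp (hzero p hother.1 hother.2.1 hother.2.2)

/-! ### The kinetic energy of the other modes -/

theorem kSq_nonneg (L : ℝ) (p : Mode d) : 0 ≤ kSq L p :=
  Finset.sum_nonneg fun _ _ => sq_nonneg _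

theorem kSq_zero (L : ℝ) : kSq L (0 : Mode d) = 0 := by simp [kSq]

theorem kSq_neg (L : ℝ) (p : Mode d) : kSq L (-p) = kSq L p := by
  simp [kSq]

theorem kinEnergy_add (L : ℝ) (n m : Occ d) :
    kinEnergy L (n + m) = kinEnergy L n + kinEnergy L m := by
  unfold kinEnergy
  exact Finsupp.sum_add_index' (by simp) (fun p a b => by push_cast; ring)

theorem kinEnergy_single (L : ℝ) (p : Mode d) (m : ℕ) :
    kinEnergy L (Finsupp.single p m) = m * kSq L p := by
  unfold kinEnergy
  exact Finsupp.sum_single_index (by simp)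

theorem kinEnergy_nonneg (L : ℝ) (n : Occ d) : 0 ≤ kinEnergy L n :=
  Finset.sum_nonneg fun _ _ => mul_nonneg (Nat.cast_nonneg _) (kSq_nonneg _ _)

/-- The kinetic energy of the modes other than `±j`. -/
def restKin (L : ℝ) (j : Mode d) (n : Occ d) : ℝ :=
  kinEnergy L n - ((n j : ℝ) + n (-j)) * kSq L j

theorem restKin_eq (hj : j ≠ 0) (L : ℝ) (n : Occ d) :
    restKin L j n = kinEnergy L ((n.erase j).erase (-j)) := by
  have herase : n = Finsupp.single j (n j) + n.erase j := (Finsupp.single_add_erase j n).symm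
  have herase_neg : n.erase j = Finsupp.single (-j) (n (-j)) + (n.erase j).erase (-j) := by
    conv_lhs => rw [← Finsupp.single_add_erase (-j) (n.erase j)]
    rw [Finsupp.erase_ne (neg_mode_ne hj)]
  have hkin : kinEnergy L n = (n j : ℝ) * kSq L j + ((n (-j) : ℝ) * kSq L j +
      kinEnergy L ((n.erase j).erase (-j))) := by
    conv_lhs => rw [herase, herase_neg, kinEnergy_add, kinEnergy_add, kinEnergy_single,
      kinEnergy_single, kSq_neg]
  rw [restKin, hkin]
  ring

theorem restKin_nonneg (hj : j ≠ 0) (L : ℝ) (n : Occ d) : 0 ≤ restKin L j n := by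
  rw [restKin_eq hj]
  exact kinEnergy_nonneg _ _

theorem gap0_le (L : ℝ) {p : Mode d} (hp : p ≠ 0) : gap0 d L ≤ kSq L p :=
  ciInf_le (f := fun p : {p : Mode d // p ≠ 0} => kSq L p.1)
    ⟨0, by rintro _ ⟨p, rfl⟩; exact kSq_nonneg _ _⟩ ⟨p, hp⟩

theorem gap0_le_kinEnergy (L : ℝ) {n : Occ d} {p : Mode d} (hp : p ≠ 0) (hnp : n p ≠ 0) :
    gap0 d L ≤ kinEnergy L n := by
  calc gap0 d L ≤ kSq L p := gap0_le L hp
    _ ≤ (n p : ℝ) * kSq L p :=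
        le_mul_of_one_le_left (kSq_nonneg L p) (by exact_mod_cast Nat.one_le_iff_ne_zero.2 hnp)
    _ ≤ kinEnergy L n := Finset.single_le_sum (f := fun p => (n p : ℝ) * kSq L p)
        (fun _ _ => mul_nonneg (Nat.cast_nonneg _) (kSq_nonneg _ _)) (Finsupp.mem_support_iff.2 hnp)

theorem gap0_le_restKin (hj : j ≠ 0) (L : ℝ) {n : Occ d} (h : n 0 + n j + n (-j) ≠ n.degree) :
    gap0 d L ≤ restKin L j n := by
  obtain ⟨p, hp, hpj, hpj', hnp⟩ := exists_other_mode hj h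
  rw [restKin_eq hj]
  refine gap0_le_kinEnergy L hp ?_
  rwa [Finsupp.erase_ne hpj', Finsupp.erase_ne hpj]

theorem restKin_pairUp (hj : j ≠ 0) (L : ℝ) {n : Occ d} (h : 2 ≤ n 0) :
    restKin L j (pairUp j n) = restKin L j n := by
  rw [restKin, restKin, pairUp_self hj, pairUp_neg hj]
  obtain ⟨m, rfl⟩ := exists_eq_add_zero_pair h
  rw [pairUp_add]
  simp only [kinEnergy_add, kinEnergy_single, kSq_neg, kSq_zero]
  push_cast
  ring

end Modes

section Coordinates

variable {d N : ℕ} (j : Mode d)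

/-- The product state with one pair in the modes `±j` more; the state itself if there is none. -/
def up (n : Conf d N) : Conf d N :=
  if h : (pairUp j n.1).degree = N then ⟨pairUp j n.1, h⟩ else n

/-- The product state with one pair in the modes `±j` less; the state itself if there is none. -/
def down (n : Conf d N) : Conf d N :=
  if h : (pairDown j n.1).degree = N then ⟨pairDown j n.1, h⟩ else n

/-- The matrix element of the interaction between a product state and the one above it. -/
def bUp (φ : ℝ) (n : Conf d N) : ℝ :=
  φ / N * √((n.1 0 : ℝ) * ((n.1 0 : ℝ) - 1)) * √(((n.1 j : ℝ) + 1) * ((n.1 (-j) : ℝ) + 1))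

/-- The matrix element of the interaction between a product state and the one below it. -/
def bDown (φ : ℝ) (n : Conf d N) : ℝ :=
  φ / N * √(((n.1 0 : ℝ) + 2) * ((n.1 0 : ℝ) + 1)) * √((n.1 j : ℝ) * (n.1 (-j) : ℝ))

/-- The diagonal matrix elements of the Hamiltonian. -/
def diagH (L φ : ℝ) (n : Conf d N) : ℝ :=
  kinEnergy L n.1 + φ / N * ((n.1 0 : ℝ) * ((n.1 j : ℝ) + n.1 (-j)))

variable {j}

theorem up_val {n : Conf d N} (h : 2 ≤ n.1 0) : (up j n).1 = pairUp j n.1 := by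
  rw [up, dif_pos ((degree_pairUp h).trans n.2)]

theorem down_val (hj : j ≠ 0) {n : Conf d N} (h1 : 1 ≤ n.1 j) (h2 : 1 ≤ n.1 (-j)) :
    (down j n).1 = pairDown j n.1 := by
  rw [down, dif_pos ((degree_pairDown hj h1 h2).trans n.2)]

theorem bUp_eq_zero {φ : ℝ} {n : Conf d N} (h : ¬ 2 ≤ n.1 0) : bUp j φ n = 0 := by
  have : n.1 0 = 0 ∨ n.1 0 = 1 := by omega
  rcases this with h | h <;> simp [bUp, h]

theorem bDown_eq_zero {φ : ℝ} {n : Conf d N} (h : ¬ (1 ≤ n.1 j ∧ 1 ≤ n.1 (-j))) :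
    bDown j φ n = 0 := by
  have : n.1 j = 0 ∨ n.1 (-j) = 0 := by omega
  rcases this with h | h <;> simp [bDown, h]

theorem down_up (hj : j ≠ 0) {n : Conf d N} (h : 2 ≤ n.1 0) : down j (up j n) = n := by
  apply Subtype.ext
  have hup := up_val (j := j) h
  rw [down_val hj (by rw [hup, pairUp_self hj]; omega) (by rw [hup, pairUp_neg hj]; omega), hup,
    pairDown_pairUp h]

theorem up_down (hj : j ≠ 0) {n : Conf d N} (h1 : 1 ≤ n.1 j) (h2 : 1 ≤ n.1 (-j)) :
    up j (down j n) = n := by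
  apply Subtype.ext
  have hdown := down_val hj h1 h2
  rw [up_val (by rw [hdown, pairDown_zero hj]; omega), hdown, pairUp_pairDown hj h1 h2]

theorem bDown_up (hj : j ≠ 0) {φ : ℝ} {n : Conf d N} (h : 2 ≤ n.1 0) :
    bDown j φ (up j n) = bUp j φ n := by
  rw [bDown, bUp, up_val h, pairUp_zero hj, pairUp_self hj, pairUp_neg hj]
  push_cast [Nat.cast_sub h]
  ring_nf

theorem bUp_down (hj : j ≠ 0) {φ : ℝ} {n : Conf d N} (h1 : 1 ≤ n.1 j) (h2 : 1 ≤ n.1 (-j)) :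
    bUp j φ (down j n) = bDown j φ n := by
  rw [← bDown_up hj (by rw [down_val hj h1 h2, pairDown_zero hj]; omega), up_down hj h1 h2]

theorem bUp_nonneg {φ : ℝ} (hφ : 0 ≤ φ) (n : Conf d N) : 0 ≤ bUp j φ n := by
  unfold bUp; positivity

theorem bUp_sq {φ : ℝ} (n : Conf d N) : bUp j φ n ^ 2 =
    (φ / N) ^ 2 * ((n.1 0 : ℝ) * ((n.1 0 : ℝ) - 1)) *
      (((n.1 j : ℝ) + 1) * ((n.1 (-j) : ℝ) + 1)) := by
  have h : (0 : ℝ) ≤ (n.1 0 : ℝ) * ((n.1 0 : ℝ) - 1) := by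
    rcases Nat.eq_zero_or_pos (n.1 0) with h | h
    · simp [h]
    · have : (1 : ℝ) ≤ n.1 0 := by exact_mod_cast h
      exact mul_nonneg (by positivity) (by linarith)
  rw [bUp, mul_pow, mul_pow, Real.sq_sqrt h, Real.sq_sqrt (by positivity)]

theorem annih_apply (p : Mode d) (x : FinFock d) (n : Occ d) :
    (annih p x).1 n = (√(n p + 1) : ℂ) * x.1 (n + Finsupp.single p 1) :=
  rfl

theorem create_apply (p : Mode d) (x : FinFock d) (n : Occ d) :
    (create p x).1 n = (√(n p) : ℂ) * x.1 (n - Finsupp.single p 1) :=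
  rfl

theorem create_annih_apply (p : Mode d) (x : FinFock d) (n : Occ d) :
    (create p (annih p x)).1 n = (n p : ℂ) * x.1 n := by
  rcases Nat.eq_zero_or_pos (n p) with h | h
  · simp [create_apply, h]
  · have hn : n - Finsupp.single p 1 + Finsupp.single p 1 = n :=
      tsub_add_cancel_of_le (Finsupp.single_le_iff.2 h)
    have hcast : (((n p - 1 : ℕ) : ℝ) + 1) = n p := by
      rw [Nat.cast_sub h]
      simp
    rw [create_apply, annih_apply, hn, Finsupp.coe_tsub, Pi.sub_apply, Finsupp.single_eq_same,
      hcast, ← mul_assoc, ← Complex.ofReal_mul, Real.mul_self_sqrt (by positivity)]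
    simp

theorem create_create_zero_apply (x : FinFock d) (n : Occ d) :
    (create 0 (create 0 x)).1 n =
      (√((n 0 : ℝ) * ((n 0 : ℝ) - 1)) : ℂ) *
        x.1 (n - Finsupp.single 0 1 - Finsupp.single 0 1) := by
  rcases Nat.eq_zero_or_pos (n 0) with h | h
  · simp [create_apply, h]
  · rw [create_apply, create_apply, Finsupp.coe_tsub, Pi.sub_apply, Finsupp.single_eq_same,
      Nat.cast_sub h, Nat.cast_one, Real.sqrt_mul (by positivity), Complex.ofReal_mul, mul_assoc]

theorem annih_annih_zero_apply (x : FinFock d) (n : Occ d) :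
    (annih 0 (annih 0 x)).1 n =
      (√(((n 0 : ℝ) + 2) * ((n 0 : ℝ) + 1)) : ℂ) *
        x.1 (n + Finsupp.single 0 1 + Finsupp.single 0 1) := by
  rw [annih_apply, annih_apply, Finsupp.coe_add, Pi.add_apply, Finsupp.single_eq_same,
    mul_comm ((n 0 : ℝ) + 2), Real.sqrt_mul (by positivity), Complex.ofReal_mul, mul_assoc]
  push_cast
  rw [add_assoc (n 0 : ℝ), one_add_one_eq_two]

theorem annih_annih_neg_apply (hj : j ≠ 0) (x : FinFock d) (n : Occ d) :
    (annih j (annih (-j) x)).1 n =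
      (√(((n j : ℝ) + 1) * ((n (-j) : ℝ) + 1)) : ℂ) *
        x.1 (n + Finsupp.single j 1 + Finsupp.single (-j) 1) := by
  rw [annih_apply, annih_apply, Finsupp.coe_add, Pi.add_apply,
    Finsupp.single_eq_of_ne (neg_mode_ne hj), add_zero, Real.sqrt_mul (by positivity),
    Complex.ofReal_mul, mul_assoc]

theorem create_create_neg_apply (hj : j ≠ 0) (x : FinFock d) (n : Occ d) :
    (create j (create (-j) x)).1 n =
      (√((n j : ℝ) * (n (-j) : ℝ)) : ℂ) *
        x.1 (n - Finsupp.single j 1 - Finsupp.single (-j) 1) := by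
  rw [create_apply, create_apply, Finsupp.coe_tsub, Pi.sub_apply,
    Finsupp.single_eq_of_ne (neg_mode_ne hj), tsub_zero, Real.sqrt_mul (by positivity),
    Complex.ofReal_mul, mul_assoc]

theorem incl_apply_val (x : Fock d N) (n : Conf d N) : (incl d N x).1 n.1 = x n := by
  simp [incl, n.2]

theorem W_apply (hj : j ≠ 0) (φ : ℝ) (x : Fock d N) (n : Conf d N) :
    W N φ j x n = (bUp j φ n : ℂ) * x (up j n) := by
  have hW : W N φ j x n = ((φ / N : ℝ) : ℂ) *
    (create 0 (create 0 (annih j (annih (-j) (incl d N x))))).1 n.1 := rfl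
  rw [hW, create_create_zero_apply, annih_annih_neg_apply hj]
  by_cases hn : 2 ≤ n.1 0
  · rw [← incl_apply_val x, up_val hn, pairUp, bUp]
    simp only [Finsupp.coe_tsub, Pi.sub_apply, Finsupp.single_eq_of_ne hj,
      Finsupp.single_eq_of_ne (neg_ne_zero.2 hj), tsub_zero]
    push_cast
    ring
  · rw [bUp_eq_zero hn]
    rcases (by omega : n.1 0 = 0 ∨ n.1 0 = 1) with h | h <;> simp [h]

theorem Wstar_apply (hj : j ≠ 0) (φ : ℝ) (x : Fock d N) (n : Conf d N) :
    Wstar N φ j x n = (bDown j φ n : ℂ) * x (down j n) := by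
  have hWstar : Wstar N φ j x n = ((φ / N : ℝ) : ℂ) *
    (annih 0 (annih 0 (create j (create (-j) (incl d N x))))).1 n.1 := rfl
  rw [hWstar, annih_annih_zero_apply, create_create_neg_apply hj]
  simp only [Finsupp.coe_add, Pi.add_apply, Finsupp.single_eq_of_ne hj,
    Finsupp.single_eq_of_ne (neg_ne_zero.2 hj), add_zero]
  by_cases hn : 1 ≤ n.1 j ∧ 1 ≤ n.1 (-j)
  · rw [← incl_apply_val x, down_val hj hn.1 hn.2, pairDown, bDown]
    push_cast
    ring
  · rw [bDown_eq_zero hn]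
    rcases (by omega : n.1 j = 0 ∨ n.1 (-j) = 0) with h | h <;> simp [h]

theorem diagInt_apply (φ : ℝ) (x : Fock d N) (n : Conf d N) :
    diagInt N φ j x n =
      ((φ / N * ((n.1 0 : ℝ) * ((n.1 j : ℝ) + n.1 (-j))) : ℝ) : ℂ) * x n := by
  have hdiag : diagInt N φ j x n = ((φ / N : ℝ) : ℂ) * (create 0 (annih 0 (create j (annih j
      (incl d N x)) + create (-j) (annih (-j) (incl d N x))))).1 n.1 := rfl
  have hadd : (create j (annih j (incl d N x)) + create (-j) (annih (-j) (incl d N x)) :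
      FinFock d).1 n.1 = (create j (annih j (incl d N x))).1 n.1 +
        (create (-j) (annih (-j) (incl d N x))).1 n.1 := rfl
  rw [hdiag, create_annih_apply, hadd, create_annih_apply, create_annih_apply, incl_apply_val]
  push_cast
  ring

theorem hBog_apply (hj : j ≠ 0) (L φ : ℝ) (x : dom d N L) (n : Conf d N) :
    hBog N L φ j x n = (diagH j L φ n : ℂ) * x.1 n + (bDown j φ n : ℂ) * x.1 (down j n) +
      (bUp j φ n : ℂ) * x.1 (up j n) := by
  have hsum : hBog N L φ j x n = (kinEnergy L n.1 : ℂ) * x.1 n + (diagInt N φ j x.1 n +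
    W N φ j x.1 n + Wstar N φ j x.1 n) := rfl
  rw [hsum, diagInt_apply, W_apply hj, Wstar_apply hj, diagH]
  push_cast
  ring

end Coordinates

/-! ### The Feshbach–Schur flow in coordinates -/

section Inverses

variable {d N : ℕ} {L : ℝ} {S T : Set (Conf d N)} {A : dom d N L →ₗ[ℂ] Fock d N}

theorem maskOp_apply (S : Set (Conf d N)) (x : Fock d N) (n : Conf d N) :
    maskOp S x n = S.indicator (fun n => x n) n := rfl

theorem maskDom_apply (S : Set (Conf d N)) (x : dom d N L) (n : Conf d N) :
    (maskDom L S x).1 n = S.indicator (fun n => x.1 n) n := rfl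

theorem IsInverseOn.unique {R R' : Fock d N →ₗ[ℂ] dom d N L}
    (h : IsInverseOn S A R) (h' : IsInverseOn S A R') : R = R' := by
  ext1 y
  rw [← h'.left (R y) (h.range y), h.right, ← h'.right, h'.left _ (h'.range y)]

theorem IsInverseOn.invOn_eq {R : Fock d N →ₗ[ℂ] dom d N L} (h : IsInverseOn S A R) :
    invOn S A = R := by
  have hi : InvertibleOn S A := ⟨R, h⟩
  rw [invOn, dif_pos hi]
  exact hi.choose_spec.unique h

theorem feshbach_apply_of_mem {R : Fock d N →ₗ[ℂ] dom d N L} (hR : IsInverseOn T A R)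
    (x : dom d N L) {n : Conf d N} (hn : n ∈ S) :
    feshbach S T A x n =
      A (maskDom L S x) n - A (R (maskOp T (A (maskDom L S x)))) n := by
  have h : feshbach S T A x = maskOp S (A (maskDom L S x)) -
      maskOp S (A (maskDom L T (invOn T A (maskOp T (A (maskDom L S x)))))) := rfl
  rw [h, hR.invOn_eq, hR.range, lp.coeFn_sub, Pi.sub_apply, maskOp_apply, maskOp_apply,
    Set.indicator_of_mem hn, Set.indicator_of_mem hn]

theorem memℓp_two_of_norm_le {ι : Type*} {f y : ι → ℂ} {C : ℝ} (hf : ∀ n, ‖f n‖ ≤ C * ‖y n‖)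
    (hy : Memℓp y 2) : Memℓp f 2 := by
  rw [memℓp_two_iff] at hy ⊢
  refine Summable.of_nonneg_of_le (fun n => by positivity) (fun n => ?_) (hy.mul_left (C ^ 2))
  rw [← mul_pow]
  exact pow_le_pow_left₀ (norm_nonneg _) (hf n) 2

/-- Multiplication by a function for which this maps `F^N` boundedly into the domain. -/
def mulOp {m : Conf d N → ℂ} {C D : ℝ} (hm : ∀ n, ‖m n‖ ≤ C)
    (hk : ∀ n, ‖(kinEnergy L n.1 : ℂ) * m n‖ ≤ D) : Fock d N →ₗ[ℂ] dom d N L where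
  toFun y := ⟨⟨fun n => m n * y n, memℓp_two_of_norm_le (C := C) (y := y) (fun n => by
      rw [norm_mul]
      exact mul_le_mul_of_nonneg_right (hm n) (norm_nonneg _)) (lp.memℓp y)⟩,
    memℓp_two_of_norm_le (C := D) (y := y) (fun n => by
      change ‖(kinEnergy L n.1 : ℂ) * (m n * y n)‖ ≤ _
      rw [← mul_assoc, norm_mul]
      exact mul_le_mul_of_nonneg_right (hk n) (norm_nonneg _)) (lp.memℓp y)⟩
  map_add' x y := by
    ext n
    exact mul_add _ _ _
  map_smul' c y := by
    ext n
    exact mul_left_comm _ _ _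

theorem mulOp_apply {m : Conf d N → ℂ} {C D : ℝ} (hm : ∀ n, ‖m n‖ ≤ C)
    (hk : ∀ n, ‖(kinEnergy L n.1 : ℂ) * m n‖ ≤ D) (y : Fock d N) (n : Conf d N) :
    (mulOp hm hk y).1 n = m n * y n := rfl

theorem norm_mulOp_le {m : Conf d N → ℂ} {C D : ℝ} (hC : 0 ≤ C) (hm : ∀ n, ‖m n‖ ≤ C)
    (hk : ∀ n, ‖(kinEnergy L n.1 : ℂ) * m n‖ ≤ D) (y : Fock d N) :
    ‖(mulOp hm hk y).1‖ ≤ C * ‖y‖ := by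
  have hle : ‖(mulOp hm hk y).1‖ ≤ ‖(C : ℂ) • y‖ := by
    refine lp.norm_mono (by norm_num) fun n => ?_
    rw [mulOp_apply, norm_mul, lp.coeFn_smul, Pi.smul_apply, norm_smul, Complex.norm_real,
      Real.norm_of_nonneg hC]
    exact mul_le_mul_of_nonneg_right (hm n) (norm_nonneg _)
  rwa [norm_smul, Complex.norm_real, Real.norm_of_nonneg hC] at hle

theorem isInverseOn_mulOp {g : Conf d N → ℝ} {C D : ℝ} (hC : 0 ≤ C) (hg : ∀ n ∈ S, g n ≠ 0)
    (hm : ∀ n, ‖S.indicator (fun n => (g n : ℂ)⁻¹) n‖ ≤ C)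
    (hk : ∀ n, ‖(kinEnergy L n.1 : ℂ) * S.indicator (fun n => (g n : ℂ)⁻¹) n‖ ≤ D)
    (hA : ∀ x, maskDom L S x = x → ∀ n ∈ S, A x n = (g n : ℂ) * x.1 n) :
    IsInverseOn S A (mulOp hm hk) := by
  have hg' : ∀ n ∈ S, (g n : ℂ) ≠ 0 := fun n hn => Complex.ofReal_ne_zero.2 (hg n hn)
  have hrange : ∀ y, maskDom L S (mulOp hm hk y) = mulOp hm hk y := fun y => by
    ext n
    rw [maskDom_apply]
    by_cases hn : n ∈ S <;> simp [hn, mulOp_apply]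
  refine ⟨⟨C, norm_mulOp_le hC hm hk⟩, hrange, fun y => ?_, fun x hx => ?_⟩
  · ext n
    rw [maskOp_apply, maskOp_apply]
    by_cases hn : n ∈ S
    · rw [Set.indicator_of_mem hn, Set.indicator_of_mem hn, hA _ (hrange y) n hn, mulOp_apply,
        Set.indicator_of_mem hn, mul_inv_cancel_left₀ (hg' n hn)]
    · rw [Set.indicator_of_notMem hn, Set.indicator_of_notMem hn]
  · ext n
    rw [mulOp_apply]
    by_cases hn : n ∈ S
    · rw [Set.indicator_of_mem hn, maskOp_apply, Set.indicator_of_mem hn, hA x hx n hn,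
        inv_mul_cancel_left₀ (hg' n hn)]
    · rw [Set.indicator_of_notMem hn, zero_mul, ← hx, maskDom_apply, Set.indicator_of_notMem hn]

theorem exists_isInverseOn_of_diagonal {g : Conf d N → ℝ} {δ C : ℝ} (hδ : 0 < δ)
    (hg : ∀ n ∈ S, δ ≤ g n) (hk : ∀ n ∈ S, kinEnergy L n.1 ≤ C * g n)
    (hA : ∀ x, maskDom L S x = x → ∀ n ∈ S, A x n = (g n : ℂ) * x.1 n) :
    ∃ R, IsInverseOn S A R ∧ ∀ y n, (R y).1 n = S.indicator (fun n => y n / (g n : ℂ)) n := by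
  have hpos : ∀ n ∈ S, 0 < g n := fun n hn => hδ.trans_le (hg n hn)
  have hinv : ∀ n, ‖S.indicator (fun n => (g n : ℂ)⁻¹) n‖ ≤ δ⁻¹ := by
    intro n
    by_cases hn : n ∈ S
    · rw [Set.indicator_of_mem hn, norm_inv, Complex.norm_real, Real.norm_of_nonneg (hpos n hn).le]
      exact inv_anti₀ hδ (hg n hn)
    · rw [Set.indicator_of_notMem hn, norm_zero]
      positivity
  have hkin : ∀ n, ‖(kinEnergy L n.1 : ℂ) * S.indicator (fun n => (g n : ℂ)⁻¹) n‖ ≤ |C| := by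
    intro n
    by_cases hn : n ∈ S
    · rw [Set.indicator_of_mem hn, norm_mul, norm_inv, Complex.norm_real, Complex.norm_real,
        Real.norm_of_nonneg (hpos n hn).le, Real.norm_of_nonneg (kinEnergy_nonneg _ _),
        ← div_eq_mul_inv, div_le_iff₀ (hpos n hn)]
      exact (hk n hn).trans (mul_le_mul_of_nonneg_right (le_abs_self C) (hpos n hn).le)
    · rw [Set.indicator_of_notMem hn, mul_zero, norm_zero]
      positivity
  refine ⟨mulOp hinv hkin,
    isInverseOn_mulOp (by positivity) (fun n hn => (hpos n hn).ne') hinv hkin hA, fun y n => ?_⟩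
  rw [mulOp_apply]
  by_cases hn : n ∈ S
  · rw [Set.indicator_of_mem hn, Set.indicator_of_mem hn, div_eq_inv_mul]
  · rw [Set.indicator_of_notMem hn, Set.indicator_of_notMem hn, zero_mul]

end Inverses

section Flow

variable {d N : ℕ} {j : Mode d} {L φ z : ℝ}

/-- The diagonal matrix element which the flow produces at a product state. -/
def flowDiag (L φ : ℝ) (j : Mode d) (z : ℝ) (n : Conf d N) : ℝ :=
  chainFrac N φ (kSq L j) (restKin L j n.1) z (n.1 0) (n.1 j) (n.1 (-j))

theorem diagH_eq (n : Conf d N) : diagH j L φ n =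
    restKin L j n.1 + ((n.1 j : ℝ) + n.1 (-j)) * (kSq L j + φ / N * n.1 0) := by
  unfold diagH restKin
  ring

theorem flowDiag_eq (hj : j ≠ 0) (n : Conf d N) : flowDiag L φ j z n =
    diagH j L φ n - z - bUp j φ n ^ 2 / flowDiag L φ j z (up j n) := by
  by_cases h : 2 ≤ n.1 0
  · obtain ⟨m, hm⟩ : ∃ m, n.1 0 = m + 2 := ⟨n.1 0 - 2, by omega⟩
    have hup : flowDiag L φ j z (up j n) =
        chainFrac N φ (kSq L j) (restKin L j n.1) z m (n.1 j + 1) (n.1 (-j) + 1) := by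
      rw [flowDiag, up_val h, restKin_pairUp hj L h, pairUp_zero hj, pairUp_self hj,
        pairUp_neg hj, hm]
      rfl
    rw [hup, bUp_sq, diagH_eq, flowDiag, hm, chainFrac]
    push_cast
    ring_nf
  · rw [bUp_eq_zero h, diagH_eq, flowDiag]
    have hzero : n.1 0 = 0 ∨ n.1 0 = 1 := by omega
    rcases hzero with h | h <;> simp [h, chainFrac]

theorem pairNum_up (hj : j ≠ 0) {n : Conf d N} (h : 2 ≤ n.1 0) :
    pairNum j (up j n) = pairNum j n + 2 := by
  rw [pairNum, pairNum, up_val h, pairUp_self hj, pairUp_neg hj]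
  omega

theorem pairNum_down (hj : j ≠ 0) {n : Conf d N} (h1 : 1 ≤ n.1 j) (h2 : 1 ≤ n.1 (-j)) :
    pairNum j (down j n) + 2 = pairNum j n := by
  rw [pairNum, pairNum, down_val hj h1 h2, pairDown_self hj, pairDown_neg hj]
  omega

theorem zero_add_pairNum_le (hj : j ≠ 0) (n : Conf d N) : n.1 0 + pairNum j n ≤ N := by
  have := three_modes_le hj n.1
  rw [n.2] at this
  rw [pairNum]
  omega

theorem mem_below {i : ℕ} {n : Conf d N} : n ∈ below j i ↔ pairNum j n + i + 1 < N := Iff.rfl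

theorem mem_shell {i : ℕ} {n : Conf d N} :
    n ∈ shell j i ↔ pairNum j n + i = N ∨ pairNum j n + i + 1 = N := Iff.rfl

theorem bUp_mul_congr (hj : j ≠ 0) {f g : Conf d N → ℂ} {n : Conf d N}
    (h : ∀ m, pairNum j m = pairNum j n + 2 → f m = g m) :
    (bUp j φ n : ℂ) * f (up j n) = (bUp j φ n : ℂ) * g (up j n) := by
  by_cases hn : 2 ≤ n.1 0
  · rw [h _ (pairNum_up hj hn)]
  · rw [bUp_eq_zero hn, Complex.ofReal_zero, zero_mul, zero_mul]

theorem bDown_mul_congr (hj : j ≠ 0) {f g : Conf d N → ℂ} {n : Conf d N}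
    (h : ∀ m, pairNum j m + 2 = pairNum j n → f m = g m) :
    (bDown j φ n : ℂ) * f (down j n) = (bDown j φ n : ℂ) * g (down j n) := by
  by_cases hn : 1 ≤ n.1 j ∧ 1 ≤ n.1 (-j)
  · rw [h _ (pairNum_down hj hn.1 hn.2)]
  · rw [bDown_eq_zero hn, Complex.ofReal_zero, zero_mul, zero_mul]

/-- The flow at the energy `z` is well defined if its diagonal matrix elements dominate the kinetic
energy of the modes other than `±j` and a positive constant. -/
def FlowPos (N : ℕ) (L φ : ℝ) (j : Mode d) (z : ℝ) : Prop :=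
  ∃ δ : ℝ, 0 < δ ∧ ∀ n : Conf d N, 1 ≤ pairNum j n → restKin L j n.1 + δ ≤ flowDiag L φ j z n

theorem FlowPos.pos (h : FlowPos N L φ j z) (hj : j ≠ 0) {n : Conf d N} (hn : 1 ≤ pairNum j n) :
    0 < flowDiag L φ j z n := by
  obtain ⟨δ, hδ, h⟩ := h
  linarith [h n hn, restKin_nonneg hj L n.1]

/-- The operator `K^{(2t-2)}(z)` is the Jacobi matrix of `H - z` on each chain, cut off after the
product states in the shell, where the eliminated part contributes a continued fraction. -/
structure IsTruncated (N : ℕ) (L φ : ℝ) (j : Mode d) (z : ℝ) (t : ℕ) : Prop where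
  interior : ∀ (x : dom d N L), ∀ n ∈ below j (2 * t), kBog N L φ j z t x n =
    ((diagH j L φ n - z : ℝ) : ℂ) * x.1 n + (bUp j φ n : ℂ) * x.1 (up j n) +
      (bDown j φ n : ℂ) * x.1 (down j n)
  boundary : ∀ (x : dom d N L), ∀ n ∈ shell j (2 * t), kBog N L φ j z t x n =
    (flowDiag L φ j z n : ℂ) * x.1 n + (bDown j φ n : ℂ) * x.1 (down j n)

theorem isTruncated_zero (hj : j ≠ 0) : IsTruncated N L φ j z 0 := by
  have hK : ∀ (x : dom d N L) n, kBog N L φ j z 0 x n = hBog N L φ j x n - (z : ℂ) * x.1 n :=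
    fun _ _ => rfl
  refine ⟨fun x n _ => ?_, fun x n hn => ?_⟩
  · rw [hK, hBog_apply hj]
    push_cast
    ring
  · have hfull : ¬ 2 ≤ n.1 0 := by
      have := zero_add_pairNum_le hj n
      rcases hn with hn | hn <;> omega
    rw [hK, hBog_apply hj, flowDiag_eq hj, bUp_eq_zero hfull]
    push_cast
    ring

theorem pairNum_pos_of_mem_shell {t : ℕ} (ht : 2 * t + 2 ≤ N) {n : Conf d N}
    (hn : n ∈ shell j (2 * t)) : 1 ≤ pairNum j n := by
  rw [mem_shell] at hn
  omega

theorem kinEnergy_le_flowDiag (hj : j ≠ 0) {δ : ℝ} (hδ : 0 < δ) {n : Conf d N}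
    (hn : restKin L j n.1 + δ ≤ flowDiag L φ j z n) :
    kinEnergy L n.1 ≤ (1 + N * kSq L j / δ) * flowDiag L φ j z n := by
  have hrest := restKin_nonneg hj L n.1
  have hk := kSq_nonneg L j
  have hsplit : kinEnergy L n.1 = restKin L j n.1 + pairNum j n * kSq L j := by
    rw [restKin, pairNum]
    push_cast
    ring
  have hpairs : (pairNum j n : ℝ) * kSq L j ≤ N * kSq L j := by
    have := zero_add_pairNum_le hj n
    gcongr
    omega
  have hdom : N * kSq L j ≤ N * kSq L j / δ * flowDiag L φ j z n := by
    rw [div_mul_eq_mul_div, le_div_iff₀ hδ]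
    gcongr
    linarith
  linarith

theorem IsTruncated.exists_isInverseOn (hj : j ≠ 0) (hz : FlowPos N L φ j z) {t : ℕ}
    (ht : 2 * t + 2 ≤ N) (hK : IsTruncated N L φ j z t) :
    ∃ R, IsInverseOn (shell j (2 * t)) (kBog N L φ j z t) R ∧
      ∀ y n, (R y).1 n =
        (shell j (2 * t)).indicator (fun n => y n / (flowDiag L φ j z n : ℂ)) n := by
  obtain ⟨δ, hδ, hz⟩ := hz
  have hz' : ∀ n ∈ shell j (2 * t), restKin L j n.1 + δ ≤ flowDiag L φ j z n := fun n hn =>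
    hz n (pairNum_pos_of_mem_shell ht hn)
  refine exists_isInverseOn_of_diagonal hδ
    (fun n hn => by linarith [hz' n hn, restKin_nonneg hj L n.1])
    (fun n hn => kinEnergy_le_flowDiag hj hδ (hz' n hn)) fun x hx n hn => ?_
  have hdown : (bDown j φ n : ℂ) * x.1 (down j n) = 0 := by
    rw [bDown_mul_congr hj (g := fun _ => 0), mul_zero]
    intro m hm
    rw [← hx, maskDom_apply, Set.indicator_of_notMem]
    rw [mem_shell] at hn ⊢
    omega
  rw [hK.boundary x n hn, hdown, add_zero]

theorem IsTruncated.kBog_succ_apply (hj : j ≠ 0) (hz : FlowPos N L φ j z) {t : ℕ}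
    (ht : 2 * t + 2 ≤ N) (hK : IsTruncated N L φ j z t) (x : dom d N L) {n : Conf d N}
    (hn : n ∈ below j (2 * t)) : kBog N L φ j z (t + 1) x n =
      ((diagH j L φ n - z : ℝ) : ℂ) * x.1 n +
        (bUp j φ n : ℂ) * ((below j (2 * t)).indicator (fun m => x.1 m) (up j n) -
          (shell j (2 * t)).indicator
            (fun m => (bDown j φ m : ℂ) * x.1 (down j m) / (flowDiag L φ j z m : ℂ)) (up j n)) +
        (bDown j φ n : ℂ) * x.1 (down j n) := by
  obtain ⟨R, hR, hRapply⟩ := hK.exists_isInverseOn hj hz ht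
  set P : Set (Conf d N) := below j (2 * t)
  set P' : Set (Conf d N) := shell j (2 * t)
  have hdisj : ∀ m ∈ P, m ∉ P' := by
    intro m hm hm'
    rw [mem_below] at hm
    rw [mem_shell] at hm'
    omega
  have hlow : ∀ m, pairNum j m + 2 = pairNum j n → m ∈ P := fun m hm => by
    rw [mem_below] at hn ⊢
    omega
  set y : dom d N L := maskDom L P x
  set v : dom d N L := R (maskOp P' (kBog N L φ j z t y))
  have hy : ∀ m, y.1 m = P.indicator (fun m => x.1 m) m := fun _ => rfl
  have hy_mem : ∀ m ∈ P, y.1 m = x.1 m := fun m hm => Set.indicator_of_mem hm _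
  have hv_notMem : ∀ m ∉ P', v.1 m = 0 := fun m hm => by
    rw [hRapply, Set.indicator_of_notMem hm]
  have hv : ∀ m, v.1 m = P'.indicator
      (fun m => (bDown j φ m : ℂ) * x.1 (down j m) / (flowDiag L φ j z m : ℂ)) m := by
    intro m
    by_cases hm : m ∈ P'
    · have hdown : (bDown j φ m : ℂ) * y.1 (down j m) = (bDown j φ m : ℂ) * x.1 (down j m) :=
        bDown_mul_congr hj (f := fun m => y.1 m) (g := fun m => x.1 m) fun l hl =>
          hy_mem l (by rw [mem_shell] at hm; rw [mem_below]; omega)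
      rw [hRapply, Set.indicator_of_mem hm, Set.indicator_of_mem hm, maskOp_apply,
        Set.indicator_of_mem hm, hK.boundary _ m hm, hy,
        Set.indicator_of_notMem fun h => hdisj m h hm, mul_zero, zero_add, hdown]
    · rw [hv_notMem m hm, Set.indicator_of_notMem hm]
  have hy_down := bDown_mul_congr (φ := φ) hj (f := fun m => y.1 m) (g := fun m => x.1 m)
    fun m hm => hy_mem m (hlow m hm)
  have hv_down := bDown_mul_congr (φ := φ) hj (f := fun m => v.1 m) (g := fun _ => 0) fun m hm =>
    hv_notMem m (hdisj m (hlow m hm))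
  rw [kBog, feshbach_apply_of_mem hR x hn, hK.interior _ n hn, hK.interior _ n hn, hy_mem n hn,
    hv_notMem n (hdisj n hn), hy_down, hv_down, hy, hv]
  ring

theorem IsTruncated.succ (hj : j ≠ 0) (hz : FlowPos N L φ j z) {t : ℕ}
    (ht : 2 * t + 2 ≤ N) (hK : IsTruncated N L φ j z t) : IsTruncated N L φ j z (t + 1) := by
  refine ⟨fun x n hn => ?_, fun x n hn => ?_⟩
  · rw [hK.kBog_succ_apply hj hz ht x (by rw [mem_below] at hn ⊢; omega),
      bUp_mul_congr hj (g := fun m => x.1 m)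
        (f := fun m => (below j (2 * t)).indicator (fun m => x.1 m) m - (shell j (2 * t)).indicator
          (fun m => (bDown j φ m : ℂ) * x.1 (down j m) / (flowDiag L φ j z m : ℂ)) m)]
    intro m hm
    rw [mem_below] at hn
    rw [Set.indicator_of_mem (by rw [mem_below]; omega),
      Set.indicator_of_notMem (by rw [mem_shell]; omega), sub_zero]
  · rw [mem_shell] at hn
    rw [hK.kBog_succ_apply hj hz ht x (by rw [mem_below]; omega), flowDiag_eq hj n]
    by_cases hu : 2 ≤ n.1 0
    · have hup := pairNum_up hj hu
      rw [Set.indicator_of_notMem (by rw [mem_below]; omega),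
        Set.indicator_of_mem (by rw [mem_shell]; omega), down_up hj hu, bDown_up hj hu]
      push_cast
      ring
    · rw [bUp_eq_zero hu]
      push_cast
      ring

theorem isTruncated (hj : j ≠ 0) (hz : FlowPos N L φ j z) {t : ℕ} (ht : 2 * t ≤ N) :
    IsTruncated N L φ j z t := by
  induction t with
  | zero => exact isTruncated_zero hj
  | succ t ih => exact (ih (by omega)).succ hj hz (by omega)

theorem stepInvertible (hj : j ≠ 0) (hz : FlowPos N L φ j z) {t : ℕ} (ht : 2 * t + 2 ≤ N) :
    StepInvertible N L φ j z t :=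
  let ⟨R, hR, _⟩ := (isTruncated hj hz (by omega)).exists_isInverseOn hj hz ht
  ⟨R, hR⟩

theorem stepInv_apply (hj : j ≠ 0) (hz : FlowPos N L φ j z) {t : ℕ} (ht : 2 * t + 2 ≤ N)
    (y : Fock d N) (n : Conf d N) : (stepInv N L φ j z t y).1 n =
      (shell j (2 * t)).indicator (fun n => y n / (flowDiag L φ j z n : ℂ)) n := by
  obtain ⟨R, hR, hRapply⟩ := (isTruncated hj hz (by omega)).exists_isInverseOn hj hz ht
  rw [stepInv, hR.invOn_eq, hRapply]

theorem flowPos {ε e s : ℝ} (h : SmallCoupling ε e s) (hN : 0 < N) (hφ : 0 < φ)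
    (hκ : kSq L j = φ * ε) (hj : j ≠ 0) (hz : z ≤ -(φ * (1 + ε - e)) + φ * (e * s)) :
    FlowPos N L φ j z := by
  have hN' : (0 : ℝ) < N := by exact_mod_cast hN
  refine ⟨φ / (4 * N), by positivity, fun n hn => ?_⟩
  refine le_chainFrac_const h hN' hφ hκ (restKin_nonneg hj L n.1) hz _ _ _ hn ?_
  have := three_modes_le hj n.1
  rw [n.2] at this
  exact_mod_cast this

end Flow

/-! ### Symmetry, quadratic form bounds and the spectrum -/

section ClosedRange

variable {E : Type*} [NormedAddCommGroup E]

theorem isClosed_range_of_bounded_below [NormedSpace ℂ E] [CompleteSpace E] {D : Submodule ℂ E}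
    {B : D →ₗ[ℂ] E} {c : ℝ} (hc : 0 < c) (hb : ∀ x : D, c * ‖(x : E)‖ ≤ ‖B x‖)
    (hgraph : ∀ (x : ℕ → D) (x₀ y : E), Tendsto (fun k => (x k : E)) atTop (𝓝 x₀) →
      Tendsto (fun k => B (x k)) atTop (𝓝 y) → y ∈ LinearMap.range B) :
    IsClosed (LinearMap.range B : Set E) := by
  refine IsSeqClosed.isClosed fun y y₀ hy hy₀ => ?_
  choose x hx using hy
  have hcauchy : CauchySeq fun k => (x k : E) := by
    rw [Metric.cauchySeq_iff]
    intro δ hδ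
    obtain ⟨K, hK⟩ := Metric.cauchySeq_iff.1 hy₀.cauchySeq (c * δ) (by positivity)
    refine ⟨K, fun k hk l hl => ?_⟩
    have hkl := hb (x k - x l)
    rw [map_sub, hx, hx, ← dist_eq_norm] at hkl
    rw [dist_eq_norm]
    exact lt_of_mul_lt_mul_left (hkl.trans_lt (hK k hk l hl)) hc.le
  obtain ⟨x₀, hx₀⟩ := cauchySeq_tendsto_of_complete hcauchy
  exact hgraph x x₀ y₀ hx₀ (by simpa only [hx] using hy₀)

end ClosedRange

theorem neg_two_mul_re_inner_le {u : ℝ} (hu : 0 < u) (b : ℝ) (x y : ℂ) :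
    -2 * (inner ℂ x ((b : ℂ) * y)).re ≤ u * ‖x‖ ^ 2 + b ^ 2 / u * ‖y‖ ^ 2 := by
  have hcs : |(inner ℂ x ((b : ℂ) * y)).re| ≤ |b| * (‖x‖ * ‖y‖) := by
    refine (Complex.abs_re_le_norm _).trans ((norm_inner_le_norm _ _).trans (le_of_eq ?_))
    rw [norm_mul, Complex.norm_real, Real.norm_eq_abs]
    ring
  have hsq : u * ‖x‖ ^ 2 + b ^ 2 / u * ‖y‖ ^ 2 - 2 * (|b| * (‖x‖ * ‖y‖)) =
      (u * ‖x‖ - |b| * ‖y‖) ^ 2 / u := by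
    rw [← sq_abs b]
    field_simp
    ring
  have hnonneg : 0 ≤ (u * ‖x‖ - |b| * ‖y‖) ^ 2 / u := by positivity
  linarith [neg_abs_le (inner ℂ x ((b : ℂ) * y)).re]

section Spectrum

variable {d N : ℕ} {j : Mode d} {L φ : ℝ}

theorem hasSum_up_iff {E : Type*} [AddCommMonoid E] [TopologicalSpace E] (hj : j ≠ 0)
    {f g : Conf d N → E} (hf : ∀ n, ¬ 2 ≤ n.1 0 → f n = 0)
    (hg : ∀ n, ¬ (1 ≤ n.1 j ∧ 1 ≤ n.1 (-j)) → g n = 0)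
    (hfg : ∀ n : Conf d N, 2 ≤ n.1 0 → g (up j n) = f n) (a : E) : HasSum g a ↔ HasSum f a := by
  have hsupp : ∀ x : Function.support f, 2 ≤ x.1.1 0 := fun x => by
    by_contra h
    exact x.2 (hf _ h)
  refine hasSum_iff_hasSum_of_ne_zero_bij (fun x : Function.support f => up j x.1) ?_ ?_ ?_
  · intro x y hxy
    apply Subtype.ext
    rw [← down_up hj (hsupp x), ← down_up hj (hsupp y)]
    exact congrArg _ hxy
  · intro n hn
    obtain ⟨h1, h2⟩ : 1 ≤ n.1 j ∧ 1 ≤ n.1 (-j) := by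
      by_contra h
      exact hn (hg _ h)
    have hdown := hfg (down j n) (by rw [down_val hj h1 h2, pairDown_zero hj]; omega)
    rw [up_down hj h1 h2] at hdown
    exact ⟨⟨down j n, by rw [Function.mem_support, ← hdown]; exact hn⟩, up_down hj h1 h2⟩
  · exact fun x => hfg _ (hsupp x)

/-- The part of `H` that does not come from the kinetic energy; it is defined on all of `F^N`. -/
def interaction (N : ℕ) (φ : ℝ) (j : Mode d) : Fock d N →ₗ[ℂ] Fock d N :=
  diagInt N φ j + W N φ j + Wstar N φ j

theorem hBog_eq (x : dom d N L) :
    hBog N L φ j x = kinetic d N L x + interaction N φ j x.1 := rfl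

theorem interaction_apply (hj : j ≠ 0) (x : Fock d N) (n : Conf d N) : interaction N φ j x n =
    ((φ / N * ((n.1 0 : ℝ) * ((n.1 j : ℝ) + n.1 (-j))) : ℝ) : ℂ) * x n +
      (bUp j φ n : ℂ) * x (up j n) + (bDown j φ n : ℂ) * x (down j n) := by
  rw [← diagInt_apply, ← W_apply hj, ← Wstar_apply hj]
  rfl

theorem inner_W_right (hj : j ≠ 0) (x y : Fock d N) :
    inner ℂ x (W N φ j y) = inner ℂ (Wstar N φ j x) y := by
  refine (lp.hasSum_inner (𝕜 := ℂ) x (W N φ j y)).unique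
    ((hasSum_up_iff hj ?_ ?_ ?_ _).1 (lp.hasSum_inner (𝕜 := ℂ) (Wstar N φ j x) y))
  · intro n hn
    rw [W_apply hj, bUp_eq_zero hn]; simp
  · intro n hn
    rw [Wstar_apply hj, bDown_eq_zero hn]; simp
  · intro n hn
    rw [W_apply hj, Wstar_apply hj, down_up hj hn, bDown_up hj hn]
    simp only [RCLike.inner_apply, map_mul, Complex.conj_ofReal]
    ring

theorem inner_eq_of_real_multiplier {v w x y : Fock d N} (g : Conf d N → ℝ)
    (hv : ∀ n, v n = (g n : ℂ) * x n) (hw : ∀ n, w n = (g n : ℂ) * y n) :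
    inner ℂ x w = inner ℂ v y := by
  rw [lp.inner_eq_tsum, lp.inner_eq_tsum]
  refine tsum_congr fun n => ?_
  simp only [hv, hw, RCLike.inner_apply, map_mul, Complex.conj_ofReal]
  ring

theorem inner_interaction (hj : j ≠ 0) (x y : Fock d N) :
    inner ℂ x (interaction N φ j y) = inner ℂ (interaction N φ j x) y := by
  have hdiag : inner ℂ x (diagInt N φ j y) = inner ℂ (diagInt N φ j x) y :=
    inner_eq_of_real_multiplier _ (diagInt_apply φ x) (diagInt_apply φ y)
  have hWstar : inner ℂ x (Wstar N φ j y) = inner ℂ (W N φ j x) y := by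
    rw [← inner_conj_symm, ← inner_W_right hj y x, inner_conj_symm]
  simp only [interaction, LinearMap.add_apply, inner_add_left, inner_add_right, hdiag, hWstar,
    inner_W_right hj x y]
  ring

theorem inner_hBog (hj : j ≠ 0) (x y : dom d N L) :
    inner ℂ x.1 (hBog N L φ j y) = inner ℂ (hBog N L φ j x) y.1 := by
  have hkin : inner ℂ x.1 (kinetic d N L y) = inner ℂ (kinetic d N L x) y.1 :=
    inner_eq_of_real_multiplier (fun n => kinEnergy L n.1) (fun _ => rfl) fun _ => rfl
  rw [hBog_eq, hBog_eq, inner_add_right, inner_add_left, hkin, inner_interaction hj]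

theorem inner_hBog_self_im (hj : j ≠ 0) (x : dom d N L) :
    (inner ℂ x.1 (hBog N L φ j x)).im = 0 := by
  rw [← Complex.conj_eq_iff_im, inner_conj_symm, inner_hBog hj]

/-- The product states, as vectors in the domain. -/
def basisVec (L : ℝ) (m : Conf d N) : dom d N L :=
  ⟨lp.single 2 m (1 : ℂ), by
    change Memℓp _ 2
    convert lp.memℓp (lp.single (E := fun _ : Conf d N => ℂ) 2 m (kinEnergy L m.1 : ℂ)) using 2
      with n
    by_cases h : n = m
    · subst h; simp
    · simp [h]⟩

theorem inner_kinetic_basisVec (n : Conf d N) (y : Fock d N) :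
    inner ℂ (kinetic d N L (basisVec L n)) y = (kinEnergy L n.1 : ℂ) * y n := by
  have hsingle : kinetic d N L (basisVec L n) = lp.single 2 n (kinEnergy L n.1 : ℂ) := by
    ext m
    change (kinEnergy L m.1 : ℂ) * lp.single (E := fun _ : Conf d N => ℂ) 2 n (1 : ℂ) m = _
    by_cases h : m = n
    · subst h; simp
    · simp [h]
  rw [hsingle, lp.inner_single_left, RCLike.inner_apply, Complex.conj_ofReal, mul_comm]

theorem exists_hBog_eq {x v : Fock d N}
    (h : ∀ n, (kinEnergy L n.1 : ℂ) * x n + interaction N φ j x n = v n) :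
    ∃ hx : x ∈ dom d N L, hBog N L φ j ⟨x, hx⟩ = v := by
  have hkin : ∀ n, (kinEnergy L n.1 : ℂ) * x n = (v - interaction N φ j x : Fock d N) n :=
    fun n => eq_sub_of_add_eq (h n)
  have hx : x ∈ dom d N L := by
    change Memℓp _ 2
    convert lp.memℓp (v - interaction N φ j x) using 2 with n
    exact hkin n
  refine ⟨hx, ?_⟩
  ext n
  exact h n

theorem tendsto_apply {u : ℕ → Fock d N} {x : Fock d N} (h : Tendsto u atTop (𝓝 x))
    (n : Conf d N) : Tendsto (fun k => u k n) atTop (𝓝 (x n)) :=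
  ((lp.evalCLM (𝕜 := ℂ) (fun _ : Conf d N => ℂ) 2 n).continuous.tendsto x).comp h

theorem mem_range_shiftBy_of_tendsto (hj : j ≠ 0) {w : ℂ} (x : ℕ → dom d N L) (x₀ y : Fock d N)
    (hx : Tendsto (fun k => (x k : Fock d N)) atTop (𝓝 x₀))
    (hy : Tendsto (fun k => shiftBy (hBog N L φ j) w (x k)) atTop (𝓝 y)) :
    y ∈ LinearMap.range (shiftBy (hBog N L φ j) w) := by
  obtain ⟨hx₀, hH⟩ := exists_hBog_eq (L := L) (φ := φ) (j := j) (x := x₀) (v := y + w • x₀) <| by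
    intro n
    have hinteraction : Tendsto (fun k => interaction N φ j (x k).1 n) atTop
        (𝓝 (interaction N φ j x₀ n)) := by
      simp only [interaction_apply hj]
      exact (((tendsto_apply hx n).const_mul _).add ((tendsto_apply hx _).const_mul _)).add
        ((tendsto_apply hx _).const_mul _)
    have hlhs := ((tendsto_apply hx n).const_mul (kinEnergy L n.1 : ℂ)).add hinteraction
    have hrhs := (tendsto_apply hy n).add ((tendsto_apply hx n).const_mul w)
    refine tendsto_nhds_unique hlhs (hrhs.congr fun k => ?_)
    exact sub_add_cancel _ _
  exact ⟨⟨x₀, hx₀⟩, sub_eq_of_eq_add hH⟩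

theorem orthogonal_range_shiftBy_eq_bot (hj : j ≠ 0) {w : ℂ}
    (hinj : ∀ x : dom d N L, hBog N L φ j x = (starRingEnd ℂ w) • x.1 → x = 0) :
    (LinearMap.range (shiftBy (hBog N L φ j) w))ᗮ = ⊥ := by
  rw [Submodule.eq_bot_iff]
  intro y hy
  obtain ⟨hy', hH⟩ := exists_hBog_eq (L := L) (φ := φ) (j := j) (x := y)
    (v := (starRingEnd ℂ w) • y) <| by
      intro n
      have horth : inner ℂ (kinetic d N L (basisVec L n) + interaction N φ j (basisVec L n).1 -
          w • (basisVec L n).1) y = 0 := (Submodule.mem_orthogonal _ _).1 hy _ ⟨basisVec L n, rfl⟩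
      rw [inner_sub_left, inner_add_left, ← inner_interaction hj, inner_kinetic_basisVec,
        inner_smul_left] at horth
      simp only [basisVec, lp.inner_single_left, RCLike.inner_apply, map_one, mul_one] at horth
      exact sub_eq_zero.1 horth
  exact congrArg Subtype.val (hinj ⟨y, hy'⟩ hH)

theorem maskOp_univ (y : Fock d N) : maskOp Set.univ y = y := by
  ext n
  rw [maskOp_apply, Set.indicator_univ]

theorem maskDom_univ (x : dom d N L) : maskDom L Set.univ x = x :=
  Subtype.ext (maskOp_univ x.1)

theorem invertibleOn_univ_of_bijective {B : dom d N L →ₗ[ℂ] Fock d N} {c : ℝ} (hc : 0 < c)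
    (hb : ∀ x : dom d N L, c * ‖x.1‖ ≤ ‖B x‖) (hB : Function.Bijective B) :
    InvertibleOn Set.univ B := by
  let Q := LinearEquiv.ofBijective B hB
  have hBQ : ∀ y, B (Q.symm y) = y := fun y => Q.apply_symm_apply y
  refine ⟨Q.symm.toLinearMap, ⟨c⁻¹, fun y => ?_⟩, fun y => maskDom_univ _, fun y => ?_,
    fun x _ => ?_⟩
  · have hbound := hb (Q.symm y)
    rw [hBQ] at hbound
    rw [← div_eq_inv_mul, le_div_iff₀ hc, mul_comm]
    exact hbound
  · rw [maskOp_univ, maskOp_univ]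
    exact hBQ y
  · rw [maskOp_univ]
    exact Q.symm_apply_apply x

theorem invertibleOn_univ_of_bounded_below (hj : j ≠ 0) {w : ℂ} {c : ℝ} (hc : 0 < c)
    (hb : ∀ x : dom d N L, c * ‖x.1‖ ≤ ‖shiftBy (hBog N L φ j) w x‖)
    (hinj : ∀ x : dom d N L, hBog N L φ j x = (starRingEnd ℂ w) • x.1 → x = 0) :
    InvertibleOn Set.univ (shiftBy (hBog N L φ j) w) := by
  refine invertibleOn_univ_of_bijective hc hb ⟨?_, ?_⟩
  · rw [← LinearMap.ker_eq_bot, LinearMap.ker_eq_bot']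
    intro x hx
    have hbx := hb x
    rw [hx, norm_zero] at hbx
    exact Subtype.ext (norm_le_zero_iff.1 (nonpos_of_mul_nonpos_right hbx hc))
  · have : CompleteSpace (LinearMap.range (shiftBy (hBog N L φ j) w)) :=
      (isClosed_range_of_bounded_below hc hb (mem_range_shiftBy_of_tendsto hj)).completeSpace_coe
    rw [← LinearMap.range_eq_top]
    exact Submodule.orthogonal_eq_bot_iff.1 (orthogonal_range_shiftBy_eq_bot hj hinj)

theorem hasSum_norm_sq (x : Fock d N) : HasSum (fun n => ‖x n‖ ^ 2) (‖x‖ ^ 2) := by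
  simpa using lp.hasSum_norm (p := 2) (by norm_num) x

theorem hasSum_diagH (hj : j ≠ 0) (x : dom d N L) :
    HasSum (fun n => diagH j L φ n * ‖x.1 n‖ ^ 2)
      ((inner ℂ x.1 (hBog N L φ j x)).re - 2 * (inner ℂ x.1 (Wstar N φ j x.1)).re) := by
  have hsym : (inner ℂ x.1 (W N φ j x.1)).re = (inner ℂ x.1 (Wstar N φ j x.1)).re := by
    rw [inner_W_right hj, ← inner_conj_symm, Complex.conj_re]
  have hsum := ((Complex.hasSum_re (lp.hasSum_inner (𝕜 := ℂ) x.1 (hBog N L φ j x))).sub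
    (Complex.hasSum_re (lp.hasSum_inner (𝕜 := ℂ) x.1 (Wstar N φ j x.1)))).sub
    (Complex.hasSum_re (lp.hasSum_inner (𝕜 := ℂ) x.1 (W N φ j x.1)))
  rw [hsym, sub_sub, ← two_mul] at hsum
  refine hsum.congr_fun fun n => ?_
  rw [hBog_apply hj, W_apply hj, Wstar_apply hj]
  simp only [RCLike.inner_apply, ← Complex.sub_re]
  have hnorm : ‖x.1 n‖ ^ 2 = (x.1 n * (starRingEnd ℂ) (x.1 n)).re := by
    rw [Complex.mul_conj, Complex.normSq_eq_norm_sq, Complex.ofReal_re]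
  rw [hnorm, ← Complex.re_ofReal_mul]
  congr 1
  ring

/-- The off-diagonal terms are split with the weight `u` by the arithmetic-geometric mean
inequality. -/
theorem le_inner_hBog (hj : j ≠ 0) {r : ℝ} {u : Conf d N → ℝ} (hu : ∀ n, 0 ≤ u n)
    (hu' : ∀ n, bDown j φ n ≠ 0 → 0 < u n) (x : dom d N L)
    (hx : ∀ n, x.1 n ≠ 0 → u n + bUp j φ n ^ 2 / u (up j n) ≤ diagH j L φ n - r) :
    r * ‖x.1‖ ^ 2 ≤ (inner ℂ x.1 (hBog N L φ j x)).re := by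
  have hlower := Complex.hasSum_re (lp.hasSum_inner (𝕜 := ℂ) x.1 (Wstar N φ j x.1))
  have hshift := (hasSum_diagH (φ := φ) hj x).sub ((hasSum_norm_sq x.1).mul_left r)
  have hp0 : ∀ n, 0 ≤ u n * ‖x.1 n‖ ^ 2 := fun n => mul_nonneg (hu n) (by positivity)
  have hq0 : ∀ n, 0 ≤ bUp j φ n ^ 2 / u (up j n) * ‖x.1 n‖ ^ 2 := fun n =>
    mul_nonneg (div_nonneg (sq_nonneg _) (hu _)) (by positivity)
  have hpq : ∀ n, u n * ‖x.1 n‖ ^ 2 + bUp j φ n ^ 2 / u (up j n) * ‖x.1 n‖ ^ 2 ≤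
      diagH j L φ n * ‖x.1 n‖ ^ 2 - r * ‖x.1 n‖ ^ 2 := by
    intro n
    by_cases hn : x.1 n = 0
    · simp [hn]
    · rw [← add_mul, ← sub_mul]
      exact mul_le_mul_of_nonneg_right (hx n hn) (by positivity)
  have hp : Summable fun n => u n * ‖x.1 n‖ ^ 2 :=
    Summable.of_nonneg_of_le hp0 (fun n => by linarith [hpq n, hq0 n]) hshift.summable
  have hq : Summable fun n => bUp j φ n ^ 2 / u (up j n) * ‖x.1 n‖ ^ 2 :=
    Summable.of_nonneg_of_le hq0 (fun n => by linarith [hpq n, hp0 n]) hshift.summable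
  have hq' : HasSum (fun n => bDown j φ n ^ 2 / u n * ‖x.1 (down j n)‖ ^ 2)
      (∑' n, bUp j φ n ^ 2 / u (up j n) * ‖x.1 n‖ ^ 2) := by
    refine (hasSum_up_iff hj ?_ ?_ ?_ _).2 hq.hasSum
    · intro n hn; rw [bUp_eq_zero hn]; simp
    · intro n hn; rw [bDown_eq_zero hn]; simp
    · intro n hn; rw [bDown_up hj hn, down_up hj hn]
  have hoff : ∀ n, -2 * (inner ℂ (x.1 n) (Wstar N φ j x.1 n)).re ≤
      u n * ‖x.1 n‖ ^ 2 + bDown j φ n ^ 2 / u n * ‖x.1 (down j n)‖ ^ 2 := by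
    intro n
    rw [Wstar_apply hj]
    by_cases hb : bDown j φ n = 0
    · simpa [hb] using hp0 n
    · exact neg_two_mul_re_inner_le (hu' n hb) _ _ _
  linarith [hasSum_le hpq (hp.hasSum.add hq.hasSum) hshift,
    hasSum_le hoff (hlower.mul_left (-2)) (hp.hasSum.add hq')]

end Spectrum

/-! ### The ground state vector -/

section GroundState

variable {d N : ℕ} {j : Mode d} {L φ z : ℝ}

theorem basisVec_apply (m n : Conf d N) [Decidable (n = m)] :
    (basisVec L m).1 n = if n = m then 1 else 0 := by
  change lp.single (E := fun _ : Conf d N => ℂ) 2 m (1 : ℂ) n = _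
  split_ifs with h
  · subst h
    simp
  · simp [h]

theorem norm_basisVec (m : Conf d N) : ‖(basisVec L m).1‖ = 1 := by
  change ‖lp.single (E := fun _ : Conf d N => ℂ) 2 m (1 : ℂ)‖ = 1
  rw [lp.norm_single (by norm_num), norm_one]

open Classical in
theorem bDown_mul_ite_down (hj : j ≠ 0) (n m : Conf d N) :
    (bDown j φ n : ℂ) * (if down j n = m then 1 else 0) =
      (bUp j φ m : ℂ) * (if n = up j m then 1 else 0) := by
  by_cases hdown : 1 ≤ n.1 j ∧ 1 ≤ n.1 (-j) ∧ down j n = m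
  · obtain ⟨hn, hn', rfl⟩ := hdown
    rw [up_down hj hn hn', bUp_down hj hn hn', if_pos rfl, if_pos rfl]
  · have hleft : (bDown j φ n : ℂ) * (if down j n = m then 1 else 0) = 0 := by
      split_ifs with h
      · rw [bDown_eq_zero fun hn => hdown ⟨hn.1, hn.2, h⟩]
        simp
      · simp
    have hright : (bUp j φ m : ℂ) * (if n = up j m then 1 else 0) = 0 := by
      split_ifs with h
      · rw [bUp_eq_zero fun hm => hdown ?_]
        · simp
        · subst h
          rw [up_val hm, pairUp_self hj, pairUp_neg hj]
          exact ⟨by omega, by omega, down_up hj hm⟩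
      · simp
    rw [hleft, hright]

theorem Wstar_basisVec (hj : j ≠ 0) (m : Conf d N) :
    Wstar N φ j (basisVec L m).1 = (bUp j φ m : ℂ) • (basisVec L (up j m)).1 := by
  classical
  ext n
  rw [lp.coeFn_smul, Pi.smul_apply, smul_eq_mul, Wstar_apply hj, basisVec_apply, basisVec_apply]
  exact bDown_mul_ite_down hj n m

theorem W_basisVec (hj : j ≠ 0) (m : Conf d N) :
    W N φ j (basisVec L m).1 = (bDown j φ m : ℂ) • (basisVec L (down j m)).1 := by
  classical
  ext n
  rw [lp.coeFn_smul, Pi.smul_apply, smul_eq_mul, W_apply hj, basisVec_apply, basisVec_apply]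
  simpa only [eq_comm] using (bDown_mul_ite_down hj m n).symm

theorem hBog_basisVec (hj : j ≠ 0) (m : Conf d N) : hBog N L φ j (basisVec L m) =
    (diagH j L φ m : ℂ) • (basisVec L m).1 + (bUp j φ m : ℂ) • (basisVec L (up j m)).1 +
      (bDown j φ m : ℂ) • (basisVec L (down j m)).1 := by
  classical
  rw [← Wstar_basisVec hj, ← W_basisVec hj]
  ext n
  simp only [lp.coeFn_add, lp.coeFn_smul, Pi.add_apply, Pi.smul_apply, smul_eq_mul]
  rw [hBog_apply hj, W_apply hj, Wstar_apply hj, basisVec_apply]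
  by_cases h : n = m
  · rw [h]
  · simp [h]

theorem maskOp_basisVec {S : Set (Conf d N)} {m : Conf d N} (hm : m ∈ S) :
    maskOp S (basisVec L m).1 = (basisVec L m).1 := by
  classical
  ext n
  rw [maskOp_apply]
  by_cases hn : n ∈ S
  · rw [Set.indicator_of_mem hn]
  · rw [Set.indicator_of_notMem hn, basisVec_apply, if_neg]
    rintro rfl
    exact hn hm

theorem stepInv_basisVec (hj : j ≠ 0) (hz : FlowPos N L φ j z) {t : ℕ} (ht : 2 * t + 2 ≤ N)
    {m : Conf d N} (hm : m ∈ shell j (2 * t)) :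
    stepInv N L φ j z t (basisVec L m).1 = ((flowDiag L φ j z m)⁻¹ : ℂ) • basisVec L m := by
  classical
  ext n
  rw [stepInv_apply hj hz ht, Submodule.coe_smul, lp.coeFn_smul, Pi.smul_apply, smul_eq_mul]
  by_cases h : n = m
  · rw [h, Set.indicator_of_mem hm, div_eq_inv_mul]
  · rw [basisVec_apply, if_neg h, mul_zero]
    refine Set.indicator_apply_eq_zero.2 fun _ => ?_
    rw [basisVec_apply, if_neg h, zero_div]

/-- The product state with `m` pairs in the modes `±j` and all other particles in the zero mode. -/
def pairConf (N : ℕ) (j : Mode d) (m : ℕ) : Conf d N :=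
  (up j)^[m] ⟨Finsupp.single 0 N, by simp⟩

theorem pairConf_zero : pairConf N j 0 = ⟨Finsupp.single 0 N, by simp⟩ := rfl

theorem pairConf_succ (m : ℕ) : pairConf N j (m + 1) = up j (pairConf N j m) :=
  Function.iterate_succ_apply' _ _ _

theorem eta_eq : eta d N L = basisVec L (pairConf N j 0) := rfl

theorem pairConf_val (hj : j ≠ 0) {m : ℕ} (hm : 2 * m ≤ N) :
    (pairConf N j m).1 0 = N - 2 * m ∧ (pairConf N j m).1 j = m ∧ (pairConf N j m).1 (-j) = m ∧
      restKin L j (pairConf N j m).1 = 0 := by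
  induction m with
  | zero => simp [pairConf_zero, restKin, kinEnergy_single_zero, hj]
  | succ m ih =>
    obtain ⟨h_zero, h_self, h_neg, h_rest⟩ := ih (by omega)
    have hpair : 2 ≤ (pairConf N j m).1 0 := by omega
    rw [pairConf_succ, up_val hpair, pairUp_zero hj, pairUp_self hj, pairUp_neg hj,
      restKin_pairUp hj L hpair]
    exact ⟨by omega, by omega, by omega, h_rest⟩

theorem pairNum_pairConf (hj : j ≠ 0) {m : ℕ} (hm : 2 * m ≤ N) :
    pairNum j (pairConf N j m) = 2 * m := by
  obtain ⟨-, h_self, h_neg, -⟩ := pairConf_val (L := 0) hj hm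
  rw [pairNum, h_self, h_neg, two_mul]

theorem pairConf_mem_shell (hj : j ≠ 0) {m i : ℕ} (hm : 2 * m + i = N) :
    pairConf N j m ∈ shell j i := by
  left
  rw [pairNum_pairConf hj (by omega), hm]

theorem flowDiag_pairConf (hj : j ≠ 0) {m : ℕ} (hm : 2 * m ≤ N) :
    flowDiag L φ j z (pairConf N j m) = chainFrac N φ (kSq L j) 0 z (N - 2 * m) m m := by
  obtain ⟨h_zero, h_self, h_neg, h_rest⟩ := pairConf_val (L := L) hj hm
  rw [flowDiag, h_zero, h_self, h_neg, h_rest]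

theorem diagH_pairConf_zero (hj : j ≠ 0) : diagH j L φ (pairConf N j 0) = 0 := by
  obtain ⟨-, h_self, h_neg, h_rest⟩ := pairConf_val (N := N) (L := L) (m := 0) hj (by simp)
  rw [diagH_eq, h_self, h_neg, h_rest]
  simp

theorem two_le_pairConf_zero (hj : j ≠ 0) {m : ℕ} (hm : 2 * (m + 1) ≤ N) :
    2 ≤ (pairConf N j m).1 0 := by
  rw [(pairConf_val (L := 0) hj (by omega)).1]
  omega

theorem bDown_pairConf_succ (hj : j ≠ 0) {m : ℕ} (hm : 2 * (m + 1) ≤ N) :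
    bDown j φ (pairConf N j (m + 1)) = bUp j φ (pairConf N j m) := by
  rw [pairConf_succ, bDown_up hj (two_le_pairConf_zero hj hm)]

theorem down_pairConf_succ (hj : j ≠ 0) {m : ℕ} (hm : 2 * (m + 1) ≤ N) :
    down j (pairConf N j (m + 1)) = pairConf N j m := by
  rw [pairConf_succ, down_up hj (two_le_pairConf_zero hj hm)]

/-- The coefficient of the product state with `m` pairs in the ground state vector: the resolvents
of the flow are diagonal, so each factor `-R_r W*` contributes one quotient. -/
def gsCoeff (N : ℕ) (L φ : ℝ) (j : Mode d) (z : ℝ) : ℕ → ℝ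
  | 0 => 1
  | m + 1 => -(bUp j φ (pairConf N j m) / flowDiag L φ j z (pairConf N j (m + 1))) *
      gsCoeff N L φ j z m

theorem gsCoeff_zero : gsCoeff N L φ j z 0 = 1 := rfl

theorem gsCoeff_succ (m : ℕ) : gsCoeff N L φ j z (m + 1) =
    -(bUp j φ (pairConf N j m) / flowDiag L φ j z (pairConf N j (m + 1))) *
      gsCoeff N L φ j z m := rfl

theorem gsTerm_eq (hj : j ≠ 0) (hE : Even N) (hz : FlowPos N L φ j z) {m : ℕ} (hm : m < N / 2) :
    gsTerm N L φ j z m =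
      ((-gsCoeff N L φ j z (m + 1) : ℝ) : ℂ) • basisVec L (pairConf N j (m + 1)) := by
  obtain ⟨K, hK⟩ := hE
  induction m with
  | zero =>
    rw [gsTerm, eta_eq (j := j), Wstar_basisVec hj, ← pairConf_succ, map_smul,
      maskOp_basisVec (pairConf_mem_shell hj (by omega)), map_smul,
      stepInv_basisVec hj hz (by omega) (pairConf_mem_shell hj (by omega)), smul_smul,
      gsCoeff_succ, gsCoeff_zero]
    congr 1
    push_cast
    ring
  | succ m ih =>
    rw [gsTerm, ih (by omega), Submodule.coe_smul, map_smul,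
      maskOp_basisVec (pairConf_mem_shell hj (by omega)), map_smul, Wstar_basisVec hj,
      ← pairConf_succ, map_smul, map_smul, map_smul,
      maskOp_basisVec (pairConf_mem_shell hj (by omega)), map_smul,
      stepInv_basisVec hj hz (by omega) (pairConf_mem_shell hj (by omega)), smul_smul, smul_smul,
      ← neg_smul, gsCoeff_succ (m + 1)]
    congr 1
    push_cast
    ring

theorem gsVector_eq (hj : j ≠ 0) (hN : 0 < N) (hE : Even N) (hz : FlowPos N L φ j z) :
    gsVector N L φ j z = ∑ l ∈ Finset.range (N / 2 + 1),
      (gsCoeff N L φ j z l : ℂ) • basisVec L (pairConf N j l) := by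
  have hhalf : 1 ≤ N / 2 := by
    obtain ⟨K, hK⟩ := hE
    omega
  have htail : ∑ l ∈ Finset.Icc 2 (N / 2), gsTerm N L φ j z (l - 1) =
      -∑ l ∈ Finset.Icc 2 (N / 2), (gsCoeff N L φ j z l : ℂ) • basisVec L (pairConf N j l) := by
    rw [← Finset.sum_neg_distrib]
    refine Finset.sum_congr rfl fun l hl => ?_
    rw [Finset.mem_Icc] at hl
    rw [gsTerm_eq hj hE hz (by omega), Nat.sub_add_cancel (by omega)]
    simp
  have hrange : Finset.range (N / 2 + 1) = insert 0 (insert 1 (Finset.Icc 2 (N / 2))) := by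
    ext l
    simp only [Finset.mem_range, Finset.mem_insert, Finset.mem_Icc]
    omega
  rw [gsVector, gsTerm_eq hj hE hz (by omega), htail, hrange, Finset.sum_insert (by simp),
    Finset.sum_insert (by simp), eta_eq (j := j), gsCoeff_zero]
  push_cast
  module

theorem gsVector_apply_eta (hj : j ≠ 0) (hN : 0 < N) (hE : Even N) (hz : FlowPos N L φ j z) :
    (gsVector N L φ j z).1 (pairConf N j 0) = 1 := by
  classical
  rw [gsVector_eq hj hN hE hz, Submodule.coe_sum, lp.coeFn_sum, Finset.sum_apply,
    Finset.sum_eq_single 0]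
  · simp [basisVec_apply, gsCoeff_zero]
  · intro l hl hl0
    rw [Finset.mem_range] at hl
    rw [Submodule.coe_smul, lp.coeFn_smul, Pi.smul_apply, basisVec_apply, if_neg, smul_zero]
    intro h
    have := congrArg (pairNum j) h
    rw [pairNum_pairConf hj (by omega), pairNum_pairConf hj (by omega)] at this
    omega
  · simp

theorem fixFun_eq (hj : j ≠ 0) (hN : 0 < N) (hE : Even N) (hz : FlowPos N L φ j z) :
    fixFun N L φ j z = (flowDiag L φ j z (pairConf N j 0) : ℂ) := by
  obtain ⟨K, hK⟩ := hE
  rw [fixFun, eta_eq (j := j), Wstar_basisVec hj, ← pairConf_succ, map_smul,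
    stepInv_basisVec hj hz (by omega) (pairConf_mem_shell hj (by omega)), Submodule.coe_smul,
    Submodule.coe_smul, map_smul, map_smul, W_basisVec hj, bDown_pairConf_succ hj (by omega),
    down_pairConf_succ hj (by omega), flowDiag_eq hj (pairConf N j 0), ← pairConf_succ,
    diagH_pairConf_zero hj, inner_smul_right, inner_smul_right, inner_smul_right,
    inner_self_eq_norm_sq_to_K, norm_basisVec]
  push_cast
  ring

theorem diagH_mul_gsCoeff_zero (hj : j ≠ 0) (h0 : flowDiag L φ j z (pairConf N j 0) = 0) :
    diagH j L φ (pairConf N j 0) * gsCoeff N L φ j z 0 =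
      z * gsCoeff N L φ j z 0 - bUp j φ (pairConf N j 0) * gsCoeff N L φ j z 1 := by
  rw [flowDiag_eq hj, ← pairConf_succ] at h0
  rw [gsCoeff_succ, gsCoeff_zero]
  linear_combination h0

theorem diagH_mul_gsCoeff_succ (hj : j ≠ 0) (hz : FlowPos N L φ j z) {m : ℕ}
    (hm : 2 * (m + 1) ≤ N) :
    diagH j L φ (pairConf N j (m + 1)) * gsCoeff N L φ j z (m + 1) =
      z * gsCoeff N L φ j z (m + 1) - bUp j φ (pairConf N j m) * gsCoeff N L φ j z m -
        bUp j φ (pairConf N j (m + 1)) * gsCoeff N L φ j z (m + 2) := by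
  have hpos : 0 < flowDiag L φ j z (pairConf N j (m + 1)) :=
    hz.pos hj (by rw [pairNum_pairConf hj hm]; omega)
  have hfrac := flowDiag_eq (L := L) (φ := φ) (z := z) hj (pairConf N j (m + 1))
  rw [← pairConf_succ] at hfrac
  have hratio : flowDiag L φ j z (pairConf N j (m + 1)) * gsCoeff N L φ j z (m + 1) =
      -(bUp j φ (pairConf N j m) * gsCoeff N L φ j z m) := by
    rw [gsCoeff_succ]
    field_simp
  rw [gsCoeff_succ (m + 1)]
  linear_combination hratio - gsCoeff N L φ j z (m + 1) * hfrac

/-- The off-diagonal terms which remain at the bond between `m` and `m + 1` pairs when `H - z` is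
applied to the ground state vector cut off after `m` pairs. -/
def bondDefect (N : ℕ) (L φ : ℝ) (j : Mode d) (z : ℝ) (m : ℕ) : Fock d N :=
  ((bUp j φ (pairConf N j m) * gsCoeff N L φ j z m : ℝ) : ℂ) • (basisVec L (pairConf N j (m + 1))).1
    - ((bUp j φ (pairConf N j m) * gsCoeff N L φ j z (m + 1) : ℝ) : ℂ) •
      (basisVec L (pairConf N j m)).1

theorem gsCoeff_smul_hBog_zero (hj : j ≠ 0) (h0 : flowDiag L φ j z (pairConf N j 0) = 0) :
    (gsCoeff N L φ j z 0 : ℂ) • hBog N L φ j (basisVec L (pairConf N j 0)) =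
      (z : ℂ) • (gsCoeff N L φ j z 0 : ℂ) • (basisVec L (pairConf N j 0)).1 +
        bondDefect N L φ j z 0 := by
  have hdown : bDown j φ (pairConf N j 0) = 0 := by
    have := (pairConf_val (N := N) (L := L) (m := 0) hj (by omega)).2.1
    exact bDown_eq_zero (by omega)
  have hdiag := congrArg (fun x : ℝ => (x : ℂ)) (diagH_mul_gsCoeff_zero hj h0)
  push_cast at hdiag
  rw [hBog_basisVec hj, hdown, ← pairConf_succ, bondDefect]
  push_cast
  linear_combination (norm := module) hdiag • (basisVec L (pairConf N j 0)).1

theorem gsCoeff_smul_hBog_succ (hj : j ≠ 0) (hz : FlowPos N L φ j z) {m : ℕ}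
    (hm : 2 * (m + 1) ≤ N) :
    (gsCoeff N L φ j z (m + 1) : ℂ) • hBog N L φ j (basisVec L (pairConf N j (m + 1))) =
      (z : ℂ) • (gsCoeff N L φ j z (m + 1) : ℂ) • (basisVec L (pairConf N j (m + 1))).1 +
        (bondDefect N L φ j z (m + 1) - bondDefect N L φ j z m) := by
  have hdiag := congrArg (fun x : ℝ => (x : ℂ)) (diagH_mul_gsCoeff_succ hj hz hm)
  push_cast at hdiag
  rw [hBog_basisVec hj, bDown_pairConf_succ hj hm, down_pairConf_succ hj hm, ← pairConf_succ,
    bondDefect, bondDefect]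
  push_cast
  linear_combination (norm := module) hdiag • (basisVec L (pairConf N j (m + 1))).1

theorem bondDefect_half (hj : j ≠ 0) : bondDefect N L φ j z (N / 2) = 0 := by
  have hempty : ¬ 2 ≤ (pairConf N j (N / 2)).1 0 := by
    rw [(pairConf_val (L := L) hj (by omega)).1]
    omega
  simp [bondDefect, bUp_eq_zero hempty]

theorem hBog_gsVector (hj : j ≠ 0) (hN : 0 < N) (hE : Even N) (hz : FlowPos N L φ j z)
    (h0 : flowDiag L φ j z (pairConf N j 0) = 0) :
    hBog N L φ j (gsVector N L φ j z) = (z : ℂ) • (gsVector N L φ j z).1 := by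
  have hterm : ∀ l ∈ Finset.range (N / 2),
      (gsCoeff N L φ j z (l + 1) : ℂ) • hBog N L φ j (basisVec L (pairConf N j (l + 1))) =
        (z : ℂ) • (gsCoeff N L φ j z (l + 1) : ℂ) • (basisVec L (pairConf N j (l + 1))).1 +
          (bondDefect N L φ j z (l + 1) - bondDefect N L φ j z l) := fun l hl => by
    rw [Finset.mem_range] at hl
    exact gsCoeff_smul_hBog_succ hj hz (by omega)
  rw [gsVector_eq hj hN hE hz, Finset.sum_range_succ', map_add, map_sum, Submodule.coe_add,
    Submodule.coe_sum, smul_add, Finset.smul_sum]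
  simp only [map_smul, Submodule.coe_smul]
  rw [Finset.sum_congr rfl hterm, Finset.sum_add_distrib, Finset.sum_range_sub,
    gsCoeff_smul_hBog_zero hj h0, bondDefect_half hj]
  module

/-- A bound on the coefficients of the ground state vector which depends only on `ε`. -/
def coeffBound (ε e : ℝ) (m : ℕ) : ℝ :=
  ∏ i ∈ Finset.range m, ratioBound ε e (2 * ((i : ℝ) + 1))

theorem coeffBound_succ (ε e : ℝ) (m : ℕ) :
    coeffBound ε e (m + 1) = coeffBound ε e m * ratioBound ε e (2 * ((m : ℝ) + 1)) :=
  Finset.prod_range_succ _ _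

theorem coeffBound_pos {ε e s : ℝ} (h : SmallCoupling ε e s) (m : ℕ) : 0 < coeffBound ε e m :=
  Finset.prod_pos fun _ _ => ratioBound_pos h (by positivity)

theorem tendsto_ratioBound (ε e : ℝ) :
    Tendsto (fun m : ℕ => ratioBound ε e (2 * ((m : ℝ) + 1))) atTop (𝓝 (1 + ε - e)) := by
  have hlim := ((tendsto_one_div_add_atTop_nhds_zero_nat (𝕜 := ℝ)).const_mul e).const_add 1
    |>.const_mul (1 + ε - e)
  rw [mul_zero, add_zero, mul_one] at hlim
  refine hlim.congr fun m => ?_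
  rw [ratioBound]
  field_simp

theorem summable_coeffBound {ε e s : ℝ} (h : SmallCoupling ε e s) :
    Summable (coeffBound ε e) := by
  have hratio : 1 + ε - e < 1 := by nlinarith [h.e_sq, h.eps_pos, h.e_pos]
  refine summable_of_ratio_test_tendsto_lt_one hratio
    (Eventually.of_forall fun m => (coeffBound_pos h m).ne') ?_
  refine (tendsto_ratioBound ε e).congr fun m => ?_
  have hpos := coeffBound_pos h m
  rw [Real.norm_of_nonneg (coeffBound_pos h _).le, Real.norm_of_nonneg hpos.le, coeffBound_succ,
    mul_div_cancel_left₀ _ hpos.ne']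

theorem bUp_pairConf_le (hφ : 0 ≤ φ) (hj : j ≠ 0) {k m : ℕ} (hk : N = 2 * (m + 1) + k) :
    bUp j φ (pairConf N j m) ≤ φ / N * (((k : ℝ) + 3 / 2) * ((m : ℝ) + 1)) := by
  obtain ⟨h_zero, h_self, h_neg, -⟩ := pairConf_val (N := N) (L := 0) (m := m) hj (by omega)
  refine abs_le_of_sq_le_sq' ?_ (by positivity) |>.2
  rw [bUp_sq, h_zero, h_self, h_neg, show N - 2 * m = k + 2 by omega]
  push_cast
  calc _ = (φ / N) ^ 2 * (((k : ℝ) + 2) * ((k : ℝ) + 1)) * (((m : ℝ) + 1) * ((m : ℝ) + 1)) := by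
        ring
    _ ≤ (φ / N * (((k : ℝ) + 3 / 2) * (((m : ℝ) + m + 2) / 2))) ^ 2 := pair_weight_le _ k m m
    _ = _ := by ring

theorem bUp_div_flowDiag_le {ε e s : ℝ} (h : SmallCoupling ε e s) (hφ : 0 < φ)
    (hκ : kSq L j = φ * ε) (hj : j ≠ 0) (hz : z ≤ -(φ * (1 + ε - e)) + φ * (e * s)) {m : ℕ}
    (hm : 2 * (m + 1) ≤ N) (hpos : 0 < flowDiag L φ j z (pairConf N j (m + 1))) :
    bUp j φ (pairConf N j m) / flowDiag L φ j z (pairConf N j (m + 1)) ≤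
      ratioBound ε e (2 * ((m : ℝ) + 1)) := by
  obtain ⟨k, hk⟩ := Nat.exists_eq_add_of_le hm
  have hN : (0 : ℝ) < N := by
    rw [hk]
    positivity
  have hge := le_chainFrac h hN hφ hκ le_rfl hz k (m + 1) (m + 1)
    (by push_cast; linarith [m.cast_nonneg (α := ℝ)]) (by rw [hk]; push_cast; linarith)
  rw [zero_add, show k = N - 2 * (m + 1) by omega, ← flowDiag_pairConf hj hm,
    show N - 2 * (m + 1) = k by omega,
    show ((m + 1 : ℕ) : ℝ) + (m + 1 : ℕ) = 2 * ((m : ℝ) + 1) by push_cast; ring,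
    mul_div_cancel_left₀ _ (two_ne_zero' ℝ), ← mul_div_assoc,
    div_le_iff₀ (ratioBound_pos h (by positivity))] at hge
  rw [div_le_iff₀ hpos, mul_comm]
  exact (bUp_pairConf_le hφ.le hj hk).trans hge

theorem abs_gsCoeff_le {ε e s : ℝ} (h : SmallCoupling ε e s) (hN : 0 < N) (hφ : 0 < φ)
    (hκ : kSq L j = φ * ε) (hj : j ≠ 0) (hz : z ≤ -(φ * (1 + ε - e)) + φ * (e * s)) {m : ℕ}
    (hm : 2 * m ≤ N) : |gsCoeff N L φ j z m| ≤ coeffBound ε e m := by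
  induction m with
  | zero => simp [gsCoeff_zero, coeffBound]
  | succ m ih =>
    have hpos := (flowPos h hN hφ hκ hj hz).pos hj (n := pairConf N j (m + 1))
      (by rw [pairNum_pairConf hj hm]; omega)
    rw [gsCoeff_succ, abs_mul, abs_neg, abs_div, abs_of_pos hpos,
      abs_of_nonneg (bUp_nonneg hφ.le _), coeffBound_succ, mul_comm]
    exact mul_le_mul (ih (by omega)) (bUp_div_flowDiag_le h hφ hκ hj hz hm hpos)
      (div_nonneg (bUp_nonneg hφ.le _) hpos.le) (coeffBound_pos h m).le

end GroundState

/-! ### The spectrum above a nondegenerate ground state -/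

section SymmetricGap

variable {E : Type*} [NormedAddCommGroup E] [InnerProductSpace ℂ E]

theorem mul_norm_le_of_mul_norm_sq_le {c : ℝ} {x v : E} (h : c * ‖x‖ ^ 2 ≤ ‖inner ℂ x v‖) :
    c * ‖x‖ ≤ ‖v‖ := by
  rcases (norm_nonneg x).eq_or_lt with hx | hx
  · simp [← hx]
  · refine le_of_mul_le_mul_left ?_ hx
    linarith [norm_inner_le_norm (𝕜 := ℂ) x v]

theorem inner_sub_smul_self (c : ℂ) (x v : E) :
    inner ℂ x (v - c • x) = inner ℂ x v - c * ((‖x‖ ^ 2 : ℝ) : ℂ) := by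
  rw [inner_sub_right, inner_smul_right, inner_self_eq_norm_sq_to_K]
  push_cast
  rfl

theorem sub_mul_norm_le {r s : ℝ} {x v : E} (h : r * ‖x‖ ^ 2 ≤ (inner ℂ x v).re) :
    (r - s) * ‖x‖ ≤ ‖v - (s : ℂ) • x‖ := by
  refine mul_norm_le_of_mul_norm_sq_le (le_trans ?_ (Complex.re_le_norm _))
  rw [inner_sub_smul_self, Complex.sub_re, ← Complex.ofReal_mul, Complex.ofReal_re]
  linarith

theorem abs_im_mul_norm_le (w : ℂ) {x v : E} (h : (inner ℂ x v).im = 0) :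
    |w.im| * ‖x‖ ≤ ‖v - w • x‖ := by
  refine mul_norm_le_of_mul_norm_sq_le (le_of_eq_of_le ?_ (Complex.abs_im_le_norm _))
  rw [inner_sub_smul_self, Complex.sub_im, h, Complex.im_mul_ofReal, zero_sub, abs_neg, abs_mul,
    abs_sq]

theorem norm_sq_add_of_inner_eq_zero {x y : E} (h : inner ℂ x y = 0) :
    ‖x + y‖ ^ 2 = ‖x‖ ^ 2 + ‖y‖ ^ 2 := by
  simpa only [sq] using norm_add_sq_eq_norm_sq_add_norm_sq_of_inner_eq_zero (𝕜 := ℂ) x y h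

theorem exists_smul_add_orthogonal {D : Submodule ℂ E} {ψ : D} (hψ : ψ ≠ 0) (x : D) :
    ∃ (a : ℂ) (y : D), x = a • ψ + y ∧ inner ℂ (ψ : E) (y : E) = 0 := by
  have hinner : inner ℂ (ψ : E) (ψ : E) ≠ 0 := by
    rwa [ne_eq, inner_self_eq_zero, ZeroMemClass.coe_eq_zero]
  refine ⟨inner ℂ (ψ : E) (x : E) / inner ℂ (ψ : E) (ψ : E), x - _, (add_sub_cancel _ _).symm, ?_⟩
  rw [Submodule.coe_sub, Submodule.coe_smul, inner_sub_right, inner_smul_right,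
    div_mul_cancel₀ _ hinner, sub_self]

variable {D : Submodule ℂ E} {A : D →ₗ[ℂ] E} {ψ : D} {f : D →ₗ[ℂ] ℂ} {z r : ℝ}

theorem le_inner_of_orthogonal
    (hA : ∀ x y : D, inner ℂ (x : E) (A y) = inner ℂ (A x) (y : E))
    (hψ : A ψ = (z : ℂ) • (ψ : E)) (hf : f ψ = 1) (hzr : z ≤ r)
    (hform : ∀ x : D, f x = 0 → r * ‖(x : E)‖ ^ 2 ≤ (inner ℂ (x : E) (A x)).re)
    {y : D} (hy : inner ℂ (ψ : E) (y : E) = 0) :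
    r * ‖(y : E)‖ ^ 2 ≤ (inner ℂ (y : E) (A y)).re := by
  set b : ℂ := -f y
  have hy' : inner ℂ (y : E) (ψ : E) = 0 := inner_eq_zero_symm.1 hy
  have hψy : inner ℂ (ψ : E) (A y) = 0 := by
    rw [hA, hψ, inner_smul_left, hy, mul_zero]
  have hnorm : ‖(y : E) + b • (ψ : E)‖ ^ 2 = ‖(y : E)‖ ^ 2 + ‖b • (ψ : E)‖ ^ 2 :=
    norm_sq_add_of_inner_eq_zero (by rw [inner_smul_right, hy', mul_zero])
  have henergy : inner ℂ ((y : E) + b • (ψ : E)) (A (y + b • ψ)) =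
      inner ℂ (y : E) (A y) + ((z * ‖b • (ψ : E)‖ ^ 2 : ℝ) : ℂ) := by
    rw [map_add, map_smul, hψ, smul_comm, inner_add_left, inner_add_right, inner_add_right,
      inner_smul_right, inner_smul_right, hy', inner_smul_left, hψy, inner_smul_right,
      inner_self_eq_norm_sq_to_K]
    push_cast
    simp only [mul_zero, add_zero, zero_add]
    rfl
  have hle := hform (y + b • ψ) (by simp [b, hf])
  rw [Submodule.coe_add, Submodule.coe_smul, hnorm, henergy, Complex.add_re,
    Complex.ofReal_re] at hle
  linarith [mul_le_mul_of_nonneg_right hzr (sq_nonneg ‖b • (ψ : E)‖)]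

theorem min_mul_norm_le
    (hA : ∀ x y : D, inner ℂ (x : E) (A y) = inner ℂ (A x) (y : E))
    (hψ : A ψ = (z : ℂ) • (ψ : E)) (hψ0 : ψ ≠ 0) {s : ℝ} (hs : s ≤ r)
    (hform : ∀ y : D, inner ℂ (ψ : E) (y : E) = 0 →
      r * ‖(y : E)‖ ^ 2 ≤ (inner ℂ (y : E) (A y)).re) (x : D) :
    min |z - s| (r - s) * ‖(x : E)‖ ≤ ‖A x - (s : ℂ) • (x : E)‖ := by
  obtain ⟨a, y, rfl, hy⟩ := exists_smul_add_orthogonal hψ0 x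
  have hψ_part : A (a • ψ) - (s : ℂ) • a • (ψ : E) = ((z - s : ℝ) : ℂ) • a • (ψ : E) := by
    rw [map_smul, hψ]
    push_cast
    module
  have hsplit : A (a • ψ + y) - (s : ℂ) • ((a • ψ + y : D) : E) =
      ((z - s : ℝ) : ℂ) • a • (ψ : E) + (A y - (s : ℂ) • (y : E)) := by
    rw [← hψ_part, map_add, Submodule.coe_add, Submodule.coe_smul]
    module
  have horth : inner ℂ (((z - s : ℝ) : ℂ) • a • (ψ : E)) (A y - (s : ℂ) • (y : E)) = 0 := by
    rw [inner_smul_left, inner_smul_left, inner_sub_right, hA, hψ, inner_smul_left,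
      inner_smul_right, hy]
    simp
  set c := min |z - s| (r - s)
  have : 0 ≤ c := le_min (abs_nonneg _) (sub_nonneg.2 hs)
  have hψ_le : c * ‖a • (ψ : E)‖ ≤ ‖((z - s : ℝ) : ℂ) • a • (ψ : E)‖ := by
    rw [norm_smul _ (a • (ψ : E)), Complex.norm_real, Real.norm_eq_abs]
    gcongr
    exact min_le_left _ _
  have hy_le : c * ‖(y : E)‖ ≤ ‖A y - (s : ℂ) • (y : E)‖ :=
    (mul_le_mul_of_nonneg_right (min_le_right _ _) (norm_nonneg _)).trans
      (sub_mul_norm_le (hform y hy))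
  refine le_of_sq_le_sq ?_ (norm_nonneg _)
  calc (c * ‖((a • ψ + y : D) : E)‖) ^ 2
      = (c * ‖a • (ψ : E)‖) ^ 2 + (c * ‖(y : E)‖) ^ 2 := by
        rw [Submodule.coe_add, Submodule.coe_smul, mul_pow,
          norm_sq_add_of_inner_eq_zero (by rw [inner_smul_left, hy, mul_zero])]
        ring
    _ ≤ ‖((z - s : ℝ) : ℂ) • a • (ψ : E)‖ ^ 2 + ‖A y - (s : ℂ) • (y : E)‖ ^ 2 := by gcongr
    _ = ‖A (a • ψ + y) - (s : ℂ) • ((a • ψ + y : D) : E)‖ ^ 2 := by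
        rw [hsplit, norm_sq_add_of_inner_eq_zero horth]

theorem eq_smul_of_eigenvector (hψ : A ψ = (z : ℂ) • (ψ : E)) (hf : f ψ = 1) (hzr : z < r)
    (hform : ∀ x : D, f x = 0 → r * ‖(x : E)‖ ^ 2 ≤ (inner ℂ (x : E) (A x)).re)
    {x : D} (hx : A x = (z : ℂ) • (x : E)) : x = f x • ψ := by
  set y := x - f x • ψ
  have hy : A y - (z : ℂ) • (y : E) = 0 := by
    rw [map_sub, map_smul, hx, hψ, Submodule.coe_sub, Submodule.coe_smul]
    module
  have hle : (r - z) * ‖(y : E)‖ ≤ 0 := by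
    simpa only [hy, norm_zero] using sub_mul_norm_le (s := z) (hform y (by simp [y, hf]))
  have hy0 : ‖(y : E)‖ ≤ 0 := nonpos_of_mul_nonpos_right hle (sub_pos.2 hzr)
  exact sub_eq_zero.1 (Subtype.ext (norm_le_zero_iff.1 hy0))

end SymmetricGap

section Gap

variable {d N : ℕ} {j : Mode d} {L φ z r : ℝ}

theorem eq_zero_of_hBog_eq {c : ℝ} {w : ℂ} (hc : 0 < c)
    (hle : ∀ x : dom d N L, c * ‖x.1‖ ≤ ‖hBog N L φ j x - w • x.1‖) {x : dom d N L}
    (hx : hBog N L φ j x = w • x.1) : x = 0 := by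
  have hx0 := hle x
  rw [hx, sub_self, norm_zero] at hx0
  exact Subtype.ext (norm_le_zero_iff.1 (nonpos_of_mul_nonpos_right hx0 hc))

theorem notMem_spec_ofReal (hj : j ≠ 0) {c s : ℝ} (hc : 0 < c)
    (hle : ∀ x : dom d N L, c * ‖x.1‖ ≤ ‖hBog N L φ j x - (s : ℂ) • x.1‖) :
    (s : ℂ) ∉ spec (hBog N L φ j) := by
  refine not_not.2 (invertibleOn_univ_of_bounded_below hj hc hle fun x hx => ?_)
  rw [Complex.conj_ofReal] at hx
  exact eq_zero_of_hBog_eq hc hle hx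

theorem im_eq_zero_of_mem_spec (hj : j ≠ 0) {w : ℂ} (hw : w ∈ spec (hBog N L φ j)) :
    w.im = 0 := by
  by_contra him
  have hle : ∀ (v : ℂ) (x : dom d N L), |v.im| * ‖x.1‖ ≤ ‖hBog N L φ j x - v • x.1‖ :=
    fun v x => abs_im_mul_norm_le v (inner_hBog_self_im hj x)
  have hconj : 0 < |((starRingEnd ℂ) w).im| := by
    rwa [Complex.conj_im, abs_neg, abs_pos]
  exact hw (invertibleOn_univ_of_bounded_below hj (abs_pos.2 him) (hle w)
    fun x hx => eq_zero_of_hBog_eq hconj (hle _) hx)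

theorem le_re_of_mem_spec (hj : j ≠ 0) {ψ : dom d N L} (hψ : hBog N L φ j ψ = (z : ℂ) • ψ.1)
    (hψ0 : ψ ≠ 0)
    (hform : ∀ y : dom d N L, inner ℂ ψ.1 y.1 = 0 →
      r * ‖y.1‖ ^ 2 ≤ (inner ℂ y.1 (hBog N L φ j y)).re)
    {w : ℂ} (hw : w ∈ spec (hBog N L φ j)) (hwz : w ≠ z) : r ≤ w.re := by
  obtain ⟨s, rfl⟩ : ∃ s : ℝ, w = s :=
    ⟨w.re, Complex.ext rfl (by simp [im_eq_zero_of_mem_spec hj hw])⟩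
  rw [Complex.ofReal_re]
  by_contra! hsr
  have hpos : 0 < min |z - s| (r - s) :=
    lt_min (abs_pos.2 (sub_ne_zero.2 fun h => hwz (by rw [h]))) (sub_pos.2 hsr)
  exact notMem_spec_ofReal hj hpos (min_mul_norm_le (inner_hBog hj) hψ hψ0 hsr.le hform) hw

end Gap

/-! ### The quadratic form on the states orthogonal to `η` -/

section FormBound

variable {d N : ℕ} {j : Mode d} {L φ z z' r : ℝ}

theorem sq_le_kSq {L : ℝ} {p : Mode d} (hp : p ≠ 0) : (2 * Real.pi / L) ^ 2 ≤ kSq L p := by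
  obtain ⟨i, hi⟩ : ∃ i, p i ≠ 0 := Function.ne_iff.1 hp
  have hone : (1 : ℝ) ≤ (p i : ℝ) ^ 2 := by
    exact_mod_cast Int.add_one_le_iff.2 (sq_pos_of_ne_zero hi)
  calc (2 * Real.pi / L) ^ 2 ≤ (2 * Real.pi / L) ^ 2 * (p i : ℝ) ^ 2 :=
        le_mul_of_one_le_right (sq_nonneg _) hone
    _ = (2 * Real.pi / L * (p i : ℝ)) ^ 2 := by ring
    _ ≤ kSq L p := Finset.single_le_sum (f := fun i => (2 * Real.pi / L * (p i : ℝ)) ^ 2)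
        (fun _ _ => sq_nonneg _) (Finset.mem_univ i)

theorem sq_le_gap0 (hj : j ≠ 0) (L : ℝ) : (2 * Real.pi / L) ^ 2 ≤ gap0 d L := by
  have : Nonempty {p : Mode d // p ≠ 0} := ⟨⟨j, hj⟩⟩
  exact le_ciInf fun p => sq_le_kSq p.2

theorem gap0_pos (hj : j ≠ 0) (hL : 0 < L) : 0 < gap0 d L :=
  (sq_pos_of_pos (div_pos Real.two_pi_pos hL)).trans_le (sq_le_gap0 hj L)

/-- A product state with equally many particles in the modes `j` and `-j`, and with particles
outside of the three modes `0`, `±j`. Its chain looks like the chain of `η` with fewer particles in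
the zero mode and at least `Δ₀` more kinetic energy. -/
def IsBalanced (j : Mode d) (n : Conf d N) : Prop :=
  n.1 j = n.1 (-j) ∧ n.1 0 + pairNum j n ≠ N

theorem isBalanced_up (hj : j ≠ 0) {n : Conf d N} (hu : 2 ≤ n.1 0) :
    IsBalanced j (up j n) ↔ IsBalanced j n := by
  rw [IsBalanced, IsBalanced, pairNum_up hj hu, up_val hu, pairUp_self hj, pairUp_neg hj,
    pairUp_zero hj]
  omega

theorem IsBalanced.pairNum_eq {n : Conf d N} (hn : IsBalanced j n) : pairNum j n = 2 * n.1 j := by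
  rw [pairNum, ← hn.1, two_mul]

theorem IsBalanced.zero_add_lt {n : Conf d N} (hj : j ≠ 0) (hn : IsBalanced j n) :
    n.1 0 + 2 * n.1 j < N := by
  rw [← hn.pairNum_eq]
  exact (zero_add_pairNum_le hj n).lt_of_ne hn.2

theorem IsBalanced.zero_lt_sub {n : Conf d N} (hj : j ≠ 0) (hn : IsBalanced j n) :
    (n.1 0 : ℝ) < (N : ℝ) - 2 * n.1 j := by
  rw [lt_sub_iff_add_lt]
  exact_mod_cast hn.zero_add_lt hj

theorem IsBalanced.gap0_le_restKin {n : Conf d N} (hj : j ≠ 0) (hn : IsBalanced j n) (L : ℝ) :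
    gap0 d L ≤ restKin L j n.1 := by
  refine ThreeMode.gap0_le_restKin hj L ?_
  rw [n.2, add_assoc]
  exact hn.2

theorem not_isBalanced_pairConf_zero (hj : j ≠ 0) : ¬ IsBalanced j (pairConf N j 0) := fun h =>
  h.2 (by rw [pairNum_pairConf hj (by omega), (pairConf_val (L := 0) hj (by omega)).1]; omega)

theorem eq_pairConf_zero {n : Conf d N} (h : n.1 0 = N) : n = pairConf N j 0 := by
  have hsplit : Finsupp.single 0 N + n.1.erase 0 = n.1 := by
    conv_rhs => rw [← Finsupp.single_add_erase 0 n.1, h]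
  have hrest : n.1.erase 0 = 0 := by
    have hdeg := congrArg Finsupp.degree hsplit
    rw [map_add, Finsupp.degree_single, n.2] at hdeg
    rw [← Finsupp.degree_eq_zero_iff]
    omega
  apply Subtype.ext
  rw [← hsplit, hrest, add_zero, pairConf_zero]

theorem up_ne_pairConf_zero (hj : j ≠ 0) {n : Conf d N} (hu : 2 ≤ n.1 0) :
    up j n ≠ pairConf N j 0 := by
  intro heq
  have hpair := pairNum_up hj hu
  rw [heq, pairNum_pairConf hj (by omega)] at hpair
  omega

open Classical in
/-- The weight in the quadratic form bound away from `η`: on balanced product states it is a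
multiple of the flow along the chain of `η` at the ground state energy `z`, on all others the flow
at the energy `z'`. -/
def formWeight (L φ : ℝ) (j : Mode d) (z z' : ℝ) (n : Conf d N) : ℝ :=
  if IsBalanced j n then
    flowDiag L φ j z (pairConf N j (n.1 j)) * (((n.1 0 : ℝ) + 2) / ((N : ℝ) - 2 * n.1 j + 2))
  else if n = pairConf N j 0 then 0
  else flowDiag L φ j z' n

theorem formWeight_of_isBalanced {n : Conf d N} (hn : IsBalanced j n) :
    formWeight L φ j z z' n = flowDiag L φ j z (pairConf N j (n.1 j)) *
      (((n.1 0 : ℝ) + 2) / ((N : ℝ) - 2 * n.1 j + 2)) :=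
  if_pos hn

theorem formWeight_pairConf_zero (hj : j ≠ 0) :
    formWeight L φ j z z' (pairConf N j 0) = 0 := by
  rw [formWeight, if_neg (not_isBalanced_pairConf_zero hj), if_pos rfl]

theorem formWeight_of_not_isBalanced {n : Conf d N} (hn : ¬ IsBalanced j n)
    (hn0 : n ≠ pairConf N j 0) : formWeight L φ j z z' n = flowDiag L φ j z' n := by
  rw [formWeight, if_neg hn, if_neg hn0]

theorem formWeight_pos (hj : j ≠ 0) (hz : FlowPos N L φ j z) (hz' : FlowPos N L φ j z')
    {n : Conf d N} (hn : 1 ≤ pairNum j n) : 0 < formWeight L φ j z z' n := by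
  by_cases hbal : IsBalanced j n
  · have hsub := hbal.zero_lt_sub hj
    have hlt := hbal.zero_add_lt hj
    have hflow : 0 < flowDiag L φ j z (pairConf N j (n.1 j)) :=
      hz.pos hj (by rw [pairNum_pairConf hj (by omega), ← hbal.pairNum_eq]; exact hn)
    rw [formWeight_of_isBalanced hbal]
    have : (0 : ℝ) ≤ n.1 0 := Nat.cast_nonneg _
    exact mul_pos hflow (div_pos (by linarith) (by linarith))
  · rw [formWeight_of_not_isBalanced hbal]
    · exact hz'.pos hj hn
    · rintro rfl
      rw [pairNum_pairConf hj (by omega)] at hn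
      omega

theorem formWeight_nonneg (hj : j ≠ 0) (hz : FlowPos N L φ j z) (hz' : FlowPos N L φ j z')
    (hzero : flowDiag L φ j z (pairConf N j 0) = 0) (n : Conf d N) :
    0 ≤ formWeight L φ j z z' n := by
  by_cases hn : 1 ≤ pairNum j n
  · exact (formWeight_pos hj hz hz' hn).le
  · have hmodes : n.1 j = 0 ∧ n.1 (-j) = 0 := by rw [pairNum] at hn; omega
    by_cases hbal : IsBalanced j n
    · rw [formWeight_of_isBalanced hbal, hmodes.1, hzero, zero_mul]
    · have hN : n.1 0 = N := by
        by_contra hne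
        exact hbal ⟨by omega, by omega⟩
      rw [eq_pairConf_zero (j := j) hN, formWeight_pairConf_zero hj]

theorem bUp_sq_div_formWeight_up_le (hj : j ≠ 0) (hz : FlowPos N L φ j z) {n : Conf d N}
    (hn : IsBalanced j n) (hu : 2 ≤ n.1 0) :
    bUp j φ n ^ 2 / formWeight L φ j z z' (up j n) ≤
      bUp j φ (pairConf N j (n.1 j)) ^ 2 / flowDiag L φ j z (pairConf N j (n.1 j + 1)) *
        ((n.1 0 : ℝ) / ((N : ℝ) - 2 * n.1 j)) := by
  have hlt := hn.zero_add_lt hj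
  have hsub := hn.zero_lt_sub hj
  have htwo : (2 : ℝ) ≤ n.1 0 := by exact_mod_cast hu
  obtain ⟨h_zero, h_self, h_neg, -⟩ := pairConf_val (L := L) hj (m := n.1 j) (N := N) (by omega)
  have hflow : 0 < flowDiag L φ j z (pairConf N j (n.1 j + 1)) :=
    hz.pos hj (by rw [pairNum_pairConf hj (by omega)]; omega)
  have hweight : formWeight L φ j z z' (up j n) =
      flowDiag L φ j z (pairConf N j (n.1 j + 1)) * ((n.1 0 : ℝ) / ((N : ℝ) - 2 * n.1 j)) := by
    rw [formWeight_of_isBalanced ((isBalanced_up hj hu).2 hn), up_val hu, pairUp_self hj,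
      pairUp_zero hj]
    push_cast [Nat.cast_sub hu]
    congr 2 <;> ring
  rw [hweight, bUp_sq, bUp_sq, h_zero, h_self, h_neg, ← hn.1]
  push_cast [Nat.cast_sub (show 2 * n.1 j ≤ N by omega)]
  set a : ℝ := (n.1 j : ℝ)
  set m : ℝ := (N : ℝ) - 2 * a
  set k : ℝ := (n.1 0 : ℝ)
  set F := flowDiag L φ j z (pairConf N j (n.1 j + 1))
  have hm : 0 < m := by linarith
  have hk : k ≠ 0 := by linarith
  have hstep : k - 1 ≤ (m - 1) * (k / m) := by
    rw [← mul_div_assoc, le_div_iff₀ hm]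
    nlinarith
  calc (φ / N) ^ 2 * (k * (k - 1)) * ((a + 1) * (a + 1)) / (F * (k / m))
      = (φ / N) ^ 2 * (m * (k - 1)) * ((a + 1) * (a + 1)) / F := by field_simp
    _ ≤ (φ / N) ^ 2 * (m * ((m - 1) * (k / m))) * ((a + 1) * (a + 1)) / F := by gcongr
    _ = (φ / N) ^ 2 * (m * (m - 1)) * ((a + 1) * (a + 1)) / F * (k / m) := by ring

theorem bUp_sq_div_flowDiag_nonneg (hj : j ≠ 0) (hz : FlowPos N L φ j z) (m : ℕ) :
    0 ≤ bUp j φ (pairConf N j m) ^ 2 / flowDiag L φ j z (pairConf N j (m + 1)) := by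
  by_cases hu : 2 ≤ (pairConf N j m).1 0
  · rw [pairConf_succ]
    exact div_nonneg (sq_nonneg _) (hz.pos hj (by rw [pairNum_up hj hu]; omega)).le
  · simp [bUp_eq_zero hu]

theorem formWeight_add_le_of_isBalanced (hj : j ≠ 0) (hz : FlowPos N L φ j z) (hz0 : z ≤ 0)
    (hκ : 2 * (φ / N) ≤ kSq L j) (hr : r ≤ z + gap0 d L) {n : Conf d N} (hn : IsBalanced j n) :
    formWeight L φ j z z' n + bUp j φ n ^ 2 / formWeight L φ j z z' (up j n) ≤
      diagH j L φ n - r := by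
  have hlt := hn.zero_add_lt hj
  obtain ⟨h_zero, h_self, h_neg, h_rest⟩ :=
    pairConf_val (L := L) hj (m := n.1 j) (N := N) (by omega)
  set R := bUp j φ (pairConf N j (n.1 j)) ^ 2 / flowDiag L φ j z (pairConf N j (n.1 j + 1))
    with hR
  have hR_nonneg : 0 ≤ R := bUp_sq_div_flowDiag_nonneg hj hz _
  have hchain : R + flowDiag L φ j z (pairConf N j (n.1 j)) =
      2 * n.1 j * (kSq L j + φ / N * ((N : ℝ) - 2 * n.1 j)) - z := by
    rw [flowDiag_eq hj, ← pairConf_succ, ← hR, diagH_eq, h_zero, h_self, h_neg, h_rest]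
    push_cast [Nat.cast_sub (show 2 * n.1 j ≤ N by omega)]
    ring
  have hsuper := supersolution_of_lt (Nat.cast_nonneg (n.1 0)) (hn.zero_lt_sub hj)
    (Nat.cast_nonneg (n.1 j)) hκ hz0 hR_nonneg hchain
  have hnext : bUp j φ n ^ 2 / formWeight L φ j z z' (up j n) ≤
      R * ((n.1 0 : ℝ) / ((N : ℝ) - 2 * n.1 j)) := by
    by_cases hu : 2 ≤ n.1 0
    · exact bUp_sq_div_formWeight_up_le hj hz hn hu
    · have hsub := (Nat.cast_nonneg (n.1 0)).trans_lt (hn.zero_lt_sub hj)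
      rw [bUp_eq_zero hu, zero_pow two_ne_zero, zero_div]
      positivity
  rw [formWeight_of_isBalanced hn, diagH_eq, ← hn.1]
  linarith [hn.gap0_le_restKin hj L]

theorem formWeight_add_le_of_not_isBalanced (hj : j ≠ 0) (hr : r ≤ z') {n : Conf d N}
    (hn : ¬ IsBalanced j n) (hn0 : n ≠ pairConf N j 0) :
    formWeight L φ j z z' n + bUp j φ n ^ 2 / formWeight L φ j z z' (up j n) ≤
      diagH j L φ n - r := by
  have hnext : bUp j φ n ^ 2 / formWeight L φ j z z' (up j n) =
      bUp j φ n ^ 2 / flowDiag L φ j z' (up j n) := by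
    by_cases hu : 2 ≤ n.1 0
    · rw [formWeight_of_not_isBalanced (mt (isBalanced_up hj hu).1 hn) (up_ne_pairConf_zero hj hu)]
    · simp [bUp_eq_zero hu]
  rw [hnext, formWeight_of_not_isBalanced hn hn0, flowDiag_eq hj]
  linarith

theorem le_inner_hBog_of_apply_eta_eq_zero (hj : j ≠ 0) (hz : FlowPos N L φ j z)
    (hz' : FlowPos N L φ j z') (hz0 : z ≤ 0) (hκ : 2 * (φ / N) ≤ kSq L j)
    (hzero : flowDiag L φ j z (pairConf N j 0) = 0) (hr : r ≤ z') (hr' : r ≤ z + gap0 d L)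
    {x : dom d N L} (hx : x.1 (pairConf N j 0) = 0) :
    r * ‖x.1‖ ^ 2 ≤ (inner ℂ x.1 (hBog N L φ j x)).re := by
  refine le_inner_hBog hj (u := formWeight L φ j z z') (formWeight_nonneg hj hz hz' hzero)
    (fun n hn => formWeight_pos hj hz hz' ?_) x fun n hn => ?_
  · by_contra hpair
    exact hn (bDown_eq_zero fun hmodes => hpair (by rw [pairNum]; omega))
  · by_cases hbal : IsBalanced j n
    · exact formWeight_add_le_of_isBalanced hj hz hz0 hκ hr' hbal
    · exact formWeight_add_le_of_not_isBalanced hj hr hbal fun h => hn (by rw [h, hx])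

end FormBound

/-! ### The ground state at small `ε` -/

section GroundState

variable {d N : ℕ} {j : Mode d} {L φ z r : ℝ} {ε e s : ℝ}

theorem isGroundState_and_gapAbove (hj : j ≠ 0) (hN : 0 < N) (hE : Even N)
    (hz : FlowPos N L φ j z) (hzero : flowDiag L φ j z (pairConf N j 0) = 0) (hzr : z < r)
    (hform : ∀ x : dom d N L, x.1 (pairConf N j 0) = 0 →
      r * ‖x.1‖ ^ 2 ≤ (inner ℂ x.1 (hBog N L φ j x)).re) :
    IsGroundState N L φ j z ∧ GapAbove N L φ j z (r - z) := by
  let f : dom d N L →ₗ[ℂ] ℂ :=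
    (lp.evalₗ (𝕜 := ℂ) (fun _ : Conf d N => ℂ) 2 (pairConf N j 0)) ∘ₗ (dom d N L).subtype
  have heigen := hBog_gsVector hj hN hE hz hzero
  have hf : f (gsVector N L φ j z) = 1 := gsVector_apply_eta hj hN hE hz
  have hne : gsVector N L φ j z ≠ 0 := fun h => by simp [h] at hf
  have hspec : ∀ w ∈ spec (hBog N L φ j), w ≠ z → w.im = 0 ∧ r ≤ w.re := fun w hw hwz =>
    ⟨im_eq_zero_of_mem_spec hj hw, le_re_of_mem_spec hj heigen hne
      (fun y => le_inner_of_orthogonal (f := f) (inner_hBog hj) heigen hf hzr.le hform) hw hwz⟩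
  refine ⟨⟨fun w hw => ?_, hne, heigen, fun x hx =>
    ⟨f x, eq_smul_of_eigenvector heigen hf hzr hform hx⟩⟩, fun w hw hwz => ?_⟩
  · rcases eq_or_ne w z with rfl | hwz
    · simp
    · exact (hspec w hw hwz).imp_right hzr.le.trans
  · rw [add_sub_cancel]
    exact hspec w hw hwz

theorem eBog_eq (h : SmallCoupling ε e s) (hφ : 0 < φ) (hκ : kSq L j = φ * ε) :
    eBog L φ j = -(φ * (1 + ε - e)) := by
  have hsq : kSq L j ^ 2 + 2 * φ * kSq L j = (φ * e) ^ 2 := by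
    rw [hκ]
    linear_combination -φ ^ 2 * h.e_sq
  rw [eBog, hsq, Real.sqrt_sq (mul_nonneg hφ.le h.e_pos.le), hκ]
  ring

theorem width_eq (h : SmallCoupling ε e s) (hφ : 0 < φ) (hκ : kSq L j = φ * ε) :
    width L φ j = φ * (e * s) := by
  have heps : eps L φ j = s ^ 2 := by
    rw [eps, hκ, h.s_sq, mul_div_cancel_left₀ _ hφ.ne']
  have hsq : (s ^ 2) ^ 2 + 2 * s ^ 2 = e ^ 2 := by
    rw [h.e_sq, h.s_sq]
  rw [width, heps, hsq, Real.sqrt_sq h.s_pos.le, Real.sqrt_sq h.e_pos.le]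
  ring

theorem isFixedPoint_of_flowDiag_eq_zero (h : SmallCoupling ε e s) (hN : 0 < N) (hE : Even N)
    (hφ : 0 < φ) (hκ : kSq L j = φ * ε) (hj : j ≠ 0)
    (hz : z ≤ -(φ * (1 + ε - e)) + φ * (e * s))
    (hzero : flowDiag L φ j z (pairConf N j 0) = 0) : IsFixedPoint N L φ j z := by
  have hwindow : eBog L φ j + width L φ j = -(φ * (1 + ε - e)) + φ * (e * s) := by
    rw [eBog_eq h hφ hκ, width_eq h hφ hκ]
  have hflow : ∀ w ≤ eBog L φ j + width L φ j, FlowPos N L φ j w := fun w hw =>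
    flowPos h hN hφ hκ hj (hwindow ▸ hw)
  have hanti : ∀ v w, v < w → w ≤ eBog L φ j + width L φ j →
      flowDiag L φ j w (pairConf N j 0) < flowDiag L φ j v (pairConf N j 0) := fun v w hvw hw => by
    rw [flowDiag_pairConf hj (by omega), flowDiag_pairConf hj (by omega)]
    exact chainFrac_strictAnti h (Nat.cast_pos.2 hN) hφ hκ le_rfl hvw (hwindow ▸ hw) _ _ _
      (by simp)
  rw [← hwindow] at hz
  refine ⟨fun w hw t ht => stepInvertible hj (hflow w hw) (by omega), hz, ?_, fun w hw hw0 => ?_⟩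
  · rw [fixFun_eq hj hN hE (hflow z hz), hzero, Complex.ofReal_zero]
  · rw [fixFun_eq hj hN hE (hflow w hw), Complex.ofReal_eq_zero] at hw0
    rcases lt_trichotomy w z with hlt | heq | hlt
    · exact absurd (hanti w z hlt hz) (by rw [hw0, hzero]; exact lt_irrefl 0)
    · exact heq
    · exact absurd (hanti z w hlt hw) (by rw [hw0, hzero]; exact lt_irrefl 0)

theorem norm_gsTerm_le (h : SmallCoupling ε e s) (hN : 0 < N) (hE : Even N) (hφ : 0 < φ)
    (hκ : kSq L j = φ * ε) (hj : j ≠ 0) (hz : z ≤ -(φ * (1 + ε - e)) + φ * (e * s)) {m : ℕ}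
    (hm : m < N / 2) : ‖(gsTerm N L φ j z m : Fock d N)‖ ≤ coeffBound ε e (m + 1) := by
  rw [gsTerm_eq hj hE (flowPos h hN hφ hκ hj hz) hm, Submodule.coe_smul, norm_smul, norm_basisVec,
    mul_one, Complex.norm_real, Real.norm_eq_abs, abs_neg]
  exact abs_gsCoeff_le h hN hφ hκ hj hz (by omega)

theorem five_div_le (h : SmallCoupling ε e s) (hNε : 1 / (N : ℝ) ≤ ε * s / 10) :
    5 / (e * N) ≤ e * s / 2 := by
  have he := h.e_pos
  have hs := h.s_pos
  have hse : s ≤ e := by linarith [h.s_le]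
  calc 5 / (e * N) = 5 / e * (1 / N) := by field_simp
    _ ≤ 5 / e * (ε * s / 10) := by gcongr
    _ = s ^ 2 * s / (2 * e) := by rw [h.s_sq]; field_simp; ring
    _ ≤ e ^ 2 * s / (2 * e) := by gcongr
    _ = e * s / 2 := by field_simp

theorem two_mul_div_le_kSq (h : SmallCoupling ε e s) (hφ : 0 < φ) (hκ : kSq L j = φ * ε)
    (hNε : 1 / (N : ℝ) ≤ ε * s / 10) : 2 * (φ / N) ≤ kSq L j := by
  have hε := h.eps_pos
  have hs : s ≤ 1 := by linarith [h.s_le, h.e_le]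
  have hεs : ε * s ≤ ε := mul_le_of_le_one_right hε.le hs
  have hN2 : 2 * (1 / (N : ℝ)) ≤ ε := by linarith
  calc 2 * (φ / N) = φ * (2 * (1 / N)) := by ring
    _ ≤ φ * ε := by gcongr
    _ = kSq L j := hκ.symm

theorem isGroundState_of_flowDiag_eq_zero (h : SmallCoupling ε e s) (hN : 0 < N) (hE : Even N)
    (hL : 0 < L) (hφ : 0 < φ) (hκ : kSq L j = φ * ε) (hj : j ≠ 0)
    (hNε : 1 / (N : ℝ) ≤ ε * s / 10) (hz : z ≤ -(φ * (1 + ε - e)) + φ * (e * s / 2))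
    (hzero : flowDiag L φ j z (pairConf N j 0) = 0) :
    IsGroundState N L φ j z ∧ GapAbove N L φ j z (gap0 d L / 2) := by
  have hes : 0 < φ * (e * s) := mul_pos hφ (mul_pos h.e_pos h.s_pos)
  have hwindow : z ≤ -(φ * (1 + ε - e)) + φ * (e * s) := by linarith
  have hz0 : z ≤ 0 := by
    have : 0 < φ * (1 + ε - e - e * s) := mul_pos hφ (by linarith [h.le_ratio_sub_width])
    linarith
  have hgap : gap0 d L ≤ φ * (e * s) := by
    calc gap0 d L ≤ φ * ε := hκ ▸ gap0_le L hj
      _ = φ * (s * s) := by rw [← h.s_sq, sq]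
      _ ≤ φ * (e * s) := by
        have := h.s_pos
        have : s ≤ e := by linarith [h.s_le]
        gcongr
  have hpos := gap0_pos hj hL
  have hflow := flowPos h hN hφ hκ hj hwindow
  have hbound := isGroundState_and_gapAbove (r := z + gap0 d L / 2) hj hN hE hflow hzero
    (by linarith) fun x hx => le_inner_hBog_of_apply_eta_eq_zero hj hflow
      (flowPos h hN hφ hκ hj le_rfl) hz0 (two_mul_div_le_kSq h hφ hκ hNε) hzero
      (by linarith) (by linarith) hx
  rwa [add_sub_cancel_left] at hbound

theorem exists_groundState (h : SmallCoupling ε e s) (hN : 0 < N) (hE : Even N) (hL : 0 < L)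
    (hφ : 0 < φ) (hκ : kSq L j = φ * ε) (hj : j ≠ 0) (hNε : 1 / (N : ℝ) ≤ ε * s / 10) :
    ∃ z : ℝ, IsFixedPoint N L φ j z ∧ IsGroundState N L φ j z ∧
      GapAbove N L φ j z (gap0 d L / 2) ∧
      (∀ m < N / 2, ‖(gsTerm N L φ j z m : Fock d N)‖ ≤ coeffBound ε e (m + 1)) ∧
      eBog L φ j ≤ z ∧ z ≤ eBog L φ j + φ * (5 / (e * N)) := by
  have hes : 0 < e * s := mul_pos h.e_pos h.s_pos
  have hshift := five_div_le h hNε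
  obtain ⟨z, hz_ge, hz_le, hroot⟩ :=
    exists_chainFrac_eq_zero h hN hE hφ hκ (hshift.trans (half_le_self hes.le))
  have hz : z ≤ -(φ * (1 + ε - e)) + φ * (e * s / 2) := hz_le.trans (by gcongr)
  have hwindow : z ≤ -(φ * (1 + ε - e)) + φ * (e * s) := hz.trans (by gcongr; linarith)
  have hzero : flowDiag L φ j z (pairConf N j 0) = 0 := by
    rw [flowDiag_pairConf hj (by omega)]
    simpa using hroot
  obtain ⟨hground, hgap⟩ := isGroundState_of_flowDiag_eq_zero h hN hE hL hφ hκ hj hNε hz hzero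
  rw [eBog_eq h hφ hκ]
  exact ⟨z, isFixedPoint_of_flowDiag_eq_zero h hN hE hφ hκ hj hwindow hzero, hground, hgap,
    fun m => norm_gsTerm_le h hN hE hφ hκ hj hwindow, hz_ge, hz_le⟩

end GroundState

/-! ### The regimes of parameters -/

section Regimes

variable {d N : ℕ} {j : Mode d} {γ k μ θ c C ε t z L φ ρ : ℝ}

theorem kSq_eq_mul_eps (hφ : 0 < φ) : kSq L j = φ * eps L φ j := by
  rw [eps, mul_div_cancel₀ _ hφ.ne']

theorem eps_pos (hL : 0 < L) (hφ : 0 < φ) (hj : j ≠ 0) : 0 < eps L φ j :=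
  div_pos ((gap0_pos hj hL).trans_le (gap0_le L hj)) hφ

theorem SmallCoupling.of_le (hε : 0 < ε) (hε' : ε ≤ 1 / 1000) :
    SmallCoupling ε (√(ε ^ 2 + 2 * ε)) (√ε) where
  e_pos := Real.sqrt_pos.2 (by positivity)
  s_pos := Real.sqrt_pos.2 hε
  e_sq := Real.sq_sqrt (by positivity)
  s_sq := Real.sq_sqrt hε.le
  e_le := by
    rw [Real.sqrt_le_left (by norm_num)]
    nlinarith

theorem GapAbove.mono {g g' : ℝ} (h : GapAbove N L φ j z g) (hg : g' ≤ g) :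
    GapAbove N L φ j z g' := fun w hw hwz =>
  ⟨(h w hw hwz).1, (by gcongr : z + g' ≤ z + g).trans (h w hw hwz).2⟩

theorem gapBound_le : gapBound L φ j ≤ gap0 d L / 2 := min_le_left _ _

theorem pow_three_sqrt (hε : 0 ≤ ε) : √ε ^ 3 = ε * √ε := by
  rw [pow_succ, Real.sq_sqrt hε]

theorem one_div_le_of_gammaCond (hε : 0 ≤ ε) (h : GammaCond (1 / 10) γ N ε) :
    1 / (N : ℝ) ≤ ε * √ε / 10 := by
  have hdiv : 0 ≤ ε / (N : ℝ) ^ γ := by positivity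
  linarith [h.1, sq_nonneg ε]

/-- The length `2π / √φ`, for which `√ε_j = |j| lengthScale φ / L` in a box of side `L`. -/
def lengthScale (φ : ℝ) : ℝ := 2 * Real.pi / √φ

theorem lengthScale_pos (hφ : 0 < φ) : 0 < lengthScale φ :=
  div_pos Real.two_pi_pos (Real.sqrt_pos.2 hφ)

theorem sq_lengthScale_div (hφ : 0 < φ) :
    (lengthScale φ / L) ^ 2 = (2 * Real.pi / L) ^ 2 / φ := by
  rw [lengthScale, div_right_comm, div_pow, Real.sq_sqrt hφ.le]

theorem lengthScale_div_le_sqrt_eps (hφ : 0 < φ) (hj : j ≠ 0) :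
    lengthScale φ / L ≤ √(eps L φ j) := by
  apply Real.le_sqrt_of_sq_le
  rw [sq_lengthScale_div hφ, eps]
  gcongr
  exact sq_le_kSq hj

theorem div_gap0_le (hL : 0 < L) (hφ : 0 < φ) (hj : j ≠ 0) :
    φ / gap0 d L ≤ (L / lengthScale φ) ^ 2 := by
  have := Real.pi_pos
  calc φ / gap0 d L ≤ φ / (2 * Real.pi / L) ^ 2 := by
        gcongr
        exact sq_le_gap0 hj L
    _ = (L / lengthScale φ) ^ 2 := by
        rw [← inv_div (lengthScale φ), inv_pow, sq_lengthScale_div hφ, inv_div]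

/-! ### Mean field regime -/

theorem tendsto_one_div_natCast_rpow {a : ℝ} (ha : 0 < a) :
    Tendsto (fun N : ℕ => 1 / (N : ℝ) ^ a) atTop (𝓝 0) :=
  ((tendsto_rpow_atTop ha).comp tendsto_natCast_atTop_atTop).const_div_atTop 1

theorem eventually_gammaCond (hγ : 0 < γ) (hγ1 : γ < 1) (hε : 0 < ε) (hk : √ε < k) :
    ∀ᶠ N : ℕ in atTop, GammaCond k γ N ε := by
  have hs : 0 < √ε := Real.sqrt_pos.2 hε
  have hlim : Tendsto (fun N : ℕ => ε ^ 2 + ε / (N : ℝ) ^ γ + 1 / (N : ℝ)) atTop (𝓝 (ε ^ 2)) := by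
    simpa [div_eq_mul_inv] using
      (((tendsto_one_div_natCast_rpow hγ).const_mul ε).const_add (ε ^ 2)).add
        tendsto_one_div_atTop_nhds_zero_nat
  have hlt : ε ^ 2 < k * ε * √ε := by
    calc ε ^ 2 = √ε * (ε * √ε) := by rw [mul_left_comm, Real.mul_self_sqrt hε.le, sq]
      _ < k * (ε * √ε) := by gcongr
      _ = k * ε * √ε := (mul_assoc ..).symm
  exact (hlim.eventually_le_const hlt).and <|
    (tendsto_one_div_natCast_rpow (sub_pos.2 hγ1)).eventually_le_const (mul_pos (hs.trans hk) hε)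

theorem eventually_rpow_le_half (hμ1 : μ < 1) : ∀ᶠ N : ℕ in atTop, (N : ℝ) ^ μ ≤ N / 2 := by
  filter_upwards [(tendsto_one_div_natCast_rpow (sub_pos.2 hμ1)).eventually_le_const
    (by norm_num : (0 : ℝ) < 1 / 2), eventually_gt_atTop 0] with N hle hN
  have hN' : (0 : ℝ) < N := by exact_mod_cast hN
  calc (N : ℝ) ^ μ = N * (1 / (N : ℝ) ^ (1 - μ)) := by
        rw [Real.rpow_sub hN', Real.rpow_one]
        field_simp
    _ ≤ N * (1 / 2) := by gcongr
    _ = N / 2 := by ring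

theorem eventually_muCond (hμ : 0 < μ) (hμ1 : μ < 1) (hC : 0 < C) (hL : 0 < L) (hφ : 0 < φ)
    (hj : j ≠ 0) : ∀ᶠ N : ℕ in atTop, MuCond μ θ C N L φ j := by
  have hs : 0 < √(eps L φ j) := Real.sqrt_pos.2 (eps_pos hL hφ hj)
  have hgap := gap0_pos hj hL
  have hlim : Tendsto (fun N : ℕ => φ / gap0 d L * (1 / (N : ℝ))) atTop (𝓝 0) := by
    simpa using (tendsto_one_div_atTop_nhds_zero_nat (𝕜 := ℝ)).const_mul (φ / gap0 d L)
  filter_upwards [hlim.eventually_lt_const (by norm_num : (0 : ℝ) < 1 / 2),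
    eventually_rpow_le_half hμ1, eventually_gt_atTop 0,
    (tendsto_one_div_natCast_rpow hμ).eventually_le_const
      (by positivity : 0 < C * √(eps L φ j) ^ (1 + θ))] with N hlt hhalf hN hle
  have : (0 : ℝ) < N := by exact_mod_cast hN
  refine ⟨lt_of_le_of_lt (mul_le_mul_of_nonneg_left ?_ (by positivity)) hlt, hle⟩
  calc (N : ℝ) ^ μ / (N * (N - (N : ℝ) ^ μ)) ≤ (N / 2) / (N * (N / 2)) := by
        gcongr
        linarith
    _ = 1 / N := by field_simp

theorem exists_tendsto_groundState (hL : 0 < L) (hφ : 0 < φ) (hj : j ≠ 0)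
    (hε : eps L φ j ≤ 1 / 1000) : ∃ z : ℕ → ℝ,
      (∀ᶠ m : ℕ in atTop, IsFixedPoint (2 * m) L φ j (z m) ∧
        IsGroundState (2 * m) L φ j (z m) ∧ GapAbove (2 * m) L φ j (z m) (gap0 d L / 2)) ∧
      Tendsto z atTop (𝓝 (eBog L φ j)) := by
  have h := SmallCoupling.of_le (eps_pos hL hφ hj) hε
  have := h.s_pos
  have hε0 := h.eps_pos
  have hN : Tendsto (fun m : ℕ => ((2 * m : ℕ) : ℝ)) atTop atTop :=
    tendsto_natCast_atTop_atTop.comp (tendsto_id.const_mul_atTop' two_pos)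
  have hexists : ∀ᶠ m : ℕ in atTop, ∃ z : ℝ,
      (IsFixedPoint (2 * m) L φ j z ∧ IsGroundState (2 * m) L φ j z ∧
        GapAbove (2 * m) L φ j z (gap0 d L / 2)) ∧ eBog L φ j ≤ z ∧
        z ≤ eBog L φ j + φ * (5 / (√(eps L φ j ^ 2 + 2 * eps L φ j) * ((2 * m : ℕ) : ℝ))) := by
    filter_upwards [eventually_gt_atTop 0, (hN.const_div_atTop 1).eventually_le_const
      (by positivity : 0 < eps L φ j * √(eps L φ j) / 10)] with m hm hNε
    obtain ⟨z, hfix, hground, hgap, _, hz_ge, hz_le⟩ := exists_groundState h (by omega)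
      (even_two_mul m) hL hφ (kSq_eq_mul_eps hφ) hj hNε
    exact ⟨z, ⟨hfix, hground, hgap⟩, hz_ge, hz_le⟩
  obtain ⟨z, hz⟩ := hexists.choice
  have hbound := (((hN.const_mul_atTop h.e_pos).const_div_atTop 5).const_mul φ).const_add
    (eBog L φ j)
  rw [mul_zero, add_zero] at hbound
  exact ⟨z, hz.mono fun m hm => hm.1, tendsto_of_tendsto_of_tendsto_of_le_of_le'
    tendsto_const_nhds hbound (hz.mono fun m hm => hm.2.1) (hz.mono fun m hm => hm.2.2)⟩

/-! ### Fixed density -/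

theorem pos_of_density (hρ : 0 < ρ) (hL : 0 < L) (hN : (N : ℝ) = ρ * L ^ d) : 0 < N := by
  have : (0 : ℝ) < N := by rw [hN]; positivity
  exact_mod_cast this

theorem mul_le_rpow_of_density (ht : 0 ≤ t) (hρ : t ^ 3 ≤ ρ) (hL : 1 ≤ L) (hd : 3 ≤ d)
    (hN : (N : ℝ) = ρ * L ^ d) : t * L ≤ (N : ℝ) ^ (1 / 3 : ℝ) := by
  rw [one_div, Real.le_rpow_inv_iff_of_pos (by positivity) (by positivity) (by norm_num), hN]
  norm_cast
  rw [mul_pow]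
  gcongr
  exact (pow_nonneg ht 3).trans hρ

theorem gammaCond_of_one_div_le (hε : 0 < ε) (hεk : √ε ≤ k / 3) (hc : c ≤ 1) (hck : c ≤ k / 3)
    (h : 1 / (N : ℝ) ^ (1 / 3 : ℝ) ≤ c * √ε) : GammaCond k (1 / 3) N ε := by
  have hs : 0 < √ε := Real.sqrt_pos.2 hε
  have hss : √ε ^ 2 = ε := Real.sq_sqrt hε.le
  have hc0 : 0 ≤ c := nonneg_of_mul_nonneg_left ((by positivity : (0 : ℝ) ≤ _).trans h) hs
  set M := (N : ℝ) ^ (1 / 3 : ℝ) with hM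
  have : 0 ≤ M := by positivity
  have hM3 : (N : ℝ) = M ^ 3 := by
    rw [hM, ← Real.rpow_natCast, ← Real.rpow_mul N.cast_nonneg]
    norm_num
  have hM2 : (N : ℝ) ^ (1 - 1 / 3 : ℝ) = M ^ 2 := by
    rw [hM, ← Real.rpow_natCast, ← Real.rpow_mul N.cast_nonneg]
    norm_num
  constructor
  · have hsq : ε ^ 2 ≤ k / 3 * (ε * √ε) := by
      calc ε ^ 2 = √ε * (ε * √ε) := by rw [mul_left_comm, Real.mul_self_sqrt hε.le, sq]
        _ ≤ k / 3 * (ε * √ε) := by gcongr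
    have hdiv : ε / M ≤ k / 3 * (ε * √ε) := by
      calc ε / M = ε * (1 / M) := div_eq_mul_one_div ..
        _ ≤ ε * (k / 3 * √ε) := by grw [h, hck]
        _ = k / 3 * (ε * √ε) := mul_left_comm ..
    have hinv : 1 / (N : ℝ) ≤ k / 3 * (ε * √ε) := by
      calc 1 / (N : ℝ) = (1 / M) ^ 3 := by rw [hM3, one_div_pow]
        _ ≤ (c * √ε) ^ 3 := by gcongr
        _ = c ^ 3 * (ε * √ε) := by rw [mul_pow, pow_three_sqrt hε.le]
        _ ≤ k / 3 * (ε * √ε) := by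
            grw [pow_le_of_le_one hc0 hc three_ne_zero, hck]
    linarith
  · calc 1 / (N : ℝ) ^ (1 - 1 / 3 : ℝ) = (1 / M) ^ 2 := by rw [hM2, one_div_pow]
      _ ≤ (c * √ε) ^ 2 := by gcongr
      _ = c ^ 2 * ε := by rw [mul_pow, hss]
      _ ≤ k * ε := by
          grw [pow_le_of_le_one hc0 hc two_ne_zero]
          gcongr
          linarith

theorem muCond_of_one_div_le (hL : 0 < L) (hφ : 0 < φ) (hj : j ≠ 0) (hc : c ≤ 1) (hcC : c ≤ C)
    (hN : 2 < (N : ℝ) ^ (1 / 3 : ℝ)) (hLN : L / lengthScale φ ≤ c * (N : ℝ) ^ (1 / 3 : ℝ))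
    (h : 1 / (N : ℝ) ^ (1 / 3 : ℝ) ≤ c * √(eps L φ j)) : MuCond (2 / 3) 1 C N L φ j := by
  have hs : 0 < √(eps L φ j) := Real.sqrt_pos.2 (eps_pos hL hφ hj)
  have hc0 : 0 ≤ c := nonneg_of_mul_nonneg_left ((by positivity : (0 : ℝ) ≤ _).trans h) hs
  have hℓ := lengthScale_pos hφ
  set M := (N : ℝ) ^ (1 / 3 : ℝ) with hM
  have : 0 < M := two_pos.trans hN
  have hM3 : (N : ℝ) = M ^ 3 := by
    rw [hM, ← Real.rpow_natCast, ← Real.rpow_mul N.cast_nonneg]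
    norm_num
  have hM2 : (N : ℝ) ^ (2 / 3 : ℝ) = M ^ 2 := by
    rw [hM, ← Real.rpow_natCast, ← Real.rpow_mul N.cast_nonneg]
    norm_num
  rw [MuCond, hM2, hM3]
  constructor
  · have hM1 : 0 < M - 1 := by linarith
    calc φ / gap0 d L * (M ^ 2 / (M ^ 3 * (M ^ 3 - M ^ 2)))
        = φ / gap0 d L * (1 / (M ^ 3 * (M - 1))) := by
          rw [show M ^ 3 * (M ^ 3 - M ^ 2) = M ^ 2 * (M ^ 3 * (M - 1)) by ring, ← div_div,
            div_self (by positivity)]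
      _ ≤ M ^ 2 * (1 / (M ^ 3 * (M - 1))) := by
          grw [div_gap0_le hL hφ hj, hLN, hc, one_mul]
      _ = 1 / (M * (M - 1)) := by field_simp
      _ < 1 / 2 := by
          apply one_div_lt_one_div_of_lt two_pos
          nlinarith
  · calc 1 / M ^ 2 = (1 / M) ^ 2 := (one_div_pow ..).symm
      _ ≤ (c * √(eps L φ j)) ^ 2 := by gcongr
      _ = c ^ 2 * √(eps L φ j) ^ 2 := mul_pow ..
      _ ≤ C * √(eps L φ j) ^ 2 := by grw [pow_le_of_le_one hc0 hc two_ne_zero, hcC]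
      _ = C * √(eps L φ j) ^ (1 + 1 : ℝ) := by norm_num

theorem conditions_of_density (hφ : 0 < φ) (hj : j ≠ 0) (hεk : √(eps L φ j) ≤ k / 3) (hc : 0 < c)
    (hc1 : c ≤ 1) (hck : c ≤ k / 3) (hcC : c ≤ C) (hd : 3 ≤ d)
    (hρ : max 2 (1 / (c * lengthScale φ)) ^ 3 ≤ ρ) (hL : 1 < L) (hN : (N : ℝ) = ρ * L ^ d) :
    GammaCond k (1 / 3) N (eps L φ j) ∧ MuCond (2 / 3) 1 C N L φ j := by
  have hL0 : 0 < L := one_pos.trans hL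
  have hℓ := lengthScale_pos hφ
  have hM := mul_le_rpow_of_density (by positivity) hρ hL.le hd hN
  have htwo : 2 < (N : ℝ) ^ (1 / 3 : ℝ) := by
    grw [← hM, ← le_max_left]
    linarith
  have hLN : L / lengthScale φ ≤ c * (N : ℝ) ^ (1 / 3 : ℝ) := by
    grw [← hM, ← le_max_right]
    exact le_of_eq (by field_simp)
  have hone_div : 1 / (N : ℝ) ^ (1 / 3 : ℝ) ≤ c * √(eps L φ j) := by
    grw [← lengthScale_div_le_sqrt_eps hφ hj]
    rw [div_le_iff₀ (two_pos.trans htwo), mul_right_comm, ← mul_div_assoc, le_div_iff₀ hL0, one_mul]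
    rwa [div_le_iff₀ hℓ] at hLN
  exact ⟨gammaCond_of_one_div_le (eps_pos hL0 hφ hj) hεk hc1 hck hone_div,
    muCond_of_one_div_le hL0 hφ hj hc1 hcC htwo hLN hone_div⟩

theorem exists_density_conditions (hk : 0 < k) (hC : 0 < C) (hφ : 0 < φ) :
    ∃ ρ₀ : ℝ, 0 < ρ₀ ∧ ∀ (d N : ℕ) (ρ L : ℝ) (j : Mode d), 3 ≤ d → ρ₀ ≤ ρ → 1 < L → j ≠ 0 →
      (N : ℝ) = ρ * L ^ d → eps L φ j ≤ (k / 3) ^ 2 →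
      GammaCond k (1 / 3) N (eps L φ j) ∧ MuCond (2 / 3) 1 C N L φ j := by
  have hc : 0 < min 1 (min (k / 3) C) := by positivity
  have := lengthScale_pos hφ
  exact ⟨max 2 (1 / (min 1 (min (k / 3) C) * lengthScale φ)) ^ 3, by positivity,
    fun d N ρ L j hd hρ hL hj hN hε => conditions_of_density hφ hj
      ((Real.sqrt_le_left (by positivity)).2 hε) hc (min_le_left ..)
      ((min_le_right ..).trans (min_le_left ..)) ((min_le_right ..).trans (min_le_right ..))
      hd hρ hL hN⟩

theorem one_div_le_of_density (hφ : 0 < φ) (hρ : 10 / lengthScale φ ^ 3 ≤ ρ) (hL : 1 ≤ L)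
    (hd : 3 ≤ d) (hN : (N : ℝ) = ρ * L ^ d) : 1 / (N : ℝ) ≤ (lengthScale φ / L) ^ 3 / 10 := by
  have hℓ := lengthScale_pos hφ
  have hρ0 : 0 ≤ ρ := le_trans (by positivity) hρ
  rw [hN]
  calc 1 / (ρ * L ^ d) ≤ 1 / (10 / lengthScale φ ^ 3 * L ^ 3) := by gcongr
    _ = (lengthScale φ / L) ^ 3 / 10 := by field_simp

theorem exists_groundState_of_one_div_le (hφ : 0 < φ) (hj : j ≠ 0) (hL : 0 < L) (hN : 0 < N)
    (hE : Even N) (hNL : 1 / (N : ℝ) ≤ (lengthScale φ / L) ^ 3 / 10)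
    (hε : eps L φ j ≤ 1 / 1000) :
    ∃ z : ℝ, IsFixedPoint N L φ j z ∧ IsGroundState N L φ j z ∧
      GapAbove N L φ j z (gap0 d L / 2) ∧ eBog L φ j ≤ z := by
  have hε0 := eps_pos hL hφ hj
  have hℓ := lengthScale_pos hφ
  have hNε : 1 / (N : ℝ) ≤ eps L φ j * √(eps L φ j) / 10 := by
    grw [hNL, lengthScale_div_le_sqrt_eps hφ hj, pow_three_sqrt hε0.le]
  obtain ⟨z, hfix, hground, hgap, _, hz, _⟩ := exists_groundState
    (SmallCoupling.of_le hε0 hε) hN hE hL hφ (kSq_eq_mul_eps hφ) hj hNε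
  exact ⟨z, hfix, hground, hgap, hz⟩

theorem exists_density_groundState (hφ : 0 < φ) :
    ∃ ρ₀ : ℝ, 0 < ρ₀ ∧ ∀ (d N : ℕ) (ρ L : ℝ) (j : Mode d), 3 ≤ d → ρ₀ ≤ ρ → 1 < L → j ≠ 0 →
      Even N → (N : ℝ) = ρ * L ^ d → eps L φ j ≤ 1 / 1000 →
      ∃ z : ℝ, IsFixedPoint N L φ j z ∧ IsGroundState N L φ j z ∧
        GapAbove N L φ j z (gap0 d L / 2) := by
  have hℓ := lengthScale_pos hφ
  have hρ₀ : 0 < 10 / lengthScale φ ^ 3 := by positivity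
  refine ⟨_, hρ₀, fun d N ρ L j hd hρ hL hj hE hN hε => ?_⟩
  have hL0 : 0 < L := one_pos.trans hL
  obtain ⟨z, hfix, hground, hgap, _⟩ := exists_groundState_of_one_div_le hφ hj hL0
    (pos_of_density (hρ₀.trans_le hρ) hL0 hN) hE (one_div_le_of_density hφ hρ hL.le hd hN) hε
  exact ⟨z, hfix, hground, hgap⟩

/-! ### The limit of large boxes -/

theorem eps_eq_div_sq (L φ : ℝ) (j : Mode d) : eps L φ j = eps 1 φ j / L ^ 2 := by
  have hscale : kSq L j = kSq 1 j / L ^ 2 := by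
    simp only [kSq, Finset.sum_div]
    exact Finset.sum_congr rfl fun i _ => by ring
  rw [eps, eps, hscale, div_right_comm]

theorem tendsto_eps (φ : ℝ) (j : Mode d) : Tendsto (fun L => eps L φ j) atTop (𝓝 0) :=
  ((tendsto_pow_atTop two_ne_zero).const_div_atTop (eps 1 φ j)).congr fun L =>
    (eps_eq_div_sq L φ j).symm

theorem tendsto_width (φ : ℝ) (j : Mode d) : Tendsto (fun L => width L φ j) atTop (𝓝 0) := by
  have hcont : Continuous fun ε : ℝ => √ε * φ * √(ε ^ 2 + 2 * ε) := by fun_prop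
  have hlim := (hcont.tendsto 0).comp (tendsto_eps φ j)
  simpa only [Function.comp_def, width, Real.sqrt_zero, zero_mul] using hlim

theorem eventually_exists_abs_sub_eBog_lt (hφ : 0 < φ) (hj : j ≠ 0) {δ : ℝ} (hδ : 0 < δ) :
    ∀ᶠ L in atTop, ∀ N : ℕ, 0 < N → Even N → 1 / (N : ℝ) ≤ (lengthScale φ / L) ^ 3 / 10 →
      ∃ z : ℝ, IsFixedPoint N L φ j z ∧ IsGroundState N L φ j z ∧ |z - eBog L φ j| < δ := by
  filter_upwards [(tendsto_eps φ j).eventually_le_const (by norm_num : (0 : ℝ) < 1 / 1000),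
    (tendsto_width φ j).eventually_lt_const hδ, eventually_gt_atTop 0]
    with L hε hwidth hL N hN hE hNL
  obtain ⟨z, hfix, hground, _, hz⟩ := exists_groundState_of_one_div_le hφ hj hL hN hE hNL hε
  refine ⟨z, hfix, hground, ?_⟩
  rw [abs_of_nonneg (sub_nonneg.2 hz)]
  linarith [hfix.le]

theorem exists_forall_abs_sub_eBog_lt_of_four_le (hd : 4 ≤ d) (hρ : 0 < ρ) (hφ : 0 < φ)
    (hj : j ≠ 0) {δ : ℝ} (hδ : 0 < δ) :
    ∃ L₀ : ℝ, 0 < L₀ ∧ ∀ (N : ℕ) (L : ℝ), L₀ ≤ L → Even N → (N : ℝ) = ρ * L ^ d →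
      ∃ z : ℝ, IsFixedPoint N L φ j z ∧ IsGroundState N L φ j z ∧ |z - eBog L φ j| < δ := by
  have hlarge : ∀ᶠ L in atTop, 10 / lengthScale φ ^ 3 ≤ ρ * L :=
    (tendsto_id.const_mul_atTop hρ).eventually_ge_atTop _
  obtain ⟨L₀, hL₀, h⟩ := (atTop_basis' 1).eventually_iff.1
    ((eventually_exists_abs_sub_eBog_lt hφ hj hδ).and hlarge)
  refine ⟨L₀, by linarith, fun N L hL hE hN => ?_⟩
  have hL1 : 1 ≤ L := hL₀.trans hL
  -- In dimension `d ≥ 4` a box of density `ρ` has the density `ρ L` of dimension `d - 1`.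
  have hN' : (N : ℝ) = ρ * L * L ^ (d - 1) := by
    rw [hN, mul_assoc, ← pow_succ', Nat.sub_add_cancel (by omega)]
  exact (h hL).1 N (pos_of_density hρ (by linarith) hN) hE
    (one_div_le_of_density hφ (h hL).2 hL1 (by omega) hN')

theorem exists_density_forall_abs_sub_eBog_lt (hφ : 0 < φ) :
    ∃ ρ₀ : ℝ, 0 < ρ₀ ∧ ∀ (d : ℕ) (ρ : ℝ) (j : Mode d), 3 ≤ d → ρ₀ ≤ ρ → j ≠ 0 →
      ∀ δ : ℝ, 0 < δ → ∃ L₀ : ℝ, 0 < L₀ ∧ ∀ (N : ℕ) (L : ℝ), L₀ ≤ L → Even N →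
        (N : ℝ) = ρ * L ^ d →
        ∃ z : ℝ, IsFixedPoint N L φ j z ∧ IsGroundState N L φ j z ∧ |z - eBog L φ j| < δ := by
  have hℓ := lengthScale_pos hφ
  have hρ₀ : 0 < 10 / lengthScale φ ^ 3 := by positivity
  refine ⟨_, hρ₀, fun d ρ j hd hρ hj δ hδ => ?_⟩
  obtain ⟨L₀, hL₀, h⟩ := (atTop_basis' 1).eventually_iff.1
    (eventually_exists_abs_sub_eBog_lt hφ hj hδ)
  refine ⟨L₀, by linarith, fun N L hL hE hN => ?_⟩
  have hL1 : 1 ≤ L := hL₀.trans hL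
  exact h hL N (pos_of_density (hρ₀.trans_le hρ) (by linarith) hN) hE
    (one_div_le_of_density hφ hρ hL1 hd hN)

end Regimes

end ThreeMode

end

open ThreeMode

theorem mainTheorem1_general {ε : ℝ} (hε : 0 < ε) (hε' : ε ≤ 1 / 1000) :
    ∃ c : ℕ → ℝ, Summable c ∧
      ∀ (d N : ℕ) (L φ : ℝ) (j : Mode d), 0 < N → Even N → 0 < L → 0 < φ → j ≠ 0 →
        eps L φ j = ε → 1 / (N : ℝ) ≤ ε * √ε / 10 →
        ∃ z : ℝ, IsFixedPoint N L φ j z ∧ IsGroundState N L φ j z ∧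
          GapAbove N L φ j z (gap0 d L / 2) ∧
          (∀ m < N / 2, ‖(gsTerm N L φ j z m : Fock d N)‖ ≤ c m) ∧
          eBog L φ j ≤ z ∧ z ≤ eBog L φ j + φ * (5 / (√(ε ^ 2 + 2 * ε) * N)) := by
  have h := SmallCoupling.of_le hε hε'
  refine ⟨_, (summable_nat_add_iff 1).2 (summable_coeffBound h), ?_⟩
  rintro d N L φ j hN hE hL hφ hj rfl hNε
  exact exists_groundState h hN hE hL hφ (kSq_eq_mul_eps hφ) hj hNε

theorem mainTheorem1 :
    -- under the two conditions: fixed point, ground state, gap, convergent expansion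
    (∀ γ : ℝ, 0 < γ → γ < 1 → ∃ k : ℝ, 0 < k ∧
      ∀ μ θ C : ℝ, 0 < μ → μ < 1 → 0 < θ → 0 < C → ∃ ε₀ : ℝ, 0 < ε₀ ∧
        ∀ ε : ℝ, 0 < ε → ε ≤ ε₀ → ∃ c : ℕ → ℝ, Summable c ∧
          ∀ (d N : ℕ) (L φ : ℝ) (j : Mode d), 0 < N → Even N → 0 < L → 0 < φ → j ≠ 0 →
            eps L φ j = ε → GammaCond k γ N ε → MuCond μ θ C N L φ j →
            ∃ z : ℝ, IsFixedPoint N L φ j z ∧ IsGroundState N L φ j z ∧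
              GapAbove N L φ j z (gapBound L φ j) ∧
              ∀ m < N / 2, ‖(gsTerm N L φ j z m : Fock d N)‖ ≤ c m) ∧
    -- the conditions hold in the mean field limiting regime, in every dimension
    (∀ γ k μ θ C : ℝ, 0 < γ → γ < 1 → 0 < k → 0 < μ → μ < 1 → 0 < θ → 0 < C →
      ∃ ε₀ : ℝ, 0 < ε₀ ∧ ∀ (d : ℕ) (L φ : ℝ) (j : Mode d), 0 < L → 0 < φ → j ≠ 0 →
        eps L φ j ≤ ε₀ →
        ∀ᶠ N : ℕ in atTop, GammaCond k γ N (eps L φ j) ∧ MuCond μ θ C N L φ j) ∧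
    -- the conditions hold for `d ≥ 3` at fixed large density in arbitrarily large boxes
    (∀ k C : ℝ, 0 < k → 0 < C → ∃ ε₀ : ℝ, 0 < ε₀ ∧ ∀ φ : ℝ, 0 < φ → ∃ ρ₀ : ℝ, 0 < ρ₀ ∧
      ∀ (d N : ℕ) (ρ L : ℝ) (j : Mode d), 3 ≤ d → ρ₀ ≤ ρ → 1 < L → j ≠ 0 →
        (N : ℝ) = ρ * L ^ d → eps L φ j ≤ ε₀ →
        GammaCond k (1 / 3) N (eps L φ j) ∧ MuCond (2 / 3) 1 C N L φ j) ∧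
    -- mean field limiting regime: ground state energy and its limit, gap `Δ₀ / 2`
    (∃ ε₀ : ℝ, 0 < ε₀ ∧ ∀ (d : ℕ) (L φ : ℝ) (j : Mode d), 0 < L → 0 < φ → j ≠ 0 →
      eps L φ j ≤ ε₀ → ∃ z : ℕ → ℝ,
        (∀ᶠ m : ℕ in atTop, IsFixedPoint (2 * m) L φ j (z m) ∧
          IsGroundState (2 * m) L φ j (z m) ∧ GapAbove (2 * m) L φ j (z m) (gap0 d L / 2)) ∧
        Tendsto z atTop (𝓝 (eBog L φ j))) ∧
    -- `d ≥ 3`, fixed large density, arbitrary box: ground state energy and gap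
    (∃ ε₀ : ℝ, 0 < ε₀ ∧ ∀ φ : ℝ, 0 < φ → ∃ ρ₀ : ℝ, 0 < ρ₀ ∧
      ∀ (d N : ℕ) (ρ L : ℝ) (j : Mode d), 3 ≤ d → ρ₀ ≤ ρ → 1 < L → j ≠ 0 → Even N →
        (N : ℝ) = ρ * L ^ d → eps L φ j ≤ ε₀ →
        ∃ z : ℝ, IsFixedPoint N L φ j z ∧ IsGroundState N L φ j z ∧
          GapAbove N L φ j z (gapBound L φ j)) ∧
    -- convergence of the ground state energy as `L → ∞` for `d ≥ 4` at fixed density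
    (∀ (d : ℕ) (ρ φ : ℝ) (j : Mode d), 4 ≤ d → 0 < ρ → 0 < φ → j ≠ 0 →
      ∀ δ : ℝ, 0 < δ → ∃ L₀ : ℝ, 0 < L₀ ∧ ∀ (N : ℕ) (L : ℝ), L₀ ≤ L → Even N →
        (N : ℝ) = ρ * L ^ d →
        ∃ z : ℝ, IsFixedPoint N L φ j z ∧ IsGroundState N L φ j z ∧ |z - eBog L φ j| < δ) ∧
    -- the same for `d = 3` at fixed large density
    (∀ φ : ℝ, 0 < φ → ∃ ρ₀ : ℝ, 0 < ρ₀ ∧ ∀ (ρ : ℝ) (j : Mode 3), ρ₀ ≤ ρ → j ≠ 0 →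
      ∀ δ : ℝ, 0 < δ → ∃ L₀ : ℝ, 0 < L₀ ∧ ∀ (N : ℕ) (L : ℝ), L₀ ≤ L → Even N →
        (N : ℝ) = ρ * L ^ 3 →
        ∃ z : ℝ, IsFixedPoint N L φ j z ∧ IsGroundState N L φ j z ∧ |z - eBog L φ j| < δ) := by
  refine ⟨fun γ _ _ => ⟨1 / 10, by norm_num, fun μ θ C _ _ _ _ => ⟨1 / 1000, by norm_num,
      fun ε hε hε' => ?_⟩⟩,
    fun γ k μ θ C hγ hγ1 hk hμ hμ1 _ hC => ⟨(k / 2) ^ 2, by positivity,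
      fun d L φ j hL hφ hj hε => ?_⟩,
    fun k C hk hC => ⟨(k / 3) ^ 2, by positivity, fun φ => exists_density_conditions hk hC⟩,
    ⟨1 / 1000, by norm_num, fun d L φ j => exists_tendsto_groundState⟩,
    ⟨1 / 1000, by norm_num, fun φ hφ => ?_⟩,
    fun d ρ φ j hd hρ hφ hj δ => exists_forall_abs_sub_eBog_lt_of_four_le hd hρ hφ hj,
    fun φ hφ => ?_⟩
  · obtain ⟨c, hc, hground⟩ := mainTheorem1_general hε hε'
    refine ⟨c, hc, fun d N L φ j hN hE hL hφ hj heps hγN _ => ?_⟩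
    obtain ⟨z, hfix, hz, hgap, hterm, _⟩ :=
      hground d N L φ j hN hE hL hφ hj heps (one_div_le_of_gammaCond hε.le hγN)
    exact ⟨z, hfix, hz, hgap.mono gapBound_le, hterm⟩
  · have hk2 : √(eps L φ j) < k :=
      ((Real.sqrt_le_left (by positivity)).2 hε).trans_lt (half_lt_self hk)
    exact (eventually_gammaCond hγ hγ1 (eps_pos hL hφ hj) hk2).and
      (eventually_muCond hμ hμ1 hC hL hφ hj)
  · obtain ⟨ρ₀, hρ₀, h⟩ := exists_density_groundState hφ
    refine ⟨ρ₀, hρ₀, fun d N ρ L j hd hρ hL hj hE hN hε => ?_⟩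
    obtain ⟨z, hfix, hz, hgap⟩ := h d N ρ L j hd hρ hL hj hE hN hε
    exact ⟨z, hfix, hz, hgap.mono gapBound_le⟩
  · obtain ⟨ρ₀, hρ₀, h⟩ := exists_density_forall_abs_sub_eBog_lt hφ
    exact ⟨ρ₀, hρ₀, fun ρ j => h 3 ρ j le_rfl⟩
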